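/- Equip $\mathbb{R}^4$ (coordinates $x_1,y_1,x_2,y_2$) with $\omega=dx_1\wedge dy_1+dx_2\wedge dy_2$ and $\lambda=\tfrac12\sum_j (x_j\,dy_j-y_j\,dx_j)$, so $d\lambda=\omega$. A closed starshaped hypersurface is a set $N=\{f(u)u : u\in S^3\}\subset\mathbb{R}^4$ with $f:S^3\to(0,\infty)$ smooth. The form $\alpha=\lambda|_N$ is a contact form; its Reeb vector field $R$ is the vector field tangent to $N$ with $\alpha(R)=1$ and $d\alpha(R,\cdot)=0$ on $TN$, and the Reeb flow of $N$ is the flow of $R$. A set $A\subset N$ is invariant if every Reeb trajectory $\mathbb{R}\to N$ starting in $A$ stays in $A$ for all positive and negative times. The Reeb flow is ergodic if every invariant Borel set $A\subset N$ has zero measure or full measure for the volume measure $|\alpha\wedge d\alpha|$. A closed Lagrangian is a nonempty compact smooth embedded surface $L\subset\mathbb{R}^4$ without boundary (not necessarily connected or orientable) with $\omega|_{TL}=0$. 1. There exists a closed starshaped hypersurface $N\subset\mathbb{R}^4$ which does not contain any closed Lagrangian. 2. If $N\subset\mathbb{R}^4$ is a closed starshaped hypersurface whose Reeb flow is ergodic,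 then $N$ does not contain any closed Lagrangian. 3. If $N\subset\mathbb{R}^4$ is a closed starshaped hypersurface whose Reeb flow has a dense trajectory (a trajectory $\mathbb{R}\to N$ with dense image), then $N$ does not contain any closed Lagrangian. 4. If a closed starshaped hypersurface $N\subset\mathbb{R}^4$ contains a closed Lagrangian $L$, then $N\setminus L$ is the union of two disjoint nonempty subsets that are open in $N$ and invariant under the Reeb flow. -/

import Mathlib

open MeasureTheory Metric Topology
open scoped ContDiff ENNReal

/-- `ℝ⁴` with its Euclidean structure and coordinates `(x₁, y₁, x₂, y₂)`. -/
abbrev R4 : Type := EuclideanSpace ℝ (Fin 4)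

/-- The standard symplectic form `ω = dx₁ ∧ dy₁ + dx₂ ∧ dy₂` on `ℝ⁴`. -/
def symplecticForm (v w : R4) : ℝ :=
  (v 0 * w 1 - v 1 * w 0) + (v 2 * w 3 - v 3 * w 2)

/-- The radial Liouville form `λ = ½ ∑ (xⱼ dyⱼ - yⱼ dxⱼ)` at the point `x`, applied to `v`.
Its exterior derivative is `ω`; on a starshaped hypersurface it restricts to a contact form. -/
noncomputable def liouvilleForm (x v : R4) : ℝ :=
  ((x 0 * v 1 - x 1 * v 0) + (x 2 * v 3 - x 3 * v 2)) / 2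

/-- The 3-form `λ ∧ dλ = λ ∧ ω` at the point `x`, applied to `(u, v, w)`. -/
noncomputable def contactVolumeForm (x u v w : R4) : ℝ :=
  liouvilleForm x u * symplecticForm v w + liouvilleForm x v * symplecticForm w u
    + liouvilleForm x w * symplecticForm u v

/-- The tangent space at `x` of a smooth embedded submanifold `S ⊆ ℝ⁴`: the velocities at time `0`
of smooth curves through `x` that stay in `S` for small times. -/
def tangentVectors (S : Set R4) (x : R4) : Set R4 :=
  {v | ∃ c : ℝ → R4, ContDiff ℝ ∞ c ∧ c 0 = x ∧ (∀ᶠ t in 𝓝 (0 : ℝ), c t ∈ S) ∧ deriv c 0 = v}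

/-- A closed smooth hypersurface of `ℝ⁴`, starshaped about the origin: the radial graph of a smooth
positive function on the unit sphere `S³` (given through a smooth extension to `ℝ⁴ ∖ {0}`). It meets
every ray from the origin in exactly one point, transversely. -/
def IsClosedStarshapedHypersurface (N : Set R4) : Prop :=
  ∃ f : R4 → ℝ, ContDiffOn ℝ ∞ f {0}ᶜ ∧ (∀ u ∈ sphere (0 : R4) 1, 0 < f u) ∧
    N = (fun u => f u • u) '' sphere (0 : R4) 1

/-- A smooth embedded surface in `ℝ⁴`, without boundary: locally the regular zero set of a smooth map
to `ℝ²`. -/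
def IsEmbeddedSurface (L : Set R4) : Prop :=
  ∀ x ∈ L, ∃ U : Set R4, IsOpen U ∧ x ∈ U ∧ ∃ g : R4 → EuclideanSpace ℝ (Fin 2),
    ContDiffOn ℝ ∞ g U ∧ (∀ y ∈ U, Function.Surjective (fderiv ℝ g y)) ∧
    L ∩ U = {y ∈ U | g y = 0}

/-- A closed Lagrangian in `ℝ⁴`: a nonempty compact embedded surface without boundary on whose
tangent planes `ω` vanishes. It need be neither connected nor orientable. -/
def IsClosedLagrangian (L : Set R4) : Prop :=
  L.Nonempty ∧ IsCompact L ∧ IsEmbeddedSurface L ∧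
    ∀ x ∈ L, ∀ v ∈ tangentVectors L x, ∀ w ∈ tangentVectors L x, symplecticForm v w = 0

/-- `v` is the value at `x ∈ N` of the Reeb vector field of the contact form `α = λ|_N`:
`v ∈ T_x N`, `α(v) = 1` and `dα(v, ·) = 0` on `T_x N`. -/
def IsReebVector (N : Set R4) (x v : R4) : Prop :=
  v ∈ tangentVectors N x ∧ liouvilleForm x v = 1 ∧
    ∀ w ∈ tangentVectors N x, symplecticForm v w = 0

/-- `c : ℝ → N` is a trajectory of the Reeb flow of `N`, defined for all times. -/
def IsReebTrajectory (N : Set R4) (c : ℝ → R4) : Prop :=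
  ∀ t : ℝ, c t ∈ N ∧ ∃ v : R4, HasDerivAt c v t ∧ IsReebVector N (c t) v

/-- A subset `A` of `N` is invariant under the Reeb flow: a trajectory that starts in `A` stays in
`A` for all positive and negative times. -/
def IsReebInvariant (N A : Set R4) : Prop :=
  A ⊆ N ∧ ∀ c : ℝ → R4, IsReebTrajectory N c → c 0 ∈ A → ∀ t : ℝ, c t ∈ A

/-- The Reeb flow of `N` has a dense trajectory. -/
def HasDenseReebTrajectory (N : Set R4) : Prop :=
  ∃ c : ℝ → R4, IsReebTrajectory N c ∧ N ⊆ closure (Set.range c)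

/-- The density of the volume form `α ∧ dα` of `N` with respect to the 3-dimensional area measure:
the value of `|α ∧ dα|` on an orthonormal basis of `T_x N` (the same for every such basis). -/
noncomputable def contactVolumeDensity (N : Set R4) (x : R4) : ℝ≥0∞ :=
  ⨆ e : {e : Fin 3 → R4 // Orthonormal ℝ e ∧ ∀ i, e i ∈ tangentVectors N x},
    ENNReal.ofReal |contactVolumeForm x (e.1 0) (e.1 1) (e.1 2)|

/-- The volume measure of the contact form `α = λ|_N` on `N`, that is `|α ∧ dα|`, as a measure on
`ℝ⁴` concentrated on `N`. -/
noncomputable def contactVolumeMeasure (N : Set R4) : Measure R4 :=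
  ((μHE[3] : Measure R4).restrict N).withDensity (contactVolumeDensity N)

/-- The Reeb flow of `N` is ergodic for the volume measure of the contact form: every invariant
measurable set has zero measure or full measure. -/
def IsReebErgodic (N : Set R4) : Prop :=
  ∀ A : Set R4, MeasurableSet A → IsReebInvariant N A →
    contactVolumeMeasure N A = 0 ∨ contactVolumeMeasure N (N \ A) = 0

/-!
Write a starshaped hypersurface as `N = {K = 1}` with `K` positive and homogeneous of degree two.
Its Reeb field is the Hamiltonian vector field `X` of `K` (`IsHomogHam.isReebVector_iff`).

*Separation.* If `L ⊆ N` is Lagrangian, then `dK` vanishes on the tangent plane of `L`, so `X` lies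
in its `ω`-orthogonal complement, which is the tangent plane itself. Thus `L` is invariant
(`reebTrajectory_mem_lagrangian`). A compact surface in `N`, a copy of `S³`, separates it into
points of two signs: the cone over `L` is a closed hypersurface of `ℝ⁴ ∖ {0}`, locally the zero set
of a submersion `G`, and the locally defined functions `± sign G` glue, first over starshaped sets
and then over two slit copies of `ℝ⁴`, to a global side function. Its two sides are open, nonempty
and invariant since `L` is (`exists_separation`). Hence a dense trajectory excludes `L`, and so does
ergodicity, because nonempty open sets have positive contact volume
(`IsHomogHam.contactVolumeMeasure_pos`).

*Existence.* It remains to find a `K` for which every two nonempty open cones are connected by a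
trajectory. It is a limit of Hamiltonians `F_α ∘ Φ⁻¹` with `F_α = (|z₁|² + α|z₂|²) / 2` and `Φ` a
homogeneous map preserving `λ`, as in the approximation by conjugation of Anosov and Katok. Given
two open cones, `α` is first replaced by a rational number `β` close to it. The flow of `F_β` is
periodic, and an area-preserving twist of its orbit space lifts to a map `h` with `F_β ∘ h = F_β`
which preserves `λ` (`TwistData.twist`); replacing `Φ` by `Φ ∘ h` does not change the Hamiltonian.
The twist can be chosen so that `Φ ∘ h` maps two points of one torus `|z₁| = const`, `|z₂| = const`
to the two cones (`exists_twist_connecting`). The linear flow of slope `α'` connects these points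
for some `α'` as close to `β` as desired (`exists_rotFlow_eq`), so that the change of the
Hamiltonian is small in `C^k`. A connection between open cones survives small changes
(`Connects.stable`), so countably many pairs of cones can be connected one after the other.
-/

/-! ### Symplectic gradients and homogeneous Hamiltonians -/

theorem liouvilleForm_eq (x v : R4) : liouvilleForm x v = symplecticForm x v / 2 := rfl

theorem symplecticForm_swap (v w : R4) : symplecticForm v w = -symplecticForm w v := by
  simp only [symplecticForm]; ring

theorem symplecticForm_self (v : R4) : symplecticForm v v = 0 := by
  simp only [symplecticForm]; ring

theorem symplecticForm_add_left (u v w : R4) :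
    symplecticForm (u + v) w = symplecticForm u w + symplecticForm v w := by
  simp only [symplecticForm, PiLp.add_apply]; ring

theorem symplecticForm_add_right (u v w : R4) :
    symplecticForm w (u + v) = symplecticForm w u + symplecticForm w v := by
  simp only [symplecticForm, PiLp.add_apply]; ring

theorem symplecticForm_smul_left (r : ℝ) (v w : R4) :
    symplecticForm (r • v) w = r * symplecticForm v w := by
  simp only [symplecticForm, PiLp.smul_apply, smul_eq_mul]; ring

theorem symplecticForm_smul_right (r : ℝ) (v w : R4) :
    symplecticForm w (r • v) = r * symplecticForm w v := by
  simp only [symplecticForm, PiLp.smul_apply, smul_eq_mul]; ring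

theorem eq_zero_of_symplecticForm_left {v : R4} (h : ∀ w, symplecticForm w v = 0) : v = 0 := by
  ext i
  have h0 := h (EuclideanSpace.single 0 1)
  have h1 := h (EuclideanSpace.single 1 1)
  have h2 := h (EuclideanSpace.single 2 1)
  have h3 := h (EuclideanSpace.single 3 1)
  simp [symplecticForm] at h0 h1 h2 h3
  fin_cases i <;> simp [h0, h1, h2, h3]

theorem eq_of_symplecticForm_left {u v : R4} (h : ∀ w, symplecticForm w u = symplecticForm w v) :
    u = v := by
  have : u + (-1 : ℝ) • v = 0 := eq_zero_of_symplecticForm_left fun w => by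
    rw [symplecticForm_add_right, symplecticForm_smul_right, h w]; ring
  simpa [← sub_eq_add_neg, sub_eq_zero] using this

/-- The vector `ω`-dual to a linear functional: `ω(w, symplGrad L) = L w`. -/
noncomputable def symplGrad : (R4 →L[ℝ] ℝ) →L[ℝ] R4 :=
  LinearMap.toContinuousLinearMap
    { toFun := fun L => !₂[-L (EuclideanSpace.single 1 1), L (EuclideanSpace.single 0 1),
        -L (EuclideanSpace.single 3 1), L (EuclideanSpace.single 2 1)]
      map_add' := fun L M => by ext i; fin_cases i <;> simp [add_comm]
      map_smul' := fun r L => by ext i; fin_cases i <;> simp }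

theorem functional_eq_sum (L : R4 →L[ℝ] ℝ) (w : R4) :
    L w = w 0 * L (EuclideanSpace.single 0 1) + w 1 * L (EuclideanSpace.single 1 1)
      + w 2 * L (EuclideanSpace.single 2 1) + w 3 * L (EuclideanSpace.single 3 1) := by
  conv_lhs => rw [← (EuclideanSpace.basisFun (Fin 4) ℝ).sum_repr w]
  simp [Fin.sum_univ_four]

theorem symplecticForm_symplGrad (L : R4 →L[ℝ] ℝ) (w : R4) :
    symplecticForm w (symplGrad L) = L w := by
  rw [functional_eq_sum L w]
  simp [symplGrad, symplecticForm]
  ring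

/-- The Hamiltonian vector field of `K`, with the sign convention `dK = ω(·, X_K)`. -/
noncomputable def hamVec (K : R4 → ℝ) (x : R4) : R4 := symplGrad (fderiv ℝ K x)

theorem symplecticForm_hamVec (K : R4 → ℝ) (x w : R4) :
    symplecticForm w (hamVec K x) = fderiv ℝ K x w := symplecticForm_symplGrad _ _

theorem fderiv_hamVec_self (K : R4 → ℝ) (x : R4) : fderiv ℝ K x (hamVec K x) = 0 := by
  rw [← symplecticForm_hamVec, symplecticForm_self]

/-- A positive Hamiltonian on `ℝ⁴ ∖ {0}`, smooth and homogeneous of degree two. Closed starshaped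
hypersurfaces are exactly the level sets `{K = 1}` of such functions, and the Reeb flow is then the
Hamiltonian flow. -/
structure IsHomogHam (K : R4 → ℝ) : Prop where
  smooth : ContDiffOn ℝ ∞ K {0}ᶜ
  homog : ∀ r : ℝ, 0 < r → ∀ x, K (r • x) = r ^ 2 * K x
  pos : ∀ x, x ≠ 0 → 0 < K x

/-- The hypersurface `{K = 1}`. -/
def unitLevel (K : R4 → ℝ) : Set R4 := {x | K x = 1}

namespace IsHomogHam

variable {K : R4 → ℝ} (hK : IsHomogHam K)
include hK

theorem zero : K 0 = 0 := by
  have := hK.homog 2 two_pos 0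
  simp at this; linarith

theorem ne_zero_of_mem {x : R4} (hx : x ∈ unitLevel K) : x ≠ 0 := by
  rintro rfl; have h := hK.zero; simp [unitLevel] at hx; linarith

theorem contDiffAt {x : R4} (hx : x ≠ 0) : ContDiffAt ℝ ∞ K x :=
  hK.smooth.contDiffAt (isOpen_compl_singleton.mem_nhds hx)

theorem hasFDerivAt {x : R4} (hx : x ≠ 0) : HasFDerivAt K (fderiv ℝ K x) x :=
  ((hK.contDiffAt hx).differentiableAt (by simp)).hasFDerivAt

theorem fderiv_self {x : R4} (hx : x ≠ 0) : fderiv ℝ K x x = 2 * K x := by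
  have h1 : HasDerivAt (fun r : ℝ => K (r • x)) (fderiv ℝ K x x) 1 := by
    have h := hK.hasFDerivAt hx
    have h2 : HasDerivAt (fun r : ℝ => r • x) ((1 : ℝ) • x) 1 := (hasDerivAt_id 1).smul_const x
    rw [one_smul] at h2
    exact HasFDerivAt.comp_hasDerivAt (1 : ℝ) (by simpa using h) h2
  have h3 : HasDerivAt (fun r : ℝ => r ^ 2 * K x) (2 * K x) 1 := by
    simpa using ((hasDerivAt_pow 2 (1 : ℝ)).mul_const (K x))
  refine h1.unique (h3.congr_of_eventuallyEq ?_)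
  filter_upwards [lt_mem_nhds (zero_lt_one (α := ℝ))] with r hr using hK.homog r hr x

theorem smul_mem {x : R4} (hx : x ≠ 0) : (√(K x))⁻¹ • x ∈ unitLevel K := by
  have hp := hK.pos x hx
  have : K ((√(K x))⁻¹ • x) = 1 := by
    rw [hK.homog _ (by positivity), inv_pow, Real.sq_sqrt hp.le, inv_mul_cancel₀ hp.ne']
  exact this

theorem tangentVectors_eq {x : R4} (hx : x ∈ unitLevel K) :
    tangentVectors (unitLevel K) x = {v | fderiv ℝ K x v = 0} := by
  have hx0 := hK.ne_zero_of_mem hx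
  ext v
  constructor
  · rintro ⟨c, hc, hc0, hcN, rfl⟩
    have hd : HasDerivAt c (deriv c 0) 0 := (hc.differentiable (by simp) 0).hasDerivAt
    have h1 : HasDerivAt (fun t => K (c t)) (fderiv ℝ K x (deriv c 0)) 0 :=
      HasFDerivAt.comp_hasDerivAt (0 : ℝ) (by rw [hc0]; exact hK.hasFDerivAt hx0) hd
    refine h1.unique ((hasDerivAt_const (0 : ℝ) (1 : ℝ)).congr_of_eventuallyEq ?_)
    filter_upwards [hcN] with t ht using ht
  · intro hv
    have hv : fderiv ℝ K x v = 0 := hv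
    have hne : ∀ t : ℝ, x + t • v ≠ 0 := by
      intro t ht
      have hxe : x = -(t • v) := eq_neg_of_add_eq_zero_left ht
      have h2 := hK.fderiv_self hx0
      have hx1 : K x = 1 := hx
      have h3 : fderiv ℝ K x x = 0 := by
        rw [show fderiv ℝ K x x = fderiv ℝ K x (-(t • v)) by rw [← hxe]]
        simp [hv]
      rw [h3, hx1] at h2
      norm_num at h2
    have hline : ContDiff ℝ ∞ (fun t : ℝ => x + t • v) := by fun_prop
    have hKl : ContDiff ℝ ∞ (fun t : ℝ => K (x + t • v)) :=
      contDiff_iff_contDiffAt.2 fun t =>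
        (hK.contDiffAt (hne t)).comp t hline.contDiffAt
    have hs : ContDiff ℝ ∞ (fun t : ℝ => (√(K (x + t • v)))⁻¹) :=
      (hKl.sqrt fun t => (hK.pos _ (hne t)).ne').inv
        fun t => (Real.sqrt_pos.2 (hK.pos _ (hne t))).ne'
    have hx1 : K x = 1 := hx
    refine ⟨fun t => (√(K (x + t • v)))⁻¹ • (x + t • v), hs.smul hline, by simp [hx1],
      Filter.Eventually.of_forall fun t => hK.smul_mem (hne t), ?_⟩
    have hl : HasDerivAt (fun t : ℝ => x + t • v) v 0 := by
      simpa using ((hasDerivAt_id (0 : ℝ)).smul_const v).const_add x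
    have h1 : HasDerivAt (fun t : ℝ => K (x + t • v)) (fderiv ℝ K x v) 0 :=
      HasFDerivAt.comp_hasDerivAt (0 : ℝ) (by simpa using hK.hasFDerivAt hx0) hl
    rw [hv] at h1
    have h2 : HasDerivAt (fun t : ℝ => (√(K (x + t • v)))⁻¹) 0 0 :=
      ((h1.sqrt (by simp [hx1])).fun_inv (by simp [hx1])).congr_deriv (by simp)
    have h3 := (h2.fun_smul hl).deriv
    rw [h3]
    simp [hx1]

/-- On `{K = 1}` the Reeb vector field is the Hamiltonian vector field. -/
theorem isReebVector_iff {x : R4} (hx : x ∈ unitLevel K) (v : R4) :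
    IsReebVector (unitLevel K) x v ↔ v = hamVec K x := by
  have hx0 := hK.ne_zero_of_mem hx
  have hx1 : K x = 1 := hx
  have hE := hK.fderiv_self hx0
  rw [IsReebVector, hK.tangentVectors_eq hx]
  constructor
  · rintro ⟨-, hl, hw⟩
    refine eq_of_symplecticForm_left fun w => ?_
    have h := hw (w + (-(fderiv ℝ K x w / 2)) • x) (by
      simp only [Set.mem_ofPred_eq, map_add, map_smul, hE, hx1, smul_eq_mul]; ring)
    rw [symplecticForm_swap, symplecticForm_add_left, symplecticForm_smul_left] at h
    rw [liouvilleForm_eq] at hl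
    rw [symplecticForm_hamVec]
    have hxv : symplecticForm x v = 2 := by linarith
    rw [hxv] at h
    linarith
  · rintro rfl
    refine ⟨fderiv_hamVec_self K x, ?_, fun w hw => ?_⟩
    · rw [liouvilleForm_eq, symplecticForm_hamVec, hE, hx1]; norm_num
    · rw [symplecticForm_swap, symplecticForm_hamVec, hw, neg_zero]

theorem isReebTrajectory_iff (c : ℝ → R4) :
    IsReebTrajectory (unitLevel K) c ↔
      ∀ t, c t ∈ unitLevel K ∧ HasDerivAt c (hamVec K (c t)) t := by
  refine forall_congr' fun t => and_congr_right fun ht => ?_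
  simp [hK.isReebVector_iff ht]

theorem isClosedStarshapedHypersurface : IsClosedStarshapedHypersurface (unitLevel K) := by
  have hsp : ∀ u ∈ sphere (0 : R4) 1, u ≠ 0 := fun u hu => by
    rintro rfl; simp at hu
  refine ⟨fun x => (√(K x))⁻¹, ?_, fun u hu => ?_, ?_⟩
  · exact (hK.smooth.sqrt fun x hx => (hK.pos x hx).ne').inv
      fun x hx => (Real.sqrt_pos.2 (hK.pos x hx)).ne'
  · have := hK.pos u (hsp u hu); positivity
  · ext x
    constructor
    · intro hx
      have hx0 := hK.ne_zero_of_mem hx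
      have hn : 0 < ‖x‖ := norm_pos_iff.2 hx0
      have hx1 : K x = 1 := hx
      refine ⟨‖x‖⁻¹ • x, by simp [norm_smul, hn.ne'], ?_⟩
      dsimp only
      rw [hK.homog _ (by positivity), hx1, mul_one, Real.sqrt_sq (by positivity), inv_inv,
        smul_smul,
        mul_inv_cancel₀ hn.ne', one_smul]
    · rintro ⟨u, hu, rfl⟩
      exact hK.smul_mem (hsp u hu)

theorem isCompact_unitLevel : IsCompact (unitLevel K) := by
  obtain ⟨f, hf, -, hN⟩ := hK.isClosedStarshapedHypersurface
  rw [hN]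
  refine (isCompact_sphere (0 : R4) 1).image_of_continuousOn ?_
  refine (hf.continuousOn.mono ?_).smul continuousOn_id
  intro u hu h0
  rw [Set.mem_singleton_iff] at h0
  simp [h0] at hu

end IsHomogHam

theorem IsClosedStarshapedHypersurface.exists_homogHam {N : Set R4}
    (hN : IsClosedStarshapedHypersurface N) : ∃ K, IsHomogHam K ∧ N = unitLevel K := by
  obtain ⟨f, hf, hpos, rfl⟩ := hN
  have hmem : ∀ x : R4, x ≠ 0 → ‖x‖⁻¹ • x ∈ sphere (0 : R4) 1 := fun x hx => by
    simp [norm_smul, norm_ne_zero_iff.2 hx]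
  refine ⟨fun x => ‖x‖ ^ 2 / f (‖x‖⁻¹ • x) ^ 2, ⟨?_, ?_, ?_⟩, ?_⟩
  · intro x hx
    have hx : x ≠ 0 := hx
    refine ContDiffAt.contDiffWithinAt ?_
    have hn : ContDiffAt ℝ ∞ (fun x : R4 => ‖x‖⁻¹ • x) x :=
      ((contDiffAt_norm ℝ hx).inv (norm_ne_zero_iff.2 hx)).smul contDiffAt_id
    have h0 : ‖x‖⁻¹ • x ≠ 0 := smul_ne_zero (inv_ne_zero (norm_ne_zero_iff.2 hx)) hx
    have h1 : ContDiffAt ℝ ∞ (fun x : R4 => f (‖x‖⁻¹ • x)) x :=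
      ContDiffAt.comp x (f := fun x : R4 => ‖x‖⁻¹ • x)
        (hf.contDiffAt (isOpen_compl_singleton.mem_nhds h0)) hn
    exact ((contDiffAt_norm ℝ hx).pow 2).div (h1.pow 2) (pow_ne_zero 2 (hpos _ (hmem x hx)).ne')
  · intro r hr x
    have : ‖r • x‖⁻¹ • (r • x) = ‖x‖⁻¹ • x := by
      rw [norm_smul, Real.norm_of_nonneg hr.le, mul_inv, smul_smul]
      congr 1
      field_simp
    simp only [this]
    rw [norm_smul, Real.norm_of_nonneg hr.le]; ring
  · intro x hx
    have := hpos _ (hmem x hx)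
    have := norm_pos_iff.2 hx
    positivity
  · ext x
    constructor
    · rintro ⟨u, hu, rfl⟩
      have hu1 : ‖u‖ = 1 := by simpa using hu
      have hfu := hpos u hu
      have hn : ‖f u • u‖ = f u := by rw [norm_smul, hu1, Real.norm_of_nonneg hfu.le, mul_one]
      change ‖f u • u‖ ^ 2 / f (‖f u • u‖⁻¹ • f u • u) ^ 2 = 1
      rw [hn, smul_smul, inv_mul_cancel₀ hfu.ne', one_smul, div_self (by positivity)]
    · intro hx
      have hx : ‖x‖ ^ 2 / f (‖x‖⁻¹ • x) ^ 2 = 1 := hx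
      have hx0 : x ≠ 0 := by rintro rfl; simp at hx
      have hfx := hpos _ (hmem x hx0)
      refine ⟨‖x‖⁻¹ • x, hmem x hx0, ?_⟩
      have hn := norm_pos_iff.2 hx0
      rw [div_eq_one_iff_eq (by positivity)] at hx
      have : f (‖x‖⁻¹ • x) = ‖x‖ := by
        exact ((sq_eq_sq₀ hn.le hfx.le).1 hx).symm
      simp only [this, smul_smul, mul_inv_cancel₀ hn.ne', one_smul]

/-! ### Straightening submersions -/

section Straightening

variable {E F : Type*} [NormedAddCommGroup E] [NormedSpace ℝ E] [FiniteDimensional ℝ E]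
  [NormedAddCommGroup F] [NormedSpace ℝ F] [FiniteDimensional ℝ F]

/-- A submersion `G` is the first component of a smooth chart; the second one is a linear
projection onto the kernel of the derivative. -/
theorem exists_straightening {G : E → F} {U : Set E} (hU : IsOpen U) (hG : ContDiffOn ℝ ∞ G U)
    {x : E} (hx : x ∈ U) (hs : Function.Surjective (fderiv ℝ G x)) :
    ∃ (p : E →L[ℝ] (fderiv ℝ G x).ker) (e : OpenPartialHomeomorph E (F × (fderiv ℝ G x).ker)),
      x ∈ e.source ∧ (∀ y, e y = (G y, p y)) ∧ (∀ v : (fderiv ℝ G x).ker, p v = v) ∧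
      ∀ᶠ z in 𝓝 (e x), ContDiffAt ℝ ∞ e.symm z := by
  have := FiniteDimensional.complete ℝ E
  have := FiniteDimensional.complete ℝ F
  have hx' : ∀ y ∈ U, ContDiffAt ℝ ∞ G y := fun y hy => hG.contDiffAt (hU.mem_nhds hy)
  obtain ⟨p, hp⟩ := (fderiv ℝ G x).ker_closedComplemented_of_finiteDimensional_range
  have hinj : ((fderiv ℝ G x).prod p).ker = ⊥ := by
    refine (Submodule.eq_bot_iff _).2 fun v hv => ?_
    have hv' : ((fderiv ℝ G x).prod p) v = 0 := hv
    simp only [ContinuousLinearMap.prod_apply, Prod.mk_eq_zero] at hv'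
    have h1 : p v = ⟨v, hv'.1⟩ := hp ⟨v, hv'.1⟩
    exact congrArg Subtype.val (h1.symm.trans hv'.2)
  have hsurj : ((fderiv ℝ G x).prod p).range = ⊤ := by
    refine (Submodule.eq_top_iff').2 fun ⟨a, k⟩ => ?_
    obtain ⟨v, hv⟩ := hs a
    refine ⟨v + (k - p v : (fderiv ℝ G x).ker), ?_⟩
    have h1 : fderiv ℝ G x ((k - p v : (fderiv ℝ G x).ker) : E) = 0 := (k - p v).2
    simp only [ContinuousLinearMap.coe_coe, ContinuousLinearMap.prod_apply, map_add, h1, hp, hv]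
    simp
  let A := ContinuousLinearEquiv.ofBijective ((fderiv ℝ G x).prod p) hinj hsurj
  have hA : (A : E →L[ℝ] F × (fderiv ℝ G x).ker) = (fderiv ℝ G x).prod p :=
    ContinuousLinearEquiv.coe_ofBijective _ _ _
  have hsm : ∀ y ∈ U, ContDiffAt ℝ ∞ (fun y => (G y, p y)) y := fun y hy =>
    (hx' y hy).prodMk p.contDiff.contDiffAt
  have hdx : HasFDerivAt (fun y => (G y, p y)) (A : E →L[ℝ] F × (fderiv ℝ G x).ker) x := by
    rw [hA]; exact (((hx' x hx).differentiableAt (by simp)).hasFDerivAt).prodMk p.hasFDerivAt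
  let e := (hsm x hx).toOpenPartialHomeomorph _ hdx (by simp)
  have he : ∀ y, e y = (G y, p y) := fun y => rfl
  have hxe : x ∈ e.source := (hsm x hx).mem_toOpenPartialHomeomorph_source hdx (by simp)
  refine ⟨p, e, hxe, he, hp, ?_⟩
  -- the derivative of the chart stays invertible near `x`
  have hinv : ∀ᶠ y in 𝓝 x, fderiv ℝ (fun y => (G y, p y)) y ∈ Set.range
      ((↑) : (E ≃L[ℝ] F × (fderiv ℝ G x).ker) → (E →L[ℝ] F × (fderiv ℝ G x).ker)) := by
    refine ((hsm x hx).continuousAt_fderiv (by simp)).eventually ?_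
    rw [hdx.fderiv]
    exact ContinuousLinearEquiv.nhds A
  have hsymm : Filter.Tendsto e.symm (𝓝 (e x)) (𝓝 x) := by
    have := e.continuousAt_symm (e.map_source hxe)
    rwa [ContinuousAt, e.left_inv hxe] at this
  filter_upwards [hsymm.eventually hinv, hsymm.eventually (hU.mem_nhds hx),
    e.open_target.mem_nhds (e.map_source hxe)] with z ⟨B, hB⟩ hzU hz
  exact e.contDiffAt_symm hz (f₀' := B)
    (by rw [hB]; exact ((hsm _ hzU).differentiableAt (by simp)).hasFDerivAt) (hsm _ hzU)

/-- Vectors in the kernel of the derivative of a submersion are velocities of smooth curves in the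
fibre. -/
theorem exists_curve_of_mem_ker {G : E → F} {U : Set E} (hU : IsOpen U) (hG : ContDiffOn ℝ ∞ G U)
    {x : E} (hx : x ∈ U) (hs : Function.Surjective (fderiv ℝ G x)) {v : E}
    (hv : fderiv ℝ G x v = 0) :
    ∃ c : ℝ → E, ContDiff ℝ ∞ c ∧ c 0 = x ∧ (∀ᶠ t in 𝓝 (0 : ℝ), c t ∈ U ∧ G (c t) = G x) ∧
      deriv c 0 = v := by
  obtain ⟨p, e, hxe, he, hp, hsm⟩ := exists_straightening hU hG hx hs
  obtain ⟨ε, hε, hball⟩ := Metric.eventually_nhds_iff_ball.1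
    (hsm.and (e.open_target.mem_nhds (e.map_source hxe)))
  let w : (fderiv ℝ G x).ker := ⟨v, hv⟩
  -- a bounded reparametrization of the line keeps the curve inside the chart for all times
  obtain ⟨d, hd, hdw⟩ : ∃ d : ℝ, 0 < d ∧ d * ‖w‖ < ε := by
    refine ⟨ε / (‖w‖ + 1), by positivity, ?_⟩
    rw [div_mul_eq_mul_div, div_lt_iff₀ (by positivity)]
    nlinarith [norm_nonneg w]
  let φ : ℝ → ℝ := fun t => d * Real.sin (t / d)
  have hφ : ContDiff ℝ ∞ φ := contDiff_const.mul (Real.contDiff_sin.comp (contDiff_id.div_const d))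
  let γ : ℝ → F × (fderiv ℝ G x).ker := fun t => e x + φ t • ((0 : F), w)
  have hγ : ContDiff ℝ ∞ γ := contDiff_const.add (hφ.smul contDiff_const)
  have hmem : ∀ t, γ t ∈ ball (e x) ε := fun t => by
    rw [mem_ball, dist_eq_norm]
    have : γ t - e x = φ t • ((0 : F), w) := by simp [γ]
    rw [this, norm_smul]
    have h1 : ‖((0 : F), w)‖ = ‖w‖ := by simp [Prod.norm_def]
    rw [h1]
    refine lt_of_le_of_lt ?_ hdw
    refine mul_le_mul_of_nonneg_right ?_ (norm_nonneg w)
    simp only [φ, norm_mul, Real.norm_eq_abs, abs_of_pos hd]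
    have := Real.abs_sin_le_one (t / d)
    nlinarith
  have hφ0 : φ 0 = 0 := by simp [φ]
  have hγ0 : γ 0 = e x := by simp [γ, hφ0]
  have hsm' : ContDiff ℝ ∞ (fun t => e.symm (γ t)) := contDiff_iff_contDiffAt.2 fun t =>
    ((hball _ (hmem t)).1).comp t hγ.contDiffAt
  have hright : ∀ t, e (e.symm (γ t)) = γ t := fun t => e.right_inv (hball _ (hmem t)).2
  have hc0 : e.symm (γ 0) = x := by rw [hγ0, e.left_inv hxe]
  have hG' : ∀ t, G (e.symm (γ t)) = G x := fun t => by
    have := congrArg Prod.fst (hright t)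
    rw [he] at this
    simpa [γ, he] using this
  refine ⟨fun t => e.symm (γ t), hsm', hc0, ?_, ?_⟩
  · have : Filter.Tendsto (fun t => e.symm (γ t)) (𝓝 0) (𝓝 x) := by
      have := hsm'.continuous.tendsto 0
      rwa [hc0] at this
    filter_upwards [this.eventually (hU.mem_nhds hx)] with t ht using ⟨ht, hG' t⟩
  · set c := fun t => e.symm (γ t)
    have hcd : HasDerivAt c (deriv c 0) 0 := (hsm'.differentiable (by simp) 0).hasDerivAt
    have h1 : HasDerivAt (fun t => p (c t)) (p (deriv c 0)) 0 :=
      p.hasFDerivAt.comp_hasDerivAt (0 : ℝ) hcd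
    have h2 : HasDerivAt (fun t => G (c t)) (fderiv ℝ G x (deriv c 0)) 0 := by
      refine HasFDerivAt.comp_hasDerivAt (0 : ℝ) ?_ hcd
      rw [show c 0 = x from hc0]
      exact ((hG.contDiffAt (hU.mem_nhds hx)).differentiableAt (by simp)).hasFDerivAt
    have h3 : fderiv ℝ G x (deriv c 0) = 0 := by
      refine h2.unique ?_
      have : (fun t => G (c t)) = fun _ => G x := funext hG'
      rw [this]; exact hasDerivAt_const _ _
    have h4 : (fun t => p (c t)) = fun t => p x + φ t • w := by
      funext t
      have := congrArg Prod.snd (hright t)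
      rw [he] at this
      simpa [γ, he, c] using this
    have h5 : HasDerivAt φ 1 0 := by
      have := ((Real.hasDerivAt_sin (0 / d)).comp (0 : ℝ)
        ((hasDerivAt_id (0 : ℝ)).div_const d)).const_mul d
      refine this.congr_deriv ?_
      simp [hd.ne']
    have h6 : HasDerivAt (fun t => p (c t)) w 0 := by
      rw [h4]; simpa using (h5.smul_const w).const_add (p x)
    have h7 : p (deriv c 0) = w := h1.unique h6
    have h8 := hp ⟨deriv c 0, h3⟩
    have h9 : (⟨deriv c 0, h3⟩ : (fderiv ℝ G x).ker) = w := h8.symm.trans h7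
    exact congrArg Subtype.val h9

/-- A `C¹` map vanishing on the zero set of a submersion `G` is locally bounded by a multiple of
`‖G‖`. -/
theorem exists_norm_le_mul_norm_of_zero_on {H : Type*} [NormedAddCommGroup H] [NormedSpace ℝ H]
    {G : E → F} {U : Set E} (hU : IsOpen U) (hG : ContDiffOn ℝ ∞ G U)
    {x : E} (hx : x ∈ U) (hs : Function.Surjective (fderiv ℝ G x)) (hGx : G x = 0) {ψ : E → H}
    (hψ : ContDiffAt ℝ 1 ψ x) (h0 : ∀ y ∈ U, G y = 0 → ψ y = 0) :
    ∃ C : ℝ, ∀ᶠ y in 𝓝 x, ‖ψ y‖ ≤ C * ‖G y‖ := by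
  obtain ⟨p, e, hxe, he, hp, hsm⟩ := exists_straightening hU hG hx hs
  have h1 : ContDiffAt ℝ 1 (fun z => ψ (e.symm z)) (e x) := by
    refine ContDiffAt.comp (e x) ?_ (hsm.self_of_nhds.of_le (by simp))
    rwa [e.left_inv hxe]
  obtain ⟨C, t, ht, hL⟩ := h1.exists_lipschitzOnWith
  refine ⟨C, ?_⟩
  have hcont : ContinuousAt e x := e.continuousAt hxe
  have hsymm : Filter.Tendsto e.symm (𝓝 (e x)) (𝓝 x) := by
    have := e.continuousAt_symm (e.map_source hxe)
    rwa [ContinuousAt, e.left_inv hxe] at this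
  have hproj : Filter.Tendsto (fun y => ((0 : F), p y)) (𝓝 x) (𝓝 (e x)) := by
    rw [he, hGx]
    exact tendsto_const_nhds.prodMk_nhds (p.continuous.tendsto x)
  filter_upwards [e.open_source.mem_nhds hxe, hcont.eventually ht, hproj.eventually ht,
    hproj.eventually (e.open_target.mem_nhds (e.map_source hxe)),
    (hsymm.comp hproj).eventually (hU.mem_nhds hx)] with y hys hyt hzt hztar hzU
  have h2 : ψ (e.symm ((0 : F), p y)) = 0 := by
    refine h0 _ hzU ?_
    have := congrArg Prod.fst (e.right_inv hztar)
    rw [he] at this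
    exact this
  have h3 := hL.dist_le_mul _ hyt _ hzt
  rw [e.left_inv hys, h2, dist_zero_right, he, dist_eq_norm] at h3
  simpa [Prod.norm_def] using h3

end Straightening

/-! ### Trajectories that meet a closed Lagrangian stay in it -/

/-- An integral curve of a vector field tangent to the zero set of a submersion, that meets this
zero set, stays in it for small times. -/
theorem eventually_zero_of_integralCurve {E F : Type*} [NormedAddCommGroup E] [NormedSpace ℝ E]
    [NormedAddCommGroup F] [NormedSpace ℝ F]
    {G : E → F} {U : Set E} (hU : IsOpen U) (hG : ContDiffOn ℝ ∞ G U) {X : E → E} {c : ℝ → E}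
    (hc : ∀ t, HasDerivAt c (X (c t)) t) {t₀ : ℝ} (hx : c t₀ ∈ U) (h0 : G (c t₀) = 0) {C : ℝ}
    (hC : ∀ᶠ y in 𝓝 (c t₀), ‖fderiv ℝ G y (X y)‖ ≤ C * ‖G y‖) :
    ∀ᶠ t in 𝓝 t₀, G (c t) = 0 := by
  have hcc : Continuous c := continuous_iff_continuousAt.2 fun t => (hc t).continuousAt
  obtain ⟨ε, hε, hball⟩ := Metric.eventually_nhds_iff_ball.1
    ((hcc.tendsto t₀).eventually (hC.and (hU.mem_nhds hx)))
  have hd : ∀ t ∈ ball t₀ ε, HasDerivAt (fun t => G (c t)) (fderiv ℝ G (c t) (X (c t))) t :=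
    fun t ht => HasFDerivAt.comp_hasDerivAt t (((hG.contDiffAt
      (hU.mem_nhds (hball t ht).2)).differentiableAt (by simp)).hasFDerivAt) (hc t)
  filter_upwards [ball_mem_nhds t₀ hε] with t ht
  have ht' : |t - t₀| < ε := by rwa [mem_ball, Real.dist_eq] at ht
  have hIn : ∀ s, |s - t₀| ≤ |t - t₀| → s ∈ ball t₀ ε := fun s hs => by
    rw [mem_ball, Real.dist_eq]; exact lt_of_le_of_lt hs ht'
  rcases le_total t₀ t with h | h
  · have hb : ∀ s ∈ Set.Icc t₀ t, s ∈ ball t₀ ε := fun s hs => hIn s (by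
      rw [abs_of_nonneg (sub_nonneg.2 hs.1), abs_of_nonneg (sub_nonneg.2 h)]; linarith [hs.2])
    exact eq_zero_of_abs_deriv_le_mul_abs_self_of_eq_zero_right
      (f := fun t => G (c t)) (f' := fun t => fderiv ℝ G (c t) (X (c t))) (K := C)
      (fun s hs => (hd s (hb s hs)).continuousAt.continuousWithinAt)
      (fun s hs => (hd s (hb s ⟨hs.1, hs.2.le⟩)).hasDerivWithinAt) h0
      (fun s hs => (hball s (hb s ⟨hs.1, hs.2.le⟩)).1) t ⟨h, le_rfl⟩
  · have hb : ∀ s ∈ Set.Icc (-t₀) (-t), -s ∈ ball t₀ ε := fun s hs => hIn _ (by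
      rw [abs_sub_comm, abs_sub_comm t, abs_of_nonneg (by linarith [hs.1]),
        abs_of_nonneg (sub_nonneg.2 h)]; linarith [hs.2])
    have hd' : ∀ s ∈ Set.Icc (-t₀) (-t), HasDerivAt (fun s => G (c (-s)))
        (-(fderiv ℝ G (c (-s)) (X (c (-s))))) s := fun s hs => by
      simpa [Function.comp_def] using (hd (-s) (hb s hs)).scomp s (hasDerivAt_neg s)
    have := eq_zero_of_abs_deriv_le_mul_abs_self_of_eq_zero_right
      (f := fun s => G (c (-s))) (f' := fun s => -(fderiv ℝ G (c (-s)) (X (c (-s))))) (K := C)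
      (fun s hs => (hd' s hs).continuousAt.continuousWithinAt)
      (fun s hs => (hd' s ⟨hs.1, hs.2.le⟩).hasDerivWithinAt) (by simpa using h0)
      (fun s hs => by rw [norm_neg]; exact (hball _ (hb s ⟨hs.1, hs.2.le⟩)).1) (-t)
      ⟨by linarith, le_rfl⟩
    simpa using this

/-- `ω` as a bilinear form on `ℝ⁴`. -/
noncomputable def symplecticBilin : LinearMap.BilinForm ℝ R4 :=
  LinearMap.mk₂ ℝ symplecticForm symplecticForm_add_left symplecticForm_smul_left
    (fun w u v => symplecticForm_add_right u v w) (fun r w v => symplecticForm_smul_right r v w)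

/-- A Lagrangian plane is its own `ω`-orthogonal complement. -/
theorem mem_of_symplecticForm_eq_zero (P : Submodule ℝ R4) (hP : Module.finrank ℝ P = 2)
    (hiso : ∀ v ∈ P, ∀ w ∈ P, symplecticForm v w = 0) {X : R4}
    (hX : ∀ w ∈ P, symplecticForm w X = 0) : X ∈ P := by
  have hnd : symplecticBilin.Nondegenerate := by
    refine ⟨fun v hv => ?_, fun v hv => eq_zero_of_symplecticForm_left hv⟩
    refine eq_zero_of_symplecticForm_left fun w => ?_
    rw [symplecticForm_swap, neg_eq_zero]; exact hv w
  have hrefl : symplecticBilin.IsRefl := fun v w h => by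
    have h : symplecticForm v w = 0 := h
    change symplecticForm w v = 0
    rw [symplecticForm_swap, h, neg_zero]
  have hle : P ≤ symplecticBilin.orthogonal P := fun v hv w hw => hiso w hw v hv
  have hfr := LinearMap.BilinForm.finrank_orthogonal hnd P
  have heq : P = symplecticBilin.orthogonal P :=
    Submodule.eq_of_le_of_finrank_eq hle (by rw [hfr, hP]; simp)
  rw [heq]
  exact fun w hw => hX w hw

theorem finrank_ker_of_surjective {f : R4 →L[ℝ] EuclideanSpace ℝ (Fin 2)}
    (hf : Function.Surjective f) : Module.finrank ℝ f.ker = 2 := by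
  have h := LinearMap.finrank_range_add_finrank_ker (f : R4 →ₗ[ℝ] EuclideanSpace ℝ (Fin 2))
  rw [LinearMap.range_eq_top.2 hf, finrank_top] at h
  simp at h
  omega

theorem tangentVectors_mono {S T : Set R4} (h : S ⊆ T) (x : R4) :
    tangentVectors S x ⊆ tangentVectors T x :=
  fun _ ⟨c, h1, h2, h3, h4⟩ => ⟨c, h1, h2, h3.mono fun _ ht => h ht, h4⟩

theorem mem_tangentVectors_of_mem_ker {L U : Set R4} (hU : IsOpen U)
    {g : R4 → EuclideanSpace ℝ (Fin 2)} (hg : ContDiffOn ℝ ∞ g U)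
    (hs : ∀ y ∈ U, Function.Surjective (fderiv ℝ g y)) (hL : L ∩ U = {y ∈ U | g y = 0})
    {y : R4} (hy : y ∈ L ∩ U) {v : R4} (hv : fderiv ℝ g y v = 0) : v ∈ tangentVectors L y := by
  obtain ⟨c, hc, hc0, hcU, hcd⟩ := exists_curve_of_mem_ker hU hg hy.2 (hs y hy.2) hv
  have hgy : g y = 0 := by rw [hL] at hy; exact hy.2
  refine ⟨c, hc, hc0, hcU.mono fun t ht => ?_, hcd⟩
  have : c t ∈ L ∩ U := by rw [hL]; exact ⟨ht.1, ht.2.trans hgy⟩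
  exact this.1

/-- The Reeb vector field is tangent to every Lagrangian in a hypersurface. -/
theorem fderiv_hamVec_eq_zero_of_lagrangian {K : R4 → ℝ} (hK : IsHomogHam K) {L U : Set R4}
    (hLN : L ⊆ unitLevel K)
    (hlag : ∀ x ∈ L, ∀ v ∈ tangentVectors L x, ∀ w ∈ tangentVectors L x, symplecticForm v w = 0)
    (hU : IsOpen U) {g : R4 → EuclideanSpace ℝ (Fin 2)} (hg : ContDiffOn ℝ ∞ g U)
    (hs : ∀ y ∈ U, Function.Surjective (fderiv ℝ g y)) (hL : L ∩ U = {y ∈ U | g y = 0})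
    {y : R4} (hy : y ∈ L ∩ U) : fderiv ℝ g y (hamVec K y) = 0 := by
  have htan : ∀ v, fderiv ℝ g y v = 0 → v ∈ tangentVectors L y := fun v hv =>
    mem_tangentVectors_of_mem_ker hU hg hs hL hy hv
  have := mem_of_symplecticForm_eq_zero (fderiv ℝ g y).ker (finrank_ker_of_surjective (hs y hy.2))
    (fun v hv w hw => hlag y hy.1 v (htan v hv) w (htan w hw)) (X := hamVec K y) (fun w hw => by
      rw [symplecticForm_hamVec]
      have := tangentVectors_mono hLN y (htan w hw)
      rwa [hK.tangentVectors_eq (hLN hy.1)] at this)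
  exact this

theorem IsHomogHam.contDiffAt_hamVec {K : R4 → ℝ} (hK : IsHomogHam K) {x : R4} (hx : x ≠ 0) :
    ContDiffAt ℝ ∞ (hamVec K) x :=
  symplGrad.contDiff.contDiffAt.comp x ((hK.contDiffAt hx).fderiv_right (m := ∞) (by simp))

/-- A Reeb trajectory that meets a closed Lagrangian is contained in it. -/
theorem reebTrajectory_mem_lagrangian {K : R4 → ℝ} (hK : IsHomogHam K) {L : Set R4}
    (hL : IsClosedLagrangian L) (hLN : L ⊆ unitLevel K) {c : ℝ → R4}
    (hc : IsReebTrajectory (unitLevel K) c) {t₀ : ℝ} (h0 : c t₀ ∈ L) (t : ℝ) : c t ∈ L := by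
  rw [hK.isReebTrajectory_iff] at hc
  have hcc : Continuous c := continuous_iff_continuousAt.2 fun t => (hc t).2.continuousAt
  have hclosed : IsClosed (c ⁻¹' L) := hL.2.1.isClosed.preimage hcc
  have hopen : IsOpen (c ⁻¹' L) := by
    refine isOpen_iff_mem_nhds.2 fun s hs => ?_
    obtain ⟨U, hU, hxU, g, hg, hsurj, hLU⟩ := hL.2.2.1 (c s) hs
    have hzero : ∀ y ∈ U, g y = 0 → fderiv ℝ g y (hamVec K y) = 0 := fun y hy hgy =>
      fderiv_hamVec_eq_zero_of_lagrangian hK hLN hL.2.2.2 hU hg hsurj hLU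
        (by rw [hLU]; exact ⟨hy, hgy⟩)
    have hgs : g (c s) = 0 := by
      have : c s ∈ L ∩ U := ⟨hs, hxU⟩
      rw [hLU] at this; exact this.2
    have hψ : ContDiffAt ℝ 1 (fun y => fderiv ℝ g y (hamVec K y)) (c s) :=
      (((hg.contDiffAt (hU.mem_nhds hxU)).fderiv_right (m := ∞) (by simp)).clm_apply
        (hK.contDiffAt_hamVec (hK.ne_zero_of_mem (hc s).1))).of_le (by simp)
    obtain ⟨C, hC⟩ := exists_norm_le_mul_norm_of_zero_on hU hg hxU (hsurj _ hxU) hgs hψ hzero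
    filter_upwards [eventually_zero_of_integralCurve hU hg (fun t => (hc t).2) hxU hgs hC,
      (hcc.tendsto s).eventually (hU.mem_nhds hxU)] with r hr hrU
    have : c r ∈ L ∩ U := by rw [hLU]; exact ⟨hrU, hr⟩
    exact this.1
  have := IsClopen.eq_univ ⟨hclosed, hopen⟩ ⟨t₀, h0⟩
  exact Set.eq_univ_iff_forall.1 this t

/-! ### Side functions of a hypersurface -/

section SideFunctions

variable {E : Type*} [NormedAddCommGroup E] [NormedSpace ℝ E]

/-- Near `x`, the set `M` is a smooth hypersurface (possibly empty) and `s` is the sign of a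
defining function of it. So `s` vanishes on `M` and labels the two local sides of `M` by `±1`. -/
def IsSideAt (M : Set E) (x : E) (s : E → SignType) : Prop :=
  ∃ (U : Set E) (g : E → ℝ), IsOpen U ∧ x ∈ U ∧ ContDiffOn ℝ ∞ g U ∧
    (∀ y ∈ U, y ∈ M ↔ g y = 0) ∧ (∀ y ∈ U, g y = 0 → fderiv ℝ g y ≠ 0) ∧
    ∀ y ∈ U, s y = SignType.sign (g y)

variable {M : Set E} {x : E} {s s' : E → SignType}

theorem IsSideAt.eventually (h : IsSideAt M x s) : ∀ᶠ y in 𝓝 x, IsSideAt M y s := by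
  obtain ⟨U, g, hU, hx, h⟩ := h
  filter_upwards [hU.mem_nhds hx] with y hy using ⟨U, g, hU, hy, h⟩

theorem isOpen_isSideAt (M : Set E) (s : E → SignType) : IsOpen {x | IsSideAt M x s} :=
  isOpen_iff_mem_nhds.2 fun _ h => IsSideAt.eventually h

theorem IsSideAt.neg (h : IsSideAt M x s) : IsSideAt M x (-s) := by
  obtain ⟨U, g, hU, hx, hg, h0, h1, h2⟩ := h
  refine ⟨U, -g, hU, hx, hg.neg, fun y hy => by simp [h0 y hy], fun y hy hgy => ?_, fun y hy => ?_⟩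
  · rw [fderiv_neg]
    exact neg_ne_zero.2 (h1 y hy (by simpa using hgy))
  · simp [h2 y hy, Left.sign_neg]

theorem IsSideAt.congr (h : IsSideAt M x s) (hs : s =ᶠ[𝓝 x] s') : IsSideAt M x s' := by
  obtain ⟨U, g, hU, hx, hg, h0, h1, h2⟩ := h
  obtain ⟨V, hV, hVo, hxV⟩ := _root_.mem_nhds_iff.1 hs
  exact ⟨U ∩ V, g, hU.inter hVo, ⟨hx, hxV⟩, hg.mono Set.inter_subset_left,
    fun y hy => h0 y hy.1, fun y hy => h1 y hy.1, fun y hy => (hV hy.2).symm.trans (h2 y hy.1)⟩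

theorem IsSideAt.eq_zero_iff (h : IsSideAt M x s) : s x = 0 ↔ x ∈ M := by
  obtain ⟨U, g, hU, hx, hg, h0, h1, h2⟩ := h
  rw [h2 x hx, sign_eq_zero_iff, h0 x hx]

theorem IsSideAt.eventually_eq_of_notMem (h : IsSideAt M x s) (hx : x ∉ M) :
    ∀ᶠ y in 𝓝 x, s y = s x := by
  obtain ⟨U, g, hU, hxU, hg, h0, h1, h2⟩ := h
  have hgx : g x ≠ 0 := fun h => hx ((h0 x hxU).2 h)
  have hc : ContinuousAt g x := (hg.contDiffAt (hU.mem_nhds hxU)).continuousAt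
  rcases lt_or_gt_of_ne hgx with h | h
  · filter_upwards [hU.mem_nhds hxU, hc.eventually (gt_mem_nhds h)] with y hy hy'
    rw [h2 y hy, h2 x hxU, sign_neg h, sign_neg hy']
  · filter_upwards [hU.mem_nhds hxU, hc.eventually (lt_mem_nhds h)] with y hy hy'
    rw [h2 y hy, h2 x hxU, sign_pos h, sign_pos hy']

/-- At a point of the hypersurface, a function with nonzero derivative takes positive values
arbitrarily close by. -/
theorem frequently_pos_of_fderiv_ne_zero {g : E → ℝ} (h0 : g x = 0) (h1 : fderiv ℝ g x ≠ 0) :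
    ∃ᶠ y in 𝓝 x, 0 < g y := by
  intro h
  refine h1 (IsLocalMax.fderiv_eq_zero ?_)
  filter_upwards [h] with y hy
  rw [h0]; exact not_lt.1 hy

theorem IsSideAt.frequently_eq_one (h : IsSideAt M x s) (hx : x ∈ M) : ∃ᶠ y in 𝓝 x, s y = 1 := by
  obtain ⟨U, g, hU, hxU, hg, h0, h1, h2⟩ := h
  have hgx := (h0 x hxU).1 hx
  refine ((frequently_pos_of_fderiv_ne_zero hgx (h1 x hxU hgx)).and_eventually
    (hU.mem_nhds hxU)).mono fun y hy => ?_
  rw [h2 y hy.2, sign_pos hy.1]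

theorem IsSideAt.frequently_ne_zero (h : IsSideAt M x s) : ∃ᶠ y in 𝓝 x, s y ≠ 0 := by
  by_cases hx : x ∈ M
  · exact (h.frequently_eq_one hx).mono fun y hy => by rw [hy]; decide
  · refine ((h.eventually_eq_of_notMem hx).mono fun y hy => ?_).frequently
    rw [hy]; exact fun h' => hx (h.eq_zero_iff.1 h')

theorem sign_const_of_isPreconnected {X : Type*} [TopologicalSpace X] {g : X → ℝ} {S : Set X}
    (hS : IsPreconnected S)
    (hg : ContinuousOn g S) (h0 : ∀ y ∈ S, g y ≠ 0) :
    (∀ y ∈ S, 0 < g y) ∨ ∀ y ∈ S, g y < 0 := by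
  by_contra hcon
  push Not at hcon
  obtain ⟨⟨a, ha, hga⟩, b, hb, hgb⟩ := hcon
  obtain ⟨y, hy, hy0⟩ := hS.intermediate_value ha hb hg ⟨hga, hgb⟩
  exact h0 y hy hy0

variable [FiniteDimensional ℝ E]

/-- Two side functions agree locally up to a sign: on each of the two local sides of `M` both are
constant, and neither defining function has a local extremum on `M`. -/
theorem IsSideAt.eventually_eq_or_neg (h : IsSideAt M x s) (h' : IsSideAt M x s') :
    (∀ᶠ y in 𝓝 x, s y = s' y) ∨ ∀ᶠ y in 𝓝 x, s y = -s' y := by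
  by_cases hxM : x ∈ M
  · obtain ⟨U, g, hU, hx, hg, h0, h1, h2⟩ := h
    obtain ⟨U', g', hU', hx', hg', h0', h1', h2'⟩ := h'
    have hgx : g x = 0 := (h0 x hx).1 hxM
    have hgx' : g' x = 0 := (h0' x hx').1 hxM
    have hsurj : Function.Surjective (fderiv ℝ g x) :=
      LinearMap.surjective (f := (fderiv ℝ g x : E →ₗ[ℝ] ℝ)) fun hz => h1 x hx hgx (by
        ext v; exact LinearMap.congr_fun hz v)
    obtain ⟨p, e, hxe, he, -, -⟩ := exists_straightening hU hg hx hsurj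
    have hsymm : Filter.Tendsto e.symm (𝓝 (e x)) (𝓝 x) := by
      have := e.continuousAt_symm (e.map_source hxe)
      rwa [ContinuousAt, e.left_inv hxe] at this
    obtain ⟨ε, hε, hball⟩ := Metric.eventually_nhds_iff_ball.1
      ((hsymm.eventually ((hU.inter hU').mem_nhds ⟨hx, hx'⟩)).and
        (e.open_target.mem_nhds (e.map_source hxe)))
    have hfst : ∀ z ∈ ball (e x) ε, g (e.symm z) = z.1 := fun z hz => by
      have := congrArg Prod.fst (e.right_inv (hball z hz).2)
      rwa [he] at this
    have hcont : ContinuousOn (fun z => g' (e.symm z)) (ball (e x) ε) := fun z hz =>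
      ((hg'.contDiffAt (hU'.mem_nhds (hball z hz).1.2)).continuousAt.comp
        (e.continuousAt_symm (hball z hz).2)).continuousWithinAt
    have hne : ∀ z ∈ ball (e x) ε, z.1 ≠ 0 → g' (e.symm z) ≠ 0 := fun z hz hz0 hz' => by
      have := (h0' _ (hball z hz).1.2).2 hz'
      rw [h0 _ (hball z hz).1.1, hfst z hz] at this
      exact hz0 this
    have hpos := sign_const_of_isPreconnected (g := fun z => g' (e.symm z))
      (S := ball (e x) ε ∩ {z | 0 < z.1})
      ((convex_ball _ _).inter ((convex_Ioi (0 : ℝ)).linear_preimage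
        (LinearMap.fst ℝ ℝ (fderiv ℝ g x).ker))).isPreconnected
      (hcont.mono Set.inter_subset_left) (fun z hz => hne z hz.1 hz.2.ne')
    have hneg := sign_const_of_isPreconnected (g := fun z => g' (e.symm z))
      (S := ball (e x) ε ∩ {z | z.1 < 0})
      ((convex_ball _ _).inter ((convex_Iio (0 : ℝ)).linear_preimage
        (LinearMap.fst ℝ ℝ (fderiv ℝ g x).ker))).isPreconnected
      (hcont.mono Set.inter_subset_left) (fun z hz => hne z hz.1 hz.2.ne)
    have hnear : ∀ᶠ y in 𝓝 x, y ∈ e.source ∧ e y ∈ ball (e x) ε ∧ y ∈ U ∧ y ∈ U' :=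
      (e.open_source.eventually_mem hxe).and (((e.continuousAt hxe).eventually
        (ball_mem_nhds _ hε)).and ((hU.eventually_mem hx).and (hU'.eventually_mem hx')))
    -- transport the sign information back to a neighbourhood of `x`
    have key : ∀ {P : ℝ → Prop}, (∀ z ∈ ball (e x) ε, z.1 ≠ 0 → P (g' (e.symm z))) → P 0 →
        ∀ᶠ y in 𝓝 x, P (g' y) := fun {P} hP hP0 => by
      filter_upwards [hnear] with y ⟨hy1, hy2, hy3, hy4⟩
      by_cases hgy : g y = 0
      · rw [(h0' y hy4).1 ((h0 y hy3).2 hgy)]; exact hP0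
      · have := hP _ hy2 (by rw [he]; exact hgy)
        rwa [e.left_inv hy1] at this
    have key2 : ∀ {P : ℝ → ℝ → Prop},
        (∀ z ∈ ball (e x) ε, z.1 ≠ 0 → P z.1 (g' (e.symm z))) → P 0 0 →
        ∀ᶠ y in 𝓝 x, P (g y) (g' y) := fun {P} hP hP0 => by
      filter_upwards [hnear] with y ⟨hy1, hy2, hy3, hy4⟩
      by_cases hgy : g y = 0
      · rw [(h0' y hy4).1 ((h0 y hy3).2 hgy), hgy]; exact hP0
      · have := hP _ hy2 (by rw [he]; exact hgy)
        rwa [e.left_inv hy1, he] at this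
    have hU2 : ∀ᶠ y in 𝓝 x, y ∈ U ∧ y ∈ U' :=
      (hU.eventually_mem hx).and (hU'.eventually_mem hx')
    rcases hpos with hp | hp <;> rcases hneg with hn | hn
    · refine absurd (IsLocalMin.fderiv_eq_zero ?_) (h1' x hx' hgx')
      rw [IsLocalMin, IsMinFilter, hgx']
      refine key (P := fun r => 0 ≤ r) (fun z hz hz0 => ?_) le_rfl
      rcases lt_or_gt_of_ne hz0 with h | h
      · exact (hn z ⟨hz, h⟩).le
      · exact (hp z ⟨hz, h⟩).le
    · left
      have := key2 (P := fun a b => SignType.sign a = SignType.sign b) (fun z hz hz0 => by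
        rcases lt_or_gt_of_ne hz0 with h | h
        · rw [sign_neg h, sign_neg (hn z ⟨hz, h⟩)]
        · rw [sign_pos h, sign_pos (hp z ⟨hz, h⟩)]) rfl
      filter_upwards [this, hU2] with y hy hyU
      rw [h2 y hyU.1, h2' y hyU.2, hy]
    · right
      have := key2 (P := fun a b => SignType.sign a = -SignType.sign b) (fun z hz hz0 => by
        rcases lt_or_gt_of_ne hz0 with h | h
        · rw [sign_neg h, sign_pos (hn z ⟨hz, h⟩)]
        · rw [sign_pos h, sign_neg (hp z ⟨hz, h⟩)]; rfl) (by simp)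
      filter_upwards [this, hU2] with y hy hyU
      rw [h2 y hyU.1, h2' y hyU.2, hy]
    · refine absurd (IsLocalMax.fderiv_eq_zero ?_) (h1' x hx' hgx')
      rw [IsLocalMax, IsMaxFilter, hgx']
      refine key (P := fun r => r ≤ 0) (fun z hz hz0 => ?_) le_rfl
      rcases lt_or_gt_of_ne hz0 with h | h
      · exact (hn z ⟨hz, h⟩).le
      · exact (hp z ⟨hz, h⟩).le
  · have e1 := h.eventually_eq_of_notMem hxM
    have e2 := h'.eventually_eq_of_notMem hxM
    have n1 : s x ≠ 0 := fun h0 => hxM (h.eq_zero_iff.1 h0)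
    have n2 : s' x ≠ 0 := fun h0 => hxM (h'.eq_zero_iff.1 h0)
    have : s x = s' x ∨ s x = -s' x := by
      generalize s x = a at n1; generalize s' x = b at n2
      revert a b; decide
    refine this.imp (fun h => ?_) fun h => ?_ <;>
    · filter_upwards [e1, e2] with y h1 h2
      rw [h1, h2, h]

/-- On a preconnected set two side functions agree up to a global sign. -/
theorem eqOn_or_eqOn_neg_of_isSideAt {W : Set E} (hW : IsPreconnected W)
    (h : ∀ x ∈ W, IsSideAt M x s) (h' : ∀ x ∈ W, IsSideAt M x s') :
    (∀ x ∈ W, ∀ᶠ y in 𝓝 x, s y = s' y) ∨ ∀ x ∈ W, ∀ᶠ y in 𝓝 x, s y = -s' y := by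
  refine isPreconnected_iff_subset_of_disjoint.1 hW {x | ∀ᶠ y in 𝓝 x, s y = s' y}
    {x | ∀ᶠ y in 𝓝 x, s y = -s' y} isOpen_setOfPred_eventually_nhds isOpen_setOfPred_eventually_nhds
    (fun x hx => (h x hx).eventually_eq_or_neg (h' x hx)) ?_
  refine Set.eq_empty_of_forall_notMem fun x ⟨hx, h1, h2⟩ => ?_
  obtain ⟨y, hy, hy1, hy2⟩ := ((h x hx).frequently_ne_zero.and_eventually (h1.and h2)).exists
  rw [hy1] at hy hy2
  generalize s' y = a at hy hy2
  clear * - hy hy2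
  revert a; decide

/-- Two side functions on open sets with preconnected nonempty intersection can be glued. -/
theorem exists_isSideAt_union {W₁ W₂ : Set E} (h₁ : IsOpen W₁) (h₂ : IsOpen W₂)
    (hW : IsPreconnected (W₁ ∩ W₂))
    (hs : ∀ x ∈ W₁, IsSideAt M x s) (hs' : ∀ x ∈ W₂, IsSideAt M x s') :
    ∃ σ : E → SignType, ∀ x ∈ W₁ ∪ W₂, IsSideAt M x σ := by
  classical
  -- after a change of sign the two functions agree on the intersection
  obtain ⟨t, ht, hst⟩ : ∃ t : E → SignType, (∀ x ∈ W₂, IsSideAt M x t) ∧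
      ∀ x ∈ W₁ ∩ W₂, s x = t x := by
    rcases eqOn_or_eqOn_neg_of_isSideAt hW (fun x hx => hs x hx.1) (fun x hx => hs' x hx.2)
      with h | h
    · exact ⟨s', hs', fun x hx => (h x hx).self_of_nhds⟩
    · exact ⟨-s', fun x hx => (hs' x hx).neg, fun x hx => (h x hx).self_of_nhds⟩
  refine ⟨fun x => if x ∈ W₁ then s x else t x, ?_⟩
  rintro x (hx | hx)
  · refine (hs x hx).congr ?_
    filter_upwards [h₁.mem_nhds hx] with y hy
    rw [if_pos hy]
  · refine (ht x hx).congr ?_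
    filter_upwards [h₂.mem_nhds hx] with y hy
    by_cases hy1 : y ∈ W₁
    · rw [if_pos hy1, hst y ⟨hy1, hy⟩]
    · rw [if_neg hy1]

/-- Local side functions exist along a segment if they exist near each of its points. -/
theorem exists_isSideAt_thickening_segment (o x : E)
    (h : ∀ y ∈ segment ℝ o x, ∃ s, IsSideAt M y s) :
    ∃ δ > 0, ∃ s, ∀ y ∈ thickening δ (segment ℝ o x), IsSideAt M y s := by
  have hcomp : IsCompact (segment ℝ o x) := by
    rw [segment_eq_image_lineMap]
    exact isCompact_Icc.image (AffineMap.lineMap_continuous)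
  obtain ⟨r, hr, hball⟩ := lebesgue_number_lemma_of_metric hcomp
    (fun s : E → SignType => isOpen_isSideAt M s) (fun y hy => by
      obtain ⟨s, hs⟩ := h y hy
      exact Set.mem_iUnion.2 ⟨s, hs⟩)
  obtain ⟨n, hn⟩ := exists_nat_gt (‖x - o‖ / (r / 2))
  let z : ℝ → E := fun t => o + t • (x - o)
  have hn0 : 0 < (n : ℝ) := lt_of_le_of_lt (by positivity) hn
  have hz : ∀ t ∈ Set.Icc (0 : ℝ) 1, z t ∈ segment ℝ o x := fun t ht => by
    rw [segment_eq_image']; exact ⟨t, ht, rfl⟩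
  have hdist : ∀ a b : ℝ, dist (z a) (z b) = |a - b| * ‖x - o‖ := fun a b => by
    simp only [z, dist_eq_norm]
    rw [show o + a • (x - o) - (o + b • (x - o)) = (a - b) • (x - o) by module, norm_smul,
      Real.norm_eq_abs]
  have hseg : ∀ k : ℕ, k ≤ n → ∃ s, ∀ y ∈ thickening (r / 2) (segment ℝ o (z (k / n))),
      IsSideAt M y s := by
    intro k
    induction k with
    | zero =>
      intro _
      obtain ⟨s, hs⟩ := hball o (left_mem_segment ℝ o x)
      refine ⟨s, fun y hy => hs ?_⟩
      simp only [Nat.cast_zero, zero_div, z, zero_smul, add_zero, segment_same,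
        thickening_singleton] at hy
      exact ball_subset_ball (by linarith) hy
    | succ k ih =>
      intro hk
      obtain ⟨s₁, hs₁⟩ := ih (by omega)
      have hk1 : (k : ℝ) / n ∈ Set.Icc (0 : ℝ) 1 :=
        ⟨by positivity, by rw [div_le_one hn0]; exact_mod_cast (by omega : k ≤ n)⟩
      obtain ⟨s₂, hs₂⟩ := hball _ (hz _ hk1)
      obtain ⟨σ, hσ⟩ := exists_isSideAt_union isOpen_thickening isOpen_ball
        (((convex_segment o (z (k / n))).thickening (r / 2)).inter
          (convex_ball (z (k / n)) r)).isPreconnected hs₁ (fun y hy => hs₂ hy)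
      refine ⟨σ, fun y hy => hσ y ?_⟩
      obtain ⟨w, hw, hyw⟩ := mem_thickening_iff.1 hy
      rw [segment_eq_image'] at hw
      obtain ⟨θ, hθ, rfl⟩ := hw
      have hw' : o + θ • (z ((k + 1 : ℕ) / n) - o) = z (θ * ((k + 1 : ℕ) / n)) := by
        simp only [z]; module
      dsimp only at hyw
      rw [hw'] at hyw
      by_cases hle : θ * ((k + 1 : ℕ) / n) ≤ k / n
      · left
        refine mem_thickening_iff.2 ⟨_, ?_, hyw⟩
        rw [segment_eq_image']
        rcases hk1.1.eq_or_lt with h0 | h0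
        · refine ⟨0, by simp, ?_⟩
          have : θ * ((k + 1 : ℕ) / n) = 0 :=
            le_antisymm (h0 ▸ hle) (mul_nonneg hθ.1 (by positivity))
          rw [this]; simp [z]
        · refine ⟨θ * ((k + 1 : ℕ) / n) / (k / n), ⟨?_, ?_⟩, ?_⟩
          · exact div_nonneg (mul_nonneg hθ.1 (by positivity)) h0.le
          · rwa [div_le_one h0]
          · simp only [z, add_sub_cancel_left, smul_smul]
            rw [div_mul_cancel₀ _ h0.ne']
      · right
        rw [mem_ball]
        refine lt_of_le_of_lt (dist_triangle _ (z (θ * ((k + 1 : ℕ) / n))) _) ?_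
        have h1 : dist (z (θ * ((k + 1 : ℕ) / n))) (z (k / n)) ≤ 1 / n * ‖x - o‖ := by
          rw [hdist]
          refine mul_le_mul_of_nonneg_right ?_ (norm_nonneg _)
          rw [abs_of_nonneg (by linarith)]
          have : θ * ((k + 1 : ℕ) / n) ≤ ((k + 1 : ℕ) : ℝ) / n :=
            mul_le_of_le_one_left (by positivity) hθ.2
          have h3 : ((k + 1 : ℕ) : ℝ) / n = k / n + 1 / n := by push_cast; ring
          linarith
        have h2 : 1 / n * ‖x - o‖ < r / 2 := by
          rw [div_lt_iff₀ (by positivity)] at hn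
          rw [one_div, inv_mul_lt_iff₀ hn0]; exact hn
        linarith
  obtain ⟨s, hs⟩ := hseg n le_rfl
  refine ⟨r / 2, by positivity, s, ?_⟩
  have hzn : z (n / n) = x := by simp [z, hn0.ne']
  rwa [hzn] at hs

/-- On an open starshaped set, local side functions can be chosen consistently. -/
theorem exists_isSideAt_of_starConvex {Ω : Set E} (hΩ : IsOpen Ω) {o : E} (hstar : StarConvex ℝ o Ω)
    (ho : o ∈ Ω) (h : ∀ y ∈ Ω, ∃ s, IsSideAt M y s) : ∃ s, ∀ y ∈ Ω, IsSideAt M y s := by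
  classical
  obtain ⟨s₀, hs₀⟩ := h o ho
  have hloc : ∀ x : E, ∃ (δ : ℝ) (s : E → SignType), x ∈ Ω → 0 < δ ∧
      (∀ y ∈ thickening δ (segment ℝ o x), IsSideAt M y s) ∧ ∀ᶠ y in 𝓝 o, s y = s₀ y := by
    intro x
    by_cases hx : x ∈ Ω
    · obtain ⟨δ, hδ, s, hs⟩ := exists_isSideAt_thickening_segment o x
        (fun y hy => h y (hstar.segment_subset hx hy))
      have hso := hs o (self_subset_thickening hδ _ (left_mem_segment ℝ o x))
      rcases hso.eventually_eq_or_neg hs₀ with h1 | h1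
      · exact ⟨δ, s, fun _ => ⟨hδ, hs, h1⟩⟩
      · refine ⟨δ, -s, fun _ => ⟨hδ, fun y hy => (hs y hy).neg, ?_⟩⟩
        filter_upwards [h1] with y hy
        simp [hy]
    · exact ⟨1, s₀, fun h => absurd h hx⟩
  choose δ s hs using hloc
  refine ⟨fun x => s x x, fun x hx => ?_⟩
  obtain ⟨hδ, hsx, hsx0⟩ := hs x hx
  have hmem := self_subset_thickening hδ (segment ℝ o x) (right_mem_segment ℝ o x)
  refine (hsx x hmem).congr ?_
  filter_upwards [isOpen_thickening.mem_nhds hmem, hΩ.mem_nhds hx] with y hy hyΩ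
  obtain ⟨hδ', hsy, hsy0⟩ := hs y hyΩ
  have hpre : IsPreconnected
      (thickening (δ x) (segment ℝ o x) ∩ thickening (δ y) (segment ℝ o y)) :=
    (((convex_segment o x).thickening _).inter ((convex_segment o y).thickening _)).isPreconnected
  have hoo : o ∈ thickening (δ x) (segment ℝ o x) ∩ thickening (δ y) (segment ℝ o y) :=
    ⟨self_subset_thickening hδ _ (left_mem_segment ℝ o x),
      self_subset_thickening hδ' _ (left_mem_segment ℝ o y)⟩
  rcases eqOn_or_eqOn_neg_of_isSideAt hpre (fun z hz => hsx z hz.1) (fun z hz => hsy z hz.2)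
    with h1 | h1
  · exact (h1 y ⟨hy, self_subset_thickening hδ' _ (right_mem_segment ℝ o y)⟩).self_of_nhds
  · exfalso
    obtain ⟨z, hz, h2, h3, h4⟩ := (hs₀.frequently_ne_zero.and_eventually
      ((h1 o hoo).and (hsx0.and hsy0))).exists
    rw [h3, h4] at h2
    generalize s₀ z = a at hz h2
    clear * - hz h2
    revert a; decide

end SideFunctions

/-! ### A closed surface separates a starshaped hypersurface -/

/-- `ℝ⁴ ∖ {0}` is the union of two open starshaped sets with connected intersection, so local side
functions can be chosen consistently on it. This is where simple connectedness of `S³` enters. -/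
theorem exists_isSideAt_compl_zero {M : Set R4} (h : ∀ x : R4, x ≠ 0 → ∃ s, IsSideAt M x s) :
    ∃ s, ∀ x : R4, x ≠ 0 → IsSideAt M x s := by
  let A : Set R4 := {x | x 1 ≠ 0 ∨ x 2 ≠ 0 ∨ x 3 ≠ 0}
  let Ω₁ : Set R4 := {x | 0 < x 0} ∪ A
  let Ω₂ : Set R4 := {x | x 0 < 0} ∪ A
  have hco : ∀ i : Fin 4, Continuous fun x : R4 => x i := fun i => by fun_prop
  have hne : ∀ i : Fin 4, IsOpen {x : R4 | x i ≠ 0} := fun i =>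
    isOpen_ne_fun (hco i) continuous_const
  have hA : IsOpen A := (hne 1).union ((hne 2).union (hne 3))
  have h1 : IsOpen Ω₁ := (isOpen_lt continuous_const (hco 0)).union hA
  have h2 : IsOpen Ω₂ := (isOpen_lt (hco 0) continuous_const).union hA
  have hA0 : ∀ x ∈ A, x ≠ 0 := by rintro x hx rfl; simp [A] at hx
  have h10 : ∀ x ∈ Ω₁, x ≠ 0 := by
    rintro x (hx | hx)
    · rintro rfl; simp at hx
    · exact hA0 x hx
  have h20 : ∀ x ∈ Ω₂, x ≠ 0 := by
    rintro x (hx | hx)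
    · rintro rfl; simp at hx
    · exact hA0 x hx
  let e : R4 := EuclideanSpace.single 0 1
  have e0 : e 0 = 1 := by simp [e]
  have e1 : e 1 = 0 := by simp [e]
  have e2 : e 2 = 0 := by simp [e]
  have e3 : e 3 = 0 := by simp [e]
  have hs1 : StarConvex ℝ e Ω₁ := by
    intro x hx a b ha hb hab
    rcases hb.eq_or_lt with rfl | hb
    · left; simp only [add_zero] at hab; simp [hab, e0]
    · rcases hx with hx | hx
      · left
        have hx : 0 < x 0 := hx
        have : 0 < a * e 0 + b * x 0 := by rw [e0]; positivity
        simpa using this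
      · right
        simpa [A, e1, e2, e3, hb.ne'] using hx
  have hs2 : StarConvex ℝ (-e) Ω₂ := by
    intro x hx a b ha hb hab
    rcases hb.eq_or_lt with rfl | hb
    · left; simp only [add_zero] at hab; simp [hab, e0]
    · rcases hx with hx | hx
      · left
        have hx : x 0 < 0 := hx
        have : -(a * e 0) + b * x 0 < 0 := by rw [e0]; nlinarith
        simpa using this
      · right
        simpa [A, e1, e2, e3, hb.ne'] using hx
  have hA' : Ω₁ ∩ Ω₂ = ((Submodule.span ℝ {e} : Submodule ℝ R4) : Set R4)ᶜ := by
    ext x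
    rw [Set.mem_compl_iff, SetLike.mem_coe, Submodule.mem_span_singleton]
    constructor
    · rintro ⟨hx1, hx2⟩ ⟨r, rfl⟩
      have hn : r • e ∉ A := by simp [A, e1, e2, e3]
      have h1 : 0 < (r • e) 0 := hx1.resolve_right hn
      have h2 : (r • e) 0 < 0 := hx2.resolve_right hn
      exact lt_asymm h1 h2
    · intro hx
      have : x ∈ A := by
        by_contra hxA
        simp only [A, Set.mem_ofPred_eq, not_or, not_not] at hxA
        refine hx ⟨x 0, ?_⟩
        ext i
        fin_cases i <;> simp [e, hxA]
      exact ⟨Or.inr this, Or.inr this⟩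
  -- the complement of a line in `ℝ⁴` is connected
  have hconn : IsPreconnected (Ω₁ ∩ Ω₂) := by
    rw [hA']
    refine (isConnected_compl_of_one_lt_codim ?_).isPreconnected
    rw [← Module.finrank_eq_rank]
    have hr := Submodule.finrank_quotient_add_finrank (Submodule.span ℝ {e})
    have he : e ≠ 0 := fun h => by rw [h] at e0; simp at e0
    rw [finrank_span_singleton he, finrank_euclideanSpace_fin] at hr
    have : Module.finrank ℝ (R4 ⧸ Submodule.span ℝ {e}) = 3 := by omega
    rw [this]; norm_num
  obtain ⟨s, hs⟩ := exists_isSideAt_of_starConvex h1 hs1 (Or.inl (by simp [e0]))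
    (fun y hy => h y (h10 y hy))
  obtain ⟨s', hs'⟩ := exists_isSideAt_of_starConvex h2 hs2 (Or.inl (by simp [e0]))
    (fun y hy => h y (h20 y hy))
  obtain ⟨σ, hσ⟩ := exists_isSideAt_union h1 h2 hconn hs hs'
  refine ⟨σ, fun x hx => hσ x ?_⟩
  by_contra hcon
  simp only [Ω₁, Ω₂, A, Set.mem_union, Set.mem_ofPred_eq, not_or, not_lt, not_not] at hcon
  obtain ⟨⟨a0, a1, a2, a3⟩, b0, -⟩ := hcon
  refine hx ?_
  ext i
  fin_cases i
  · exact le_antisymm a0 b0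
  · exact a1
  · exact a2
  · exact a3

/-- An embedded surface in a starshaped hypersurface is locally cut out in it by one function whose
derivative does not vanish on the tangent space of the hypersurface. -/
theorem exists_local_equation {K : R4 → ℝ} (hK : IsHomogHam K) {L : Set R4}
    (hL : IsEmbeddedSurface L) (hLN : L ⊆ unitLevel K) {z : R4} (hz : z ∈ L) :
    ∃ (U : Set R4) (m : R4 → ℝ), IsOpen U ∧ z ∈ U ∧ ContDiffOn ℝ ∞ m U ∧
      (∀ y ∈ U, y ∈ unitLevel K → (y ∈ L ↔ m y = 0)) ∧
      ∃ v, fderiv ℝ K z v = 0 ∧ fderiv ℝ m z v ≠ 0 := by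
  obtain ⟨U, hU, hzU, g, hg, hsurj, hLU⟩ := hL z hz
  have hmemL : ∀ y ∈ U, (y ∈ L ↔ g y = 0) := fun y hy => by
    have : y ∈ L ∩ U ↔ y ∈ {y ∈ U | g y = 0} := by rw [hLU]
    simpa [hy] using this
  have hz0 : z ≠ 0 := hK.ne_zero_of_mem (hLN hz)
  have hK1 : K z = 1 := hLN hz
  have hEz : fderiv ℝ K z z = 2 := by rw [hK.fderiv_self hz0, hK1, mul_one]
  have hker : ∀ v, fderiv ℝ g z v = 0 → fderiv ℝ K z v = 0 := fun v hv => by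
    have := tangentVectors_mono hLN z
      (mem_tangentVectors_of_mem_ker hU hg hsurj hLU ⟨hz, hzU⟩ hv)
    rwa [hK.tangentVectors_eq (hLN hz)] at this
  have hgd : ∀ y ∈ U, HasFDerivAt g (fderiv ℝ g y) y := fun y hy =>
    ((hg.contDiffAt (hU.mem_nhds hy)).differentiableAt (by simp)).hasFDerivAt
  -- `ℓ` is chosen to kill the radial direction, along which `K` increases
  let b := fderiv ℝ g z z
  have hb : b ≠ 0 := fun h => by have := hker z h; rw [hEz] at this; norm_num at this
  have hb2 : 0 < b 0 ^ 2 + b 1 ^ 2 := by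
    have : b 0 ≠ 0 ∨ b 1 ≠ 0 := by
      by_contra hcon
      push Not at hcon
      exact hb (by ext i; fin_cases i <;> simp [hcon])
    rcases this with h | h <;> positivity
  let ℓ : EuclideanSpace ℝ (Fin 2) →L[ℝ] ℝ :=
    b 0 • EuclideanSpace.proj (𝕜 := ℝ) (1 : Fin 2) - b 1 • EuclideanSpace.proj (𝕜 := ℝ) (0 : Fin 2)
  have hℓ : ∀ u, ℓ u = b 0 * u 1 - b 1 * u 0 := fun u => by simp [ℓ]
  have hℓb : ℓ b = 0 := by rw [hℓ]; ring
  have hℓspan : ∀ u, ℓ u = 0 → ∃ τ : ℝ, u = τ • b := fun u hu => by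
    rw [hℓ] at hu
    refine ⟨(b 0 * u 0 + b 1 * u 1) / (b 0 ^ 2 + b 1 ^ 2), ?_⟩
    have h : b 0 * u 1 = b 1 * u 0 := by linarith
    ext i
    fin_cases i
    · simp only [Fin.zero_eta, PiLp.smul_apply, smul_eq_mul]
      rw [div_mul_eq_mul_div, eq_div_iff hb2.ne']
      linear_combination (-b 1) * h
    · simp only [Fin.mk_one, PiLp.smul_apply, smul_eq_mul]
      rw [div_mul_eq_mul_div, eq_div_iff hb2.ne']
      linear_combination b 0 * h
  -- along the direction transverse to `ℓ` the function `K` is strictly monotone near `L`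
  obtain ⟨p, e, hze, he, -, hsm⟩ := exists_straightening hU hg hzU (hsurj z hzU)
  have hgz : g z = 0 := (hmemL z hzU).1 hz
  have hsymm : Filter.Tendsto e.symm (𝓝 (e z)) (𝓝 z) := by
    have := e.continuousAt_symm (e.map_source hze)
    rwa [ContinuousAt, e.left_inv hze] at this
  let k := fun w => K (e.symm w)
  have hk : ContDiffAt ℝ ∞ k (e z) := by
    refine ContDiffAt.comp (e z) ?_ hsm.self_of_nhds
    rw [e.left_inv hze]
    exact hK.contDiffAt hz0
  have hdsymm : HasFDerivAt e.symm (fderiv ℝ e.symm (e z)) (e z) :=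
    (hsm.self_of_nhds.differentiableAt (by simp)).hasFDerivAt
  let ζ := fderiv ℝ e.symm (e z) (b, 0)
  have hζ : fderiv ℝ g z ζ = b := by
    have h1 : HasFDerivAt (fun w => g (e.symm w))
        ((fderiv ℝ g z).comp (fderiv ℝ e.symm (e z))) (e z) :=
      HasFDerivAt.comp (e z) (by rw [e.left_inv hze]; exact hgd z hzU) hdsymm
    have h2 : HasFDerivAt (fun w => g (e.symm w)) (ContinuousLinearMap.fst ℝ _ _) (e z) := by
      refine (ContinuousLinearMap.fst ℝ (EuclideanSpace ℝ (Fin 2))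
        (fderiv ℝ g z).ker).hasFDerivAt.congr_of_eventuallyEq ?_
      filter_upwards [e.open_target.mem_nhds (e.map_source hze)] with w hw
      have := congrArg Prod.fst (e.right_inv hw)
      rwa [he] at this
    have := DFunLike.congr_fun (h1.unique h2) (b, 0)
    simpa using this
  have hdk : fderiv ℝ k (e z) (b, 0) = 2 := by
    have h1 : HasFDerivAt k ((fderiv ℝ K z).comp (fderiv ℝ e.symm (e z))) (e z) :=
      HasFDerivAt.comp (e z) (by rw [e.left_inv hze]; exact hK.hasFDerivAt hz0) hdsymm
    rw [h1.fderiv]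
    have h2 : fderiv ℝ K z (ζ - z) = 0 := hker _ (by rw [map_sub, hζ, sub_self])
    rw [map_sub, hEz, sub_eq_zero] at h2
    exact h2
  have hkpos : ∀ᶠ w in 𝓝 (e z), 0 < fderiv ℝ k w (b, 0) := by
    have hc : ContinuousAt (fun w => fderiv ℝ k w (b, 0)) (e z) :=
      (hk.continuousAt_fderiv (by simp)).clm_apply continuousAt_const
    exact hc.eventually (lt_mem_nhds (by simp only [hdk]; norm_num))
  have hkd : ∀ᶠ w in 𝓝 (e z), DifferentiableAt ℝ k w :=
    ((hk.of_le (m := 1) (by simp)).eventually (by simp)).mono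
      fun w hw => hw.differentiableAt (by simp)
  obtain ⟨ε, hε, hball⟩ := Metric.eventually_nhds_iff_ball.1 ((hkpos.and hkd).and
    ((e.open_target.eventually_mem (e.map_source hze)).and
      (hsymm.eventually (hU.eventually_mem hzU))))
  have hproj : Filter.Tendsto (fun y => ((0 : EuclideanSpace ℝ (Fin 2)), p y)) (𝓝 z)
      (𝓝 (e z)) := by
    rw [he, hgz]
    exact tendsto_const_nhds.prodMk_nhds (p.continuous.tendsto z)
  have hnear : ∀ᶠ y in 𝓝 z, y ∈ U ∧ y ∈ e.source ∧ e y ∈ ball (e z) ε ∧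
      ((0 : EuclideanSpace ℝ (Fin 2)), p y) ∈ ball (e z) ε :=
    (hU.eventually_mem hzU).and ((e.open_source.eventually_mem hze).and
      (((e.continuousAt hze).eventually (ball_mem_nhds _ hε)).and
        (hproj.eventually (ball_mem_nhds _ hε))))
  obtain ⟨U', hU'sub, hU', hzU'⟩ := _root_.mem_nhds_iff.1 hnear
  refine ⟨U', fun y => ℓ (g y), hU', hzU', ℓ.contDiff.comp_contDiffOn
    (hg.mono fun y hy => (hU'sub hy).1), fun y hy hyN => ⟨fun hyL => ?_, fun hm => ?_⟩, ?_⟩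
  · dsimp only
    rw [(hmemL y (hU'sub hy).1).1 hyL, map_zero]
  · obtain ⟨hyU, hys, hy1, hy2⟩ := hU'sub hy
    obtain ⟨τ, hτ⟩ := hℓspan _ hm
    rw [hmemL y hyU, hτ]
    let σ : ℝ → EuclideanSpace ℝ (Fin 2) × (fderiv ℝ g z).ker := fun t => (t • τ • b, p y)
    have hσmem : ∀ t ∈ Set.Icc (0 : ℝ) 1, σ t ∈ ball (e z) ε := fun t ht => by
      have := (convex_ball (e z) ε) hy2 hy1 (sub_nonneg.2 ht.2) ht.1 (by ring)
      rw [he y, hτ] at this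
      convert! this using 1
      simp only [σ, Prod.smul_mk, smul_zero, Prod.mk_add_mk, zero_add]
      congr 1
      module
    have hσd : ∀ t, HasDerivAt σ (τ • b, 0) t := fun t =>
      (by simpa using (hasDerivAt_id t).smul_const (τ • b) :
        HasDerivAt (fun t : ℝ => t • τ • b) (τ • b) t).prodMk (hasDerivAt_const t (p y))
    have hkσ : ∀ t ∈ Set.Icc (0 : ℝ) 1, HasDerivAt (fun t => k (σ t))
        (fderiv ℝ k (σ t) (τ • b, 0)) t := fun t ht =>
      HasFDerivAt.comp_hasDerivAt t (hball _ (hσmem t ht)).1.2.hasFDerivAt (hσd t)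
    have hk0 : k (σ 0) = 1 := by
      have hmem := hσmem 0 (by simp)
      have : e.symm (σ 0) ∈ L := by
        rw [hmemL _ (hball _ hmem).2.2]
        have := congrArg Prod.fst (e.right_inv (hball _ hmem).2.1)
        rw [he] at this
        simpa [σ] using this
      exact hLN this
    have hk1 : k (σ 1) = 1 := by
      have : σ 1 = e y := by simp [σ, he, hτ]
      simp only [k, this, e.left_inv hys]
      exact hyN
    obtain ⟨t, ht, ht0⟩ := exists_hasDerivAt_eq_zero (f := fun t => k (σ t)) zero_lt_one
      (fun t ht => (hkσ t ht).continuousAt.continuousWithinAt) (hk0.trans hk1.symm)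
      (fun t ht => hkσ t ⟨ht.1.le, ht.2.le⟩)
    have hsm0 : ((τ • b, 0) : EuclideanSpace ℝ (Fin 2) × (fderiv ℝ g z).ker) = τ • (b, 0) := by
      simp
    rw [hsm0, map_smul, smul_eq_mul] at ht0
    have := (hball _ (hσmem t ⟨ht.1.le, ht.2.le⟩)).1.1
    rcases mul_eq_zero.1 ht0 with h | h
    · rw [h, zero_smul]
    · exact absurd h this.ne'
  · obtain ⟨v₀, hv₀⟩ := hsurj z hzU (!₂[-b 1, b 0])
    refine ⟨v₀ - (fderiv ℝ K z v₀ / 2) • z, by rw [map_sub, map_smul, hEz, smul_eq_mul]; ring, ?_⟩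
    have h1 : HasFDerivAt (fun y => ℓ (g y)) (ℓ.comp (fderiv ℝ g z)) z :=
      ℓ.hasFDerivAt.comp z (hgd z hzU)
    rw [h1.fderiv, ContinuousLinearMap.comp_apply, map_sub, map_sub, map_smul, map_smul, hv₀]
    change ℓ _ - _ • ℓ b ≠ 0
    rw [hℓb, hℓ]
    have : b 0 * b 0 - b 1 * -b 1 ≠ 0 := by nlinarith
    simpa using this

/-- The cone over an embedded closed surface in a starshaped hypersurface is a smooth hypersurface
in `ℝ⁴ ∖ {0}`. -/
theorem exists_isSideAt_cone {K : R4 → ℝ} (hK : IsHomogHam K) {L : Set R4}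
    (hL : IsEmbeddedSurface L) (hLc : IsClosed L) (hLN : L ⊆ unitLevel K) {x : R4} (hx : x ≠ 0) :
    ∃ s, IsSideAt {y : R4 | (√(K y))⁻¹ • y ∈ L} x s := by
  let ν : R4 → R4 := fun y => (√(K y))⁻¹ • y
  have hν : ∀ y, y ≠ 0 → ContDiffAt ℝ ∞ ν y := fun y hy =>
    (((hK.contDiffAt hy).sqrt (hK.pos y hy).ne').inv
      (Real.sqrt_pos.2 (hK.pos y hy)).ne').smul contDiffAt_id
  have hνc : ContinuousOn ν {0}ᶜ := fun y hy => (hν y hy).continuousAt.continuousWithinAt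
  by_cases hxL : ν x ∈ L
  · obtain ⟨U, m, hU, hzU, hm, hmL, v, hv, hmv⟩ := exists_local_equation hK hL hLN hxL
    have hGd : ∀ y, y ≠ 0 → ν y ∈ U → ContDiffAt ℝ ∞ (fun y => m (ν y)) y := fun y hy hyU =>
      ContDiffAt.comp (f := ν) y (hm.contDiffAt (hU.mem_nhds hyU)) (hν y hy)
    have hreg : fderiv ℝ (fun y => m (ν y)) x ≠ 0 := by
      have hz : ν x ∈ unitLevel K := hK.smul_mem hx
      have hvt : v ∈ tangentVectors (unitLevel K) (ν x) := by
        rw [hK.tangentVectors_eq hz]; exact hv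
      obtain ⟨c, hc, hc0, hcN, rfl⟩ := hvt
      have hr : 0 < √(K x) := Real.sqrt_pos.2 (hK.pos x hx)
      have hcd : HasDerivAt c (deriv c 0) 0 := (hc.differentiable (by simp) 0).hasDerivAt
      have h1 : HasDerivAt (fun t => m (c t)) (fderiv ℝ m (ν x) (deriv c 0)) 0 := by
        refine HasFDerivAt.comp_hasDerivAt (0 : ℝ) ?_ hcd
        rw [hc0]
        exact ((hm.contDiffAt (hU.mem_nhds hzU)).differentiableAt (by simp)).hasFDerivAt
      have h2 : HasDerivAt (fun t => m (ν (√(K x) • c t)))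
          (fderiv ℝ (fun y => m (ν y)) x (√(K x) • deriv c 0)) 0 := by
        refine HasFDerivAt.comp_hasDerivAt (l := fun y => m (ν y)) (0 : ℝ) ?_
          (hcd.const_smul (√(K x)))
        have : √(K x) • c 0 = x := by
          rw [hc0]; simp only [ν, smul_smul, mul_inv_cancel₀ hr.ne', one_smul]
        change HasFDerivAt _ _ (√(K x) • c 0)
        rw [this]
        exact ((hGd x hx hzU).differentiableAt (by simp)).hasFDerivAt
      have h3 : (fun t => m (c t)) =ᶠ[𝓝 0] fun t => m (ν (√(K x) • c t)) := by
        filter_upwards [hcN] with t ht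
        have ht : K (c t) = 1 := ht
        simp only [ν]
        rw [hK.homog _ hr, ht, mul_one, Real.sqrt_sq hr.le, smul_smul, inv_mul_cancel₀ hr.ne',
          one_smul]
      have h4 := h1.unique (h2.congr_of_eventuallyEq h3)
      intro h0
      rw [h0] at h4
      exact hmv h4
    have hW : IsOpen ({0}ᶜ ∩ ν ⁻¹' U) := hνc.isOpen_inter_preimage isOpen_compl_singleton hU
    have hfc : ContinuousAt (fderiv ℝ (fun y => m (ν y))) x :=
      (hGd x hx hzU).continuousAt_fderiv (by simp)
    obtain ⟨V, hVsub, hV, hxV⟩ := _root_.mem_nhds_iff.1 (hfc.eventually_ne hreg)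
    refine ⟨fun y => SignType.sign (m (ν y)), ({0}ᶜ ∩ ν ⁻¹' U) ∩ V, fun y => m (ν y), hW.inter hV,
      ⟨⟨hx, hzU⟩, hxV⟩, fun y hy => (hGd y hy.1.1 hy.1.2).contDiffWithinAt,
      fun y hy => hmL _ hy.1.2 (hK.smul_mem hy.1.1), fun y hy _ => hVsub hy.2, fun y _ => rfl⟩
  · have hW : IsOpen ({0}ᶜ ∩ ν ⁻¹' Lᶜ) :=
      hνc.isOpen_inter_preimage isOpen_compl_singleton hLc.isOpen_compl
    refine ⟨fun _ => 1, {0}ᶜ ∩ ν ⁻¹' Lᶜ, fun _ => 1, hW, ⟨hx, hxL⟩, contDiffOn_const,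
      fun y hy => ?_, fun y hy h => absurd h one_ne_zero, fun y hy => by simp⟩
    have : ν y ∉ L := hy.2
    simpa using this

theorem IsHomogHam.sqrt_inv_smul_eq_self {K : R4 → ℝ} {x : R4} (hx : x ∈ unitLevel K) :
    (√(K x))⁻¹ • x = x := by
  have : K x = 1 := hx
  simp [this]

/-- A closed Lagrangian separates a starshaped hypersurface into two open invariant sets. -/
theorem exists_separation {K : R4 → ℝ} (hK : IsHomogHam K) {L : Set R4}
    (hL : IsClosedLagrangian L) (hLN : L ⊆ unitLevel K) :
    ∃ U V : Set R4, U.Nonempty ∧ V.Nonempty ∧ Disjoint U V ∧ U ∪ V = unitLevel K \ L ∧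
      (∃ O : Set R4, IsOpen O ∧ U = unitLevel K ∩ O) ∧
      (∃ O : Set R4, IsOpen O ∧ V = unitLevel K ∩ O) ∧
      IsReebInvariant (unitLevel K) U ∧ IsReebInvariant (unitLevel K) V := by
  obtain ⟨s, hs⟩ := exists_isSideAt_compl_zero
    (fun x hx => exists_isSideAt_cone hK hL.2.2.1 hL.2.1.isClosed hLN hx)
  let M : Set R4 := {y : R4 | (√(K y))⁻¹ • y ∈ L}
  have hs : ∀ x : R4, x ≠ 0 → IsSideAt M x s := hs
  let O : SignType → Set R4 := fun a => {x | x ≠ 0 ∧ x ∉ M ∧ s x = a}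
  have hOo : ∀ a, IsOpen (O a) := fun a => isOpen_iff_mem_nhds.2 fun x ⟨hx, hxM, hxa⟩ => by
    filter_upwards [isOpen_compl_singleton.mem_nhds hx, (hs x hx).eventually_eq_of_notMem hxM,
      (hs x hx).eventually] with y hy hys hyS
    refine ⟨hy, fun hyM => ?_, hys.trans hxa⟩
    rw [← hyS.eq_zero_iff, hys, (hs x hx).eq_zero_iff] at hyM
    exact hxM hyM
  have hcover : ∀ x, x ≠ 0 → x ∉ M → x ∈ O 1 ∪ O (-1) := fun x hx hxM => by
    have h0 : s x ≠ 0 := fun h => hxM ((hs x hx).eq_zero_iff.1 h)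
    have : s x = 1 ∨ s x = -1 := by
      generalize s x = a at h0; revert a; decide
    exact this.imp (fun h => ⟨hx, hxM, h⟩) fun h => ⟨hx, hxM, h⟩
  have hOdisj : Disjoint (O 1) (O (-1)) := by
    rw [Set.disjoint_left]
    rintro x ⟨-, -, h1⟩ ⟨-, -, h2⟩
    rw [h1] at h2; exact absurd h2 (by decide)
  have hNM : ∀ x ∈ unitLevel K, x ∈ M ↔ x ∈ L := fun x hx => by
    change (√(K x))⁻¹ • x ∈ L ↔ x ∈ L
    rw [IsHomogHam.sqrt_inv_smul_eq_self hx]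
  -- connected sets avoiding the cone stay on one side
  have hside : ∀ S : Set R4, IsPreconnected S → (∀ x ∈ S, x ≠ 0 ∧ x ∉ M) →
      ∀ a, (a = 1 ∨ a = -1) → (S ∩ O a).Nonempty → S ⊆ O a := by
    rintro S hS hSM a (rfl | rfl) hne
    · exact hS.subset_left_of_subset_union (hOo 1) (hOo (-1)) hOdisj
        (fun x hx => hcover x (hSM x hx).1 (hSM x hx).2) hne
    · exact hS.subset_left_of_subset_union (hOo (-1)) (hOo 1) hOdisj.symm
        (fun x hx => (hcover x (hSM x hx).1 (hSM x hx).2).symm) hne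
  have hnonempty : ∀ a : SignType, (a = 1 ∨ a = -1) → (unitLevel K ∩ O a).Nonempty := by
    intro a ha
    obtain ⟨z, hz⟩ := hL.1
    have hz0 := hK.ne_zero_of_mem (hLN hz)
    have hzM : z ∈ M := (hNM z (hLN hz)).2 hz
    have hfreq : ∃ᶠ y in 𝓝 z, s y = a := by
      rcases ha with rfl | rfl
      · exact (hs z hz0).frequently_eq_one hzM
      · refine ((hs z hz0).neg.frequently_eq_one hzM).mono fun y hy => ?_
        have hy : -s y = 1 := hy
        rw [← hy, neg_neg]
    obtain ⟨y, hya, hy0, hyS⟩ := (hfreq.and_eventually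
      ((isOpen_compl_singleton.eventually_mem hz0).and (hs z hz0).eventually)).exists
    have hyM : y ∉ M := fun h => by
      rw [← hyS.eq_zero_iff, hya] at h
      rcases ha with rfl | rfl <;> exact absurd h (by decide)
    have hy0 : y ≠ 0 := hy0
    have hray : ∀ r : ℝ, 0 < r → (√(K (r • y)))⁻¹ • r • y = (√(K y))⁻¹ • y := fun r hr => by
      rw [hK.homog r hr, Real.sqrt_mul (by positivity), Real.sqrt_sq hr.le, smul_smul, mul_inv]
      congr 1
      field_simp
    have hsub := hside ((fun r : ℝ => r • y) '' Set.Ioi 0)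
      ((convex_Ioi (0 : ℝ)).isPreconnected.image _ (by fun_prop))
      (by
        rintro _ ⟨r, hr, rfl⟩
        have hr : 0 < r := hr
        refine ⟨smul_ne_zero hr.ne' hy0, fun h => hyM ?_⟩
        have h : (√(K (r • y)))⁻¹ • r • y ∈ L := h
        rwa [hray r hr] at h) a ha
      ⟨y, ⟨1, by simp, by simp⟩, hy0, hyM, hya⟩
    exact ⟨(√(K y))⁻¹ • y, hK.smul_mem hy0, hsub ⟨_, by
      have := Real.sqrt_pos.2 (hK.pos y hy0); simpa using this, rfl⟩⟩
  have hinv : ∀ a : SignType, (a = 1 ∨ a = -1) →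
      IsReebInvariant (unitLevel K) (unitLevel K ∩ O a) := by
    refine fun a ha => ⟨Set.inter_subset_left, fun c hc h0 t => ⟨(hc t).1, ?_⟩⟩
    have hcc : Continuous c := continuous_iff_continuousAt.2 fun t =>
      (hc t).2.choose_spec.1.continuousAt
    refine hside (Set.range c) (isPreconnected_range hcc) ?_ a ha ⟨c 0, ⟨0, rfl⟩, h0.2⟩ ⟨t, rfl⟩
    rintro _ ⟨r, rfl⟩
    refine ⟨hK.ne_zero_of_mem (hc r).1, fun h => h0.2.2.1 ?_⟩
    rw [hNM _ (hc 0).1]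
    exact reebTrajectory_mem_lagrangian hK hL hLN hc ((hNM _ (hc r).1).1 h) 0
  refine ⟨unitLevel K ∩ O 1, unitLevel K ∩ O (-1), hnonempty 1 (Or.inl rfl),
    hnonempty (-1) (Or.inr rfl), hOdisj.mono Set.inter_subset_right Set.inter_subset_right, ?_,
    ⟨_, hOo 1, rfl⟩, ⟨_, hOo (-1), rfl⟩, hinv 1 (Or.inl rfl), hinv (-1) (Or.inr rfl)⟩
  rw [← Set.inter_union_distrib_left]
  ext x
  constructor
  · rintro ⟨hx, h⟩
    refine ⟨hx, fun hxL => ?_⟩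
    rcases h with h | h <;> exact h.2.1 ((hNM x hx).2 hxL)
  · rintro ⟨hx, hxL⟩
    exact ⟨hx, hcover x (hK.ne_zero_of_mem hx) fun h => hxL ((hNM x hx).1 h)⟩

/-! ### Nonempty relatively open sets have positive contact volume -/

theorem det_fin_four (M : Matrix (Fin 4) (Fin 4) ℝ) : M.det =
    M 0 0 * (M 1 1 * (M 2 2 * M 3 3 - M 2 3 * M 3 2) - M 1 2 * (M 2 1 * M 3 3 - M 2 3 * M 3 1)
        + M 1 3 * (M 2 1 * M 3 2 - M 2 2 * M 3 1))
      - M 0 1 * (M 1 0 * (M 2 2 * M 3 3 - M 2 3 * M 3 2) - M 1 2 * (M 2 0 * M 3 3 - M 2 3 * M 3 0)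
        + M 1 3 * (M 2 0 * M 3 2 - M 2 2 * M 3 0))
      + M 0 2 * (M 1 0 * (M 2 1 * M 3 3 - M 2 3 * M 3 1) - M 1 1 * (M 2 0 * M 3 3 - M 2 3 * M 3 0)
        + M 1 3 * (M 2 0 * M 3 1 - M 2 1 * M 3 0))
      - M 0 3 * (M 1 0 * (M 2 1 * M 3 2 - M 2 2 * M 3 1) - M 1 1 * (M 2 0 * M 3 2 - M 2 2 * M 3 0)
        + M 1 2 * (M 2 0 * M 3 1 - M 2 1 * M 3 0)) := by
  rw [Matrix.det_succ_row_zero, Fin.sum_univ_four]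
  simp only [Matrix.det_fin_three, Matrix.submatrix_apply]
  have h : ∀ (i : Fin 3) , Fin.succAbove (0 : Fin 4) i = i.succ := fun i => rfl
  have a0 : Fin.succAbove (1 : Fin 4) (0 : Fin 3) = 0 := rfl
  have a1 : Fin.succAbove (1 : Fin 4) (1 : Fin 3) = 2 := rfl
  have a2 : Fin.succAbove (1 : Fin 4) (2 : Fin 3) = 3 := rfl
  have b0 : Fin.succAbove (2 : Fin 4) (0 : Fin 3) = 0 := rfl
  have b1 : Fin.succAbove (2 : Fin 4) (1 : Fin 3) = 1 := rfl
  have b2 : Fin.succAbove (2 : Fin 4) (2 : Fin 3) = 3 := rfl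
  have c0 : Fin.succAbove (3 : Fin 4) (0 : Fin 3) = 0 := rfl
  have c1 : Fin.succAbove (3 : Fin 4) (1 : Fin 3) = 1 := rfl
  have c2 : Fin.succAbove (3 : Fin 4) (2 : Fin 3) = 2 := rfl
  have d0 : Fin.succ (0 : Fin 3) = 1 := rfl
  have d1 : Fin.succ (1 : Fin 3) = 2 := rfl
  have d2 : Fin.succ (2 : Fin 3) = 3 := rfl
  simp only [h, a0, a1, a2, b0, b1, b2, c0, c1, c2, d0, d1, d2]
  norm_num [pow_succ]
  ring
/-- The contact volume form is half of the determinant, as `ω ∧ ω / 2` is the Euclidean volume. -/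
theorem two_mul_contactVolumeForm (x u v w : R4) :
    2 * contactVolumeForm x u v w = Matrix.det (Matrix.of ![x.ofLp, u.ofLp, v.ofLp, w.ofLp]) := by
  rw [det_fin_four]
  simp [contactVolumeForm, liouvilleForm, symplecticForm]
  ring

theorem sq_two_mul_contactVolumeForm (x : R4) {e : Fin 3 → R4} (he : Orthonormal ℝ e) :
    (2 * contactVolumeForm x (e 0) (e 1) (e 2)) ^ 2 = ‖x - ∑ i, inner ℝ (e i) x • e i‖ ^ 2 := by
  have hin : ∀ a b : R4,
      inner ℝ a b = a 0 * b 0 + a 1 * b 1 + a 2 * b 2 + a 3 * b 3 := fun a b => by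
    rw [PiLp.inner_apply, Fin.sum_univ_four]; simp [mul_comm]
  have h : ∀ i j, inner ℝ (e i) (e j) = if i = j then (1 : ℝ) else 0 := orthonormal_iff_ite.1 he
  have hR : ‖x - ∑ i, inner ℝ (e i) x • e i‖ ^ 2 =
      inner ℝ x x - inner ℝ (e 0) x ^ 2 - inner ℝ (e 1) x ^ 2 - inner ℝ (e 2) x ^ 2 := by
    rw [← real_inner_self_eq_norm_sq, Fin.sum_univ_three]
    simp only [inner_sub_left, inner_sub_right, inner_add_left, inner_add_right, inner_smul_left,
      inner_smul_right, real_inner_comm (e 0) x, real_inner_comm (e 1) x, real_inner_comm (e 2) x]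
    simp [h, he.1]
    ring
  have hM : (Matrix.of ![x.ofLp, (e 0).ofLp, (e 1).ofLp, (e 2).ofLp]) *
      (Matrix.of ![x.ofLp, (e 0).ofLp, (e 1).ofLp, (e 2).ofLp]).transpose =
      Matrix.of ![![inner ℝ x x, inner ℝ (e 0) x, inner ℝ (e 1) x, inner ℝ (e 2) x],
        ![inner ℝ (e 0) x, 1, 0, 0], ![inner ℝ (e 1) x, 0, 1, 0], ![inner ℝ (e 2) x, 0, 0, 1]] := by
    have h00 := (h 0 0).trans (if_pos rfl)
    have h01 := (h 0 1).trans (if_neg (by decide))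
    have h02 := (h 0 2).trans (if_neg (by decide))
    have h11 := (h 1 1).trans (if_pos rfl)
    have h12 := (h 1 2).trans (if_neg (by decide))
    have h22 := (h 2 2).trans (if_pos rfl)
    rw [hin] at h00 h01 h02 h11 h12 h22
    have hxx := hin x x
    rw [real_inner_self_eq_norm_sq] at hxx
    ext i j
    fin_cases i <;> fin_cases j <;>
      simp [Matrix.mul_apply, Fin.sum_univ_four, hin] <;> linarith
  rw [hR, two_mul_contactVolumeForm, sq]
  nth_rewrite 2 [← Matrix.det_transpose]
  rw [← Matrix.det_mul, hM]
  rw [det_fin_four]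
  simp
  ring

theorem IsHomogHam.surjective_fderiv {K : R4 → ℝ} (hK : IsHomogHam K) {x : R4} (hx : x ≠ 0) :
    Function.Surjective (fderiv ℝ K x) := by
  have h := hK.fderiv_self hx
  have hp := hK.pos x hx
  refine fun r => ⟨(r / (2 * K x)) • x, ?_⟩
  rw [map_smul, h, smul_eq_mul, div_mul_cancel₀ _ (by positivity)]

theorem IsHomogHam.finrank_ker {K : R4 → ℝ} (hK : IsHomogHam K) {x : R4} (hx : x ≠ 0) :
    Module.finrank ℝ (fderiv ℝ K x).ker = 3 := by
  have h := LinearMap.finrank_range_add_finrank_ker (fderiv ℝ K x : R4 →ₗ[ℝ] ℝ)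
  rw [LinearMap.range_eq_top.2 (hK.surjective_fderiv hx), finrank_top] at h
  simp at h
  omega

/-- The contact volume density at `x` is at least `1 / ‖dK‖`. -/
theorem IsHomogHam.le_contactVolumeDensity {K : R4 → ℝ} (hK : IsHomogHam K) {x : R4}
    (hx : x ∈ unitLevel K) {C : ℝ} (hC : 0 < C) (hKC : ‖fderiv ℝ K x‖ ≤ C) :
    ENNReal.ofReal C⁻¹ ≤ contactVolumeDensity (unitLevel K) x := by
  have hx0 := hK.ne_zero_of_mem hx
  have hx1 : K x = 1 := hx
  let b := (stdOrthonormalBasis ℝ (fderiv ℝ K x).ker).reindex (finCongr (hK.finrank_ker hx0))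
  let e : Fin 3 → R4 := fun i => b i
  have he : Orthonormal ℝ e := b.orthonormal.comp_linearIsometry (fderiv ℝ K x).ker.subtypeₗᵢ
  have hker : ∀ i, fderiv ℝ K x (e i) = 0 := fun i => (b i).2
  have het : ∀ i, e i ∈ tangentVectors (unitLevel K) x := fun i => by
    rw [hK.tangentVectors_eq hx]; exact hker i
  refine le_trans ?_ (le_iSup (fun e : {e : Fin 3 → R4 //
    Orthonormal ℝ e ∧ ∀ i, e i ∈ tangentVectors (unitLevel K) x} =>
      ENNReal.ofReal |contactVolumeForm x (e.1 0) (e.1 1) (e.1 2)|) ⟨e, he, het⟩)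
  refine ENNReal.ofReal_le_ofReal ?_
  have hsq := sq_two_mul_contactVolumeForm x he
  have habs : 2 * |contactVolumeForm x (e 0) (e 1) (e 2)| = ‖x - ∑ i, inner ℝ (e i) x • e i‖ := by
    rw [← abs_norm (x - _), ← (sq_eq_sq_iff_abs_eq_abs _ _).1 hsq, abs_mul, abs_two]
  have h2 : (2 : ℝ) ≤ C * ‖x - ∑ i, inner ℝ (e i) x • e i‖ := by
    have h3 : fderiv ℝ K x (x - ∑ i, inner ℝ (e i) x • e i) = 2 := by
      rw [map_sub, map_sum, hK.fderiv_self hx0, hx1]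
      simp [hker]
    calc (2 : ℝ) = ‖fderiv ℝ K x (x - ∑ i, inner ℝ (e i) x • e i)‖ := by rw [h3]; norm_num
      _ ≤ ‖fderiv ℝ K x‖ * ‖x - ∑ i, inner ℝ (e i) x • e i‖ := ContinuousLinearMap.le_opNorm _ _
      _ ≤ _ := mul_le_mul_of_nonneg_right hKC (norm_nonneg _)
  rw [← habs] at h2
  change C⁻¹ ≤ |contactVolumeForm x (e 0) (e 1) (e 2)|
  rw [inv_le_iff_one_le_mul₀ hC]
  linarith

theorem IsHomogHam.euclideanHausdorffMeasure_pos {K : R4 → ℝ} (hK : IsHomogHam K) {O : Set R4}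
    (hO : IsOpen O) (hne : (unitLevel K ∩ O).Nonempty) :
    0 < (μHE[3] : Measure R4) (unitLevel K ∩ O) := by
  obtain ⟨x, hx, hxO⟩ := hne
  have hx0 := hK.ne_zero_of_mem hx
  have hx1 : K x = 1 := hx
  obtain ⟨p, e, hxe, he, -, -⟩ := exists_straightening isOpen_compl_singleton hK.smooth
    (show x ∈ ({0}ᶜ : Set R4) from hx0) (hK.surjective_fderiv hx0)
  have hsymm : Filter.Tendsto e.symm (𝓝 (e x)) (𝓝 x) := by
    have := e.continuousAt_symm (e.map_source hxe)
    rwa [ContinuousAt, e.left_inv hxe] at this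
  -- the linear projection `p` maps the set onto a neighbourhood of `p x` in a 3-dimensional space
  have himg : p '' (unitLevel K ∩ O) ∈ 𝓝 (p x) := by
    have hl : Filter.Tendsto (fun k => ((1 : ℝ), k)) (𝓝 (p x)) (𝓝 (e x)) := by
      rw [he, hx1]; exact tendsto_const_nhds.prodMk_nhds Filter.tendsto_id
    filter_upwards [hl.eventually (e.open_target.eventually_mem (e.map_source hxe)),
      (hsymm.comp hl).eventually (hO.eventually_mem hxO)] with k hk hkO
    have h1 := e.right_inv hk
    rw [he] at h1
    exact ⟨e.symm (1, k), ⟨congrArg Prod.fst h1, hkO⟩, congrArg Prod.snd h1⟩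
  have hHaar : (μH[(Module.finrank ℝ (fderiv ℝ K x).ker : ℕ)] :
      Measure (fderiv ℝ K x).ker).IsAddHaarMeasure := inferInstance
  have hpos : 0 < (μH[(3 : ℝ)] : Measure (fderiv ℝ K x).ker) (p '' (unitLevel K ∩ O)) := by
    rw [hK.finrank_ker hx0] at hHaar
    have : ((3 : ℕ) : ℝ) = 3 := by norm_num
    rw [this] at hHaar
    exact Measure.measure_pos_of_mem_nhds _ himg
  have hle := p.lipschitz.hausdorffMeasure_image_le (d := 3) (by norm_num) (unitLevel K ∩ O)
  have hH : (μH[(3 : ℝ)] : Measure R4) (unitLevel K ∩ O) ≠ 0 := by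
    intro h0
    rw [h0, mul_zero] at hle
    exact absurd hpos (not_lt.2 hle)
  rw [Measure.euclideanHausdorffMeasure_def, Measure.smul_apply]
  rw [ENNReal.smul_def, smul_eq_mul]
  refine ENNReal.mul_pos ?_ (by simpa using hH)
  simpa using Measure.addHaarScalarFactor_volume_hausdorffMeasure_ne_zero 3

/-- A nonempty relatively open subset of a starshaped hypersurface has positive contact volume. -/
theorem IsHomogHam.contactVolumeMeasure_pos {K : R4 → ℝ} (hK : IsHomogHam K) {O : Set R4}
    (hO : IsOpen O) (hne : (unitLevel K ∩ O).Nonempty) :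
    0 < contactVolumeMeasure (unitLevel K) (unitLevel K ∩ O) := by
  have hmeas : MeasurableSet (unitLevel K ∩ O) :=
    hK.isCompact_unitLevel.isClosed.measurableSet.inter hO.measurableSet
  obtain ⟨C, hC⟩ : ∃ C, ∀ x ∈ unitLevel K, ‖fderiv ℝ K x‖ ≤ C :=
    hK.isCompact_unitLevel.exists_bound_of_continuousOn fun x hx =>
      ((hK.contDiffAt (hK.ne_zero_of_mem hx)).continuousAt_fderiv
        (by simp)).continuousWithinAt
  have hC' : ∀ x ∈ unitLevel K, ‖fderiv ℝ K x‖ ≤ max C 1 := fun x hx =>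
    (hC x hx).trans (le_max_left _ _)
  have hC0 : 0 < max C 1 := lt_of_lt_of_le one_pos (le_max_right _ _)
  rw [contactVolumeMeasure, withDensity_apply _ hmeas]
  calc (0 : ℝ≥0∞) < ENNReal.ofReal (max C 1)⁻¹ * (μHE[3] : Measure R4) (unitLevel K ∩ O) :=
        ENNReal.mul_pos (by simp [hC0]) (hK.euclideanHausdorffMeasure_pos hO hne).ne'
    _ = ∫⁻ _ in unitLevel K ∩ O, ENNReal.ofReal (max C 1)⁻¹
          ∂((μHE[3] : Measure R4).restrict (unitLevel K)) := by
        rw [setLIntegral_const, Measure.restrict_apply hmeas,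
          Set.inter_eq_self_of_subset_left Set.inter_subset_left]
    _ ≤ _ := setLIntegral_mono' hmeas fun x hx =>
        hK.le_contactVolumeDensity hx.1 hC0 (hC' x hx.1)

/-! ### Global Hamiltonian trajectories -/

/-- A bounded Lipschitz vector field has global integral curves. -/
theorem exists_global_integralCurve {E : Type*} [NormedAddCommGroup E] [NormedSpace ℝ E]
    [CompleteSpace E] {X : E → E} {Λ M : NNReal} (hL : LipschitzWith Λ X) (hM : ∀ x, ‖X x‖ ≤ M)
    (x₀ : E) : ∃ c : ℝ → E, c 0 = x₀ ∧ ∀ t, HasDerivAt c (X (c t)) t := by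
  have hloc : ∀ n : ℕ, ∃ α : ℝ → E, α 0 = x₀ ∧
      ∀ t ∈ Set.Ioo (-((n : ℝ) + 1)) (n + 1), HasDerivAt α (X (α t)) t := by
    intro n
    have h0 : (0 : ℝ) ∈ Set.Icc (-((n : ℝ) + 1)) (n + 1) :=
      ⟨by linarith [n.cast_nonneg (α := ℝ)], by positivity⟩
    have hPL : IsPicardLindelof (fun _ => X) (⟨0, h0⟩ : Set.Icc (-((n : ℝ) + 1)) (n + 1)) x₀
        (M * (n + 1)) 0 M Λ :=
      { lipschitzOnWith := fun _ _ => hL.lipschitzOnWith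
        continuousOn := fun _ _ => continuousOn_const
        norm_le := fun _ _ x _ => hM x
        mul_max_le := by simp }
    obtain ⟨α, hα0, hα⟩ := hPL.exists_eq_forall_mem_Icc_hasDerivWithinAt₀
    exact ⟨α, hα0, fun t ht => (hα t (Set.Ioo_subset_Icc_self ht)).hasDerivAt
      (Icc_mem_nhds ht.1 ht.2)⟩
  choose α hα0 hα using hloc
  have hagree : ∀ m n : ℕ, m ≤ n → Set.EqOn (α m) (α n) (Set.Ioo (-((m : ℝ) + 1)) (m + 1)) := by
    intro m n hmn
    have hsub : Set.Ioo (-((m : ℝ) + 1)) (m + 1) ⊆ Set.Ioo (-((n : ℝ) + 1)) (n + 1) := by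
      have : (m : ℝ) ≤ n := by exact_mod_cast hmn
      exact Set.Ioo_subset_Ioo (by linarith) (by linarith)
    exact ODE_solution_unique_of_mem_Ioo (v := fun _ => X) (s := fun _ => Set.univ) (t₀ := 0)
      (fun t _ => hL.lipschitzOnWith) ⟨by linarith [m.cast_nonneg (α := ℝ)], by positivity⟩
      (fun t ht => ⟨hα m t ht, trivial⟩) (fun t ht => ⟨hα n t (hsub ht), trivial⟩)
      ((hα0 m).trans (hα0 n).symm)
  let N : ℝ → ℕ := fun t => ⌈|t|⌉₊
  have hN : ∀ t (n : ℕ), N t ≤ n → t ∈ Set.Ioo (-((n : ℝ) + 1)) (n + 1) := fun t n hn => by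
    have h1 : |t| ≤ n := (Nat.le_ceil _).trans (by exact_mod_cast hn)
    have h2 := abs_le.1 h1
    exact ⟨by linarith, by linarith⟩
  have hc : ∀ t (n : ℕ), N t ≤ n → α (N t) t = α n t := fun t n hn =>
    hagree (N t) n hn (hN t _ le_rfl)
  refine ⟨fun t => α (N t) t, hα0 _, fun t => ?_⟩
  -- near `t` the glued curve coincides with a single local solution
  let n := N t + 1
  have hder : HasDerivAt (α n) (X (α n t)) t := hα n t (hN t n (Nat.le_succ _))
  dsimp only
  rw [hc t n (Nat.le_succ _)]
  refine hder.congr_of_eventuallyEq ?_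
  filter_upwards [Ioo_mem_nhds (sub_one_lt t) (lt_add_one t)] with s hs
  refine hc s n ?_
  have h1 : |s| ≤ |t| + 1 := by
    have h3 : |s - t| ≤ 1 := abs_le.2 ⟨by linarith [hs.1], by linarith [hs.2]⟩
    have h4 := abs_add_le (s - t) t
    rw [sub_add_cancel] at h4
    linarith
  refine Nat.ceil_le.2 ?_
  push_cast [n]
  linarith [Nat.le_ceil |t|]

theorem IsHomogHam.fderiv_smul {K : R4 → ℝ} (hK : IsHomogHam K) {r : ℝ} (hr : 0 < r) {x : R4}
    (hx : x ≠ 0) : fderiv ℝ K (r • x) = r • fderiv ℝ K x := by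
  have h1 : HasFDerivAt (fun y : R4 => K (r • y)) (r • fderiv ℝ K (r • x)) x := by
    have h := (hK.hasFDerivAt (smul_ne_zero hr.ne' hx)).comp x
      ((hasFDerivAt_id (𝕜 := ℝ) x).const_smul r)
    refine h.congr_fderiv ?_
    ext v; simp
  have h2 : HasFDerivAt (fun y : R4 => K (r • y)) (r ^ 2 • fderiv ℝ K x) x := by
    refine ((hK.hasFDerivAt hx).const_mul (r ^ 2)).congr_of_eventuallyEq ?_
    exact Filter.Eventually.of_forall fun y => hK.homog r hr y
  have h3 := h1.unique h2
  have h4 : r • (fderiv ℝ K (r • x)) = r • (r • fderiv ℝ K x) := by rw [h3, smul_smul, sq]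
  exact smul_right_injective _ hr.ne' h4

theorem IsHomogHam.hamVec_smul {K : R4 → ℝ} (hK : IsHomogHam K) {r : ℝ} (hr : 0 < r) {x : R4}
    (hx : x ≠ 0) : hamVec K (r • x) = r • hamVec K x := by
  rw [hamVec, hK.fderiv_smul hr hx, map_smul, hamVec]

/-- `c` is a global trajectory in `ℝ⁴ ∖ {0}` of the Hamiltonian vector field of `K`. -/
def IsHamTrajectory (K : R4 → ℝ) (c : ℝ → R4) : Prop :=
  ∀ t, c t ≠ 0 ∧ HasDerivAt c (hamVec K (c t)) t

theorem IsHamTrajectory.smul {K : R4 → ℝ} (hK : IsHomogHam K) {c : ℝ → R4}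
    (hc : IsHamTrajectory K c) {r : ℝ} (hr : 0 < r) : IsHamTrajectory K fun t => r • c t :=
  fun t => ⟨smul_ne_zero hr.ne' (hc t).1, by
    rw [hK.hamVec_smul hr (hc t).1]; exact (hc t).2.const_smul r⟩

theorem IsHamTrajectory.energy {K : R4 → ℝ} (hK : IsHomogHam K) {c : ℝ → R4}
    (hc : IsHamTrajectory K c) (s t : ℝ) : K (c s) = K (c t) := by
  have h : ∀ t, HasDerivAt (fun t => K (c t)) 0 t := fun t => by
    have := HasFDerivAt.comp_hasDerivAt t (hK.hasFDerivAt (hc t).1) (hc t).2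
    rwa [fderiv_hamVec_self] at this
  exact is_const_of_deriv_eq_zero (fun t => (h t).differentiableAt) (fun t => (h t).deriv) s t

/-- Uniform bounds on a Hamiltonian that confine trajectories starting on the unit sphere to the
annulus `1/2 ≤ ‖x‖ ≤ 2`. -/
def IsPinched (K : R4 → ℝ) : Prop := ∀ x, ‖x‖ ^ 2 / 4 ≤ K x ∧ K x ≤ ‖x‖ ^ 2

theorem IsPinched.norm_mem {K : R4 → ℝ} (hK : IsPinched K) {x y : R4} (hx : ‖x‖ = 1)
    (hxy : K y = K x) : 1 / 2 ≤ ‖y‖ ∧ ‖y‖ ≤ 2 := by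
  have h1 := hK x
  have h2 := hK y
  rw [hx] at h1
  constructor <;> nlinarith [norm_nonneg y]

/-- A smooth cutoff function that is `1` for `1/4 ≤ ‖x‖ ≤ 4`, and vanishes near the origin and
outside of a large ball. -/
noncomputable def annulusCutoff (x : R4) : ℝ :=
  Real.smoothTransition (64 * ‖x‖ ^ 2 - 1) * Real.smoothTransition (17 - ‖x‖ ^ 2)

theorem contDiff_annulusCutoff : ContDiff ℝ ∞ annulusCutoff := by
  have h : ContDiff ℝ ∞ (fun x : R4 => ‖x‖ ^ 2) := contDiff_norm_sq ℝ
  exact (Real.smoothTransition.contDiff.comp ((contDiff_const.mul h).sub contDiff_const)).mul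
    (Real.smoothTransition.contDiff.comp (contDiff_const.sub h))

theorem annulusCutoff_eq_one {x : R4} (h1 : 1 / 4 ≤ ‖x‖) (h2 : ‖x‖ ≤ 4) : annulusCutoff x = 1 := by
  rw [annulusCutoff, Real.smoothTransition.one_of_one_le (by nlinarith),
    Real.smoothTransition.one_of_one_le (by nlinarith), one_mul]

theorem annulusCutoff_eq_zero {x : R4} (h : ‖x‖ ≤ 1 / 8) : annulusCutoff x = 0 := by
  rw [annulusCutoff, Real.smoothTransition.zero_of_nonpos (by nlinarith [norm_nonneg x]), zero_mul]

theorem annulusCutoff_eventually_zero : annulusCutoff =ᶠ[𝓝 (0 : R4)] 0 := by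
  filter_upwards [ball_mem_nhds (0 : R4) (show (0 : ℝ) < 1 / 8 by norm_num)] with x hx
  exact annulusCutoff_eq_zero (by rw [mem_ball_zero_iff] at hx; exact hx.le)

theorem hasCompactSupport_annulusCutoff : HasCompactSupport annulusCutoff :=
  HasCompactSupport.intro (isCompact_closedBall (0 : R4) 5) fun x hx => by
    rw [mem_closedBall_zero_iff, not_le] at hx
    rw [annulusCutoff, Real.smoothTransition.zero_of_nonpos (x := 17 - ‖x‖ ^ 2) (by nlinarith),
      mul_zero]

/-- A function smooth away from the origin, multiplied by the cutoff. -/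
noncomputable def cutOff (K : R4 → ℝ) (x : R4) : ℝ := annulusCutoff x * K x

theorem contDiff_cutOff {K : R4 → ℝ} (hK : ContDiffOn ℝ ∞ K {0}ᶜ) : ContDiff ℝ ∞ (cutOff K) := by
  refine contDiff_iff_contDiffAt.2 fun x => ?_
  by_cases hx : x = 0
  · subst hx
    refine (contDiffAt_const (c := (0 : ℝ))).congr_of_eventuallyEq ?_
    filter_upwards [annulusCutoff_eventually_zero] with x hx
    rw [cutOff, hx]; simp
  · exact contDiff_annulusCutoff.contDiffAt.mul
      (hK.contDiffAt (isOpen_compl_singleton.mem_nhds hx))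

theorem hasCompactSupport_cutOff (K : R4 → ℝ) : HasCompactSupport (cutOff K) :=
  hasCompactSupport_annulusCutoff.mul_right

theorem cutOff_eventuallyEq (K : R4 → ℝ) {x : R4} (h1 : 1 / 4 < ‖x‖) (h2 : ‖x‖ < 4) :
    cutOff K =ᶠ[𝓝 x] K := by
  filter_upwards [continuous_norm.continuousAt.eventually (lt_mem_nhds h1),
    continuous_norm.continuousAt.eventually (gt_mem_nhds h2)] with y hy1 hy2
  rw [cutOff, annulusCutoff_eq_one hy1.le hy2.le, one_mul]

theorem hamVec_cutOff (K : R4 → ℝ) {x : R4} (h1 : 1 / 4 < ‖x‖) (h2 : ‖x‖ < 4) :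
    hamVec (cutOff K) x = hamVec K x := by
  rw [hamVec, (cutOff_eventuallyEq K h1 h2).fderiv_eq, hamVec]

theorem exists_lipschitzWith_hamVec_cutOff {K : R4 → ℝ} (hK : ContDiffOn ℝ ∞ K {0}ᶜ) :
    (∃ Λ, LipschitzWith Λ (hamVec (cutOff K))) ∧
      ∃ M : NNReal, ∀ x, ‖hamVec (cutOff K) x‖ ≤ M := by
  have hs : HasCompactSupport (hamVec (cutOff K)) :=
    ((hasCompactSupport_cutOff K).fderiv ℝ).comp_left (g := symplGrad) (map_zero _)
  have hd : ContDiff ℝ ∞ (hamVec (cutOff K)) :=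
    symplGrad.contDiff.comp ((contDiff_cutOff hK).fderiv_right (m := ∞) (by simp))
  refine ⟨hd.lipschitzWith_of_hasCompactSupport hs (by simp), ?_⟩
  obtain ⟨C, hC⟩ := hs.exists_bound_of_continuous hd.continuous
  exact ⟨C.toNNReal, fun x => (hC x).trans (Real.le_coe_toNNReal C)⟩

/-- The Hamiltonian flow is complete: trajectories are trapped in an energy level. -/
theorem IsHomogHam.exists_trajectory {K : R4 → ℝ} (hK : IsHomogHam K) (hp : IsPinched K) {x₀ : R4}
    (hx₀ : ‖x₀‖ = 1) : ∃ c, IsHamTrajectory K c ∧ c 0 = x₀ := by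
  obtain ⟨⟨Λ, hΛ⟩, M, hM⟩ := exists_lipschitzWith_hamVec_cutOff hK.smooth
  obtain ⟨c, hc0, hc⟩ := exists_global_integralCurve hΛ hM x₀
  have hcc : Continuous c := continuous_iff_continuousAt.2 fun t => (hc t).continuousAt
  have hE : ∀ t, cutOff K (c t) = K x₀ := by
    have h : ∀ t, HasDerivAt (fun t => cutOff K (c t)) 0 t := fun t => by
      have := HasFDerivAt.comp_hasDerivAt t
        ((contDiff_cutOff hK.smooth).differentiable (by simp) (c t)).hasFDerivAt (hc t)
      rwa [fderiv_hamVec_self] at this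
    intro t
    rw [is_const_of_deriv_eq_zero (fun t => (h t).differentiableAt) (fun t => (h t).deriv) t 0, hc0,
      cutOff, annulusCutoff_eq_one (by rw [hx₀]; norm_num) (by rw [hx₀]; norm_num), one_mul]
  -- where the trajectory is in the larger annulus, its energy confines it to the smaller one
  let S : Set ℝ := {t | 1 / 4 < ‖c t‖ ∧ ‖c t‖ < 4}
  have hnc : Continuous fun t => ‖c t‖ := hcc.norm
  have hSo : IsOpen S := (isOpen_lt continuous_const hnc).inter (isOpen_lt hnc continuous_const)
  have hSeq : S = {t | 1 / 2 ≤ ‖c t‖ ∧ ‖c t‖ ≤ 2} := by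
    ext t
    constructor
    · rintro ⟨h1, h2⟩
      refine hp.norm_mem hx₀ ?_
      rw [← hE t, (cutOff_eventuallyEq K h1 h2).eq_of_nhds]
    · rintro ⟨h1, h2⟩
      exact ⟨by linarith, by linarith⟩
  have hSc : IsClosed S := by
    rw [hSeq]
    exact (isClosed_le continuous_const hnc).inter (isClosed_le hnc continuous_const)
  have hSu : S = Set.univ := IsClopen.eq_univ ⟨hSc, hSo⟩
    ⟨0, by rw [hc0, hx₀]; norm_num, by rw [hc0, hx₀]; norm_num⟩
  refine ⟨c, fun t => ?_, hc0⟩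
  obtain ⟨h1, h2⟩ : t ∈ S := by rw [hSu]; trivial
  refine ⟨fun h => ?_, ?_⟩
  · rw [h, norm_zero] at h1; norm_num at h1
  · rw [← hamVec_cutOff K h1 h2]; exact hc t

/-! ### Connecting orbits -/

/-- A subset of `ℝ⁴` invariant under positive dilations. -/
def IsCone (C : Set R4) : Prop := ∀ x ∈ C, ∀ r : ℝ, 0 < r → r • x ∈ C

/-- Some trajectory of `K` starting in `C` reaches `C'`. -/
def Connects (K : R4 → ℝ) (C C' : Set R4) : Prop :=
  ∃ c, IsHamTrajectory K c ∧ c 0 ∈ C ∧ ∃ T, 0 ≤ T ∧ c T ∈ C'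

/-- Having a connecting orbit between two open cones is stable under `C¹`-small perturbations. -/
theorem Connects.stable {K : R4 → ℝ} (hK : IsHomogHam K) (hp : IsPinched K) {C C' : Set R4}
    (hC : IsCone C) (hC' : IsCone C') (hC'o : IsOpen C') (h : Connects K C C') :
    ∃ ρ > 0, ∀ K', IsHomogHam K' → IsPinched K' →
      (∀ x : R4, 1 / 4 < ‖x‖ → ‖x‖ < 4 → ‖fderiv ℝ K' x - fderiv ℝ K x‖ ≤ ρ) →
      Connects K' C C' := by
  obtain ⟨c₁, hc₁, hc₁0, T, hT, hc₁T⟩ := h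
  have hn : 0 < ‖c₁ 0‖⁻¹ := inv_pos.2 (norm_pos_iff.2 (hc₁ 0).1)
  let c : ℝ → R4 := fun t => ‖c₁ 0‖⁻¹ • c₁ t
  have hc : IsHamTrajectory K c := hc₁.smul hK hn
  have hc0 : c 0 ∈ C := hC _ hc₁0 _ hn
  have hcT : c T ∈ C' := hC' _ hc₁T _ hn
  have hnorm : ‖c 0‖ = 1 := by
    simp only [c, norm_smul, norm_inv, norm_norm]
    exact inv_mul_cancel₀ (norm_ne_zero_iff.2 (hc₁ 0).1)
  obtain ⟨⟨Λ, hΛ⟩, -⟩ := exists_lipschitzWith_hamVec_cutOff hK.smooth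
  obtain ⟨ε, hε, hball⟩ := Metric.isOpen_iff.1 hC'o _ hcT
  obtain ⟨ρ, hρ, hgr⟩ : ∃ ρ > 0, gronwallBound 0 Λ (0 + ‖symplGrad‖ * ρ) (T - 0) < ε := by
    have hcont : Continuous fun ρ : ℝ => gronwallBound 0 Λ (0 + ‖symplGrad‖ * ρ) (T - 0) :=
      (gronwallBound_continuous_ε 0 Λ (T - 0)).comp (by fun_prop)
    have h0 : gronwallBound 0 Λ (0 + ‖symplGrad‖ * 0) (T - 0) < ε := by
      simpa [gronwallBound_ε0_δ0] using hε
    have hev := hcont.continuousAt.eventually (gt_mem_nhds h0)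
    obtain ⟨δ, hδ, hb⟩ := Metric.eventually_nhds_iff_ball.1 hev
    refine ⟨δ / 2, by positivity, hb _ ?_⟩
    rw [mem_ball, dist_zero_right, Real.norm_of_nonneg (by positivity)]
    linarith
  refine ⟨ρ, hρ, fun K' hK' hp' hclose => ?_⟩
  obtain ⟨c', hc', hc'0⟩ := hK'.exists_trajectory hp' hnorm
  refine ⟨c', hc', hc'0 ▸ hc0, T, hT, hball ?_⟩
  have hb : ∀ t, 1 / 4 < ‖c t‖ ∧ ‖c t‖ < 4 := fun t => by
    have := hp.norm_mem hnorm (hc.energy hK t 0)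
    exact ⟨by linarith [this.1], by linarith [this.2]⟩
  have hb' : ∀ t, 1 / 4 < ‖c' t‖ ∧ ‖c' t‖ < 4 := fun t => by
    have := hp'.norm_mem (x := c' 0) (by rw [hc'0]; exact hnorm) (hc'.energy hK' t 0)
    exact ⟨by linarith [this.1], by linarith [this.2]⟩
  have hcc : Continuous c := continuous_iff_continuousAt.2 fun t => (hc t).2.continuousAt
  have hcc' : Continuous c' := continuous_iff_continuousAt.2 fun t => (hc' t).2.continuousAt
  have hG := dist_le_of_approx_trajectories_ODE (v := fun _ => hamVec (cutOff K)) (K := Λ)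
    (f := c) (g := c') (f' := fun t => hamVec K (c t)) (g' := fun t => hamVec K' (c' t))
    (a := 0) (b := T) (εf := 0) (εg := ‖symplGrad‖ * ρ) (δ := 0)
    (fun _ => hΛ) hcc.continuousOn (fun t _ => (hc t).2.hasDerivWithinAt)
    (fun t _ => by rw [hamVec_cutOff K (hb t).1 (hb t).2, dist_self]) hcc'.continuousOn
    (fun t _ => (hc' t).2.hasDerivWithinAt)
    (fun t _ => by
      rw [hamVec_cutOff K (hb' t).1 (hb' t).2, dist_eq_norm, hamVec, hamVec, ← map_sub]
      exact (symplGrad.le_opNorm _).trans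
        (mul_le_mul_of_nonneg_left (hclose _ (hb' t).1 (hb' t).2) (norm_nonneg _)))
    (by rw [hc'0, dist_self]) T ⟨hT, le_rfl⟩
  rw [mem_ball, dist_comm]
  exact lt_of_le_of_lt hG hgr

/-! ### Complex coordinates -/

/-- The coordinate `z₁ = x₁ + i y₁`. -/
noncomputable def zOne : R4 →L[ℝ] ℂ := LinearMap.toContinuousLinearMap
  { toFun := fun x => ⟨x 0, x 1⟩
    map_add' := fun x y => by apply Complex.ext <;> simp
    map_smul' := fun r x => by apply Complex.ext <;> simp }

/-- The coordinate `z₂ = x₂ + i y₂`. -/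
noncomputable def zTwo : R4 →L[ℝ] ℂ := LinearMap.toContinuousLinearMap
  { toFun := fun x => ⟨x 2, x 3⟩
    map_add' := fun x y => by apply Complex.ext <;> simp
    map_smul' := fun r x => by apply Complex.ext <;> simp }

/-- The point of `ℝ⁴` with given complex coordinates. -/
noncomputable def ofComplex : ℂ × ℂ →L[ℝ] R4 := LinearMap.toContinuousLinearMap
  { toFun := fun z => !₂[z.1.re, z.1.im, z.2.re, z.2.im]
    map_add' := fun x y => by ext i; fin_cases i <;> simp
    map_smul' := fun r x => by ext i; fin_cases i <;> simp }

theorem zOne_apply (x : R4) : zOne x = ⟨x 0, x 1⟩ := rfl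

theorem zTwo_apply (x : R4) : zTwo x = ⟨x 2, x 3⟩ := rfl

@[simp] theorem zOne_ofComplex (z : ℂ × ℂ) : zOne (ofComplex z) = z.1 := by
  rw [zOne_apply]; simp [ofComplex]

@[simp] theorem zTwo_ofComplex (z : ℂ × ℂ) : zTwo (ofComplex z) = z.2 := by
  rw [zTwo_apply]; simp [ofComplex]

@[simp] theorem ofComplex_zOne_zTwo (x : R4) : ofComplex (zOne x, zTwo x) = x := by
  ext i; fin_cases i <;> simp [ofComplex, zOne_apply, zTwo_apply]

theorem ext_complex {x y : R4} (h1 : zOne x = zOne y) (h2 : zTwo x = zTwo y) : x = y := by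
  rw [← ofComplex_zOne_zTwo x, h1, h2, ofComplex_zOne_zTwo]

theorem liouvilleForm_eq_complex (x v : R4) : liouvilleForm x v =
    ((star (zOne x) * zOne v).im + (star (zTwo x) * zTwo v).im) / 2 := by
  simp [liouvilleForm, zOne_apply, zTwo_apply]
  ring

theorem norm_sq_eq_complex (x : R4) :
    ‖x‖ ^ 2 = Complex.normSq (zOne x) + Complex.normSq (zTwo x) := by
  rw [EuclideanSpace.norm_sq_eq, Fin.sum_univ_four]
  simp [zOne_apply, zTwo_apply, Complex.normSq_apply]
  ring

theorem contDiff_normSq : ContDiff ℝ ∞ Complex.normSq := by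
  have h : (Complex.normSq : ℂ → ℝ) = fun z => ‖z‖ ^ 2 := by
    funext z; rw [Complex.normSq_eq_norm_sq]
  rw [h]; exact contDiff_norm_sq ℝ

/-- Angular velocity of a complex curve in polar form. -/
theorem im_star_mul_deriv_polar {r ξ : ℝ → ℝ} {z Z : ℝ → ℂ} {r' ξ' : ℝ} {z' Z' : ℂ} {t : ℝ}
    (hr : HasDerivAt r r' t) (hξ : HasDerivAt ξ ξ' t) (hz : HasDerivAt z z' t)
    (hZ : HasDerivAt Z Z' t)
    (h : Z =ᶠ[𝓝 t] fun t => (r t : ℂ) * Complex.exp (ξ t * Complex.I) * z t) :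
    (star (Z t) * Z').im = r t ^ 2 * (Complex.normSq (z t) * ξ' + (star (z t) * z').im) := by
  have h1 : HasDerivAt (fun t => (r t : ℂ) * Complex.exp (ξ t * Complex.I) * z t)
      ((r' * Complex.exp (ξ t * Complex.I) +
        r t * (Complex.exp (ξ t * Complex.I) * (ξ' * Complex.I))) * z t +
        r t * Complex.exp (ξ t * Complex.I) * z') t :=
    (hr.ofReal_comp.fun_mul ((hξ.ofReal_comp.mul_const Complex.I).cexp)).fun_mul hz
  have h2 := hZ.unique (h1.congr_of_eventuallyEq h)
  rw [h2, h.eq_of_nhds]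
  have he : star (Complex.exp (ξ t * Complex.I)) * Complex.exp (ξ t * Complex.I) = 1 := by
    rw [Complex.star_def, ← Complex.exp_conj, ← Complex.exp_add]
    simp
  have h3 : star ((r t : ℂ) * Complex.exp (ξ t * Complex.I) * z t) *
      ((r' * Complex.exp (ξ t * Complex.I) +
        r t * (Complex.exp (ξ t * Complex.I) * (ξ' * Complex.I))) * z t +
        r t * Complex.exp (ξ t * Complex.I) * z') =
      (star (Complex.exp (ξ t * Complex.I)) * Complex.exp (ξ t * Complex.I)) *
        (r t * r' * (star (z t) * z t) + r t ^ 2 * (ξ' * (star (z t) * z t) * Complex.I) +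
        r t ^ 2 * (star (z t) * z')) := by
    simp only [star_mul', Complex.star_def, Complex.conj_ofReal]
    ring
  have h4 : star (z t) * z t = (Complex.normSq (z t) : ℂ) := by
    rw [Complex.normSq_eq_conj_mul_self, Complex.star_def]
  rw [h3, he, h4, one_mul, ← Complex.ofReal_pow, ← Complex.ofReal_mul, ← Complex.ofReal_mul,
    ← Complex.ofReal_mul, Complex.add_im, Complex.add_im, Complex.ofReal_im,
    Complex.im_ofReal_mul, Complex.im_ofReal_mul, Complex.im_ofReal_mul, Complex.I_im]
  ring

theorem hasDerivAt_arg {w : ℝ → ℂ} {w' : ℂ} {t : ℝ} (hw : HasDerivAt w w' t)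
    (h : w t ∈ Complex.slitPlane) :
    HasDerivAt (fun t => Complex.arg (w t)) (w' / w t).im t := by
  have h1 := hw.clog_real h
  have h2 := Complex.imCLM.hasFDerivAt.comp_hasDerivAt t h1
  simpa [Function.comp_def, Complex.log_im] using h2

theorem contDiffAt_arg {w : ℂ} (h : w ∈ Complex.slitPlane) : ContDiffAt ℝ ∞ Complex.arg w := by
  have h1 : ContDiffAt ℝ ∞ Complex.log w := (Complex.contDiffAt_log h).restrict_scalars ℝ
  have h2 := Complex.imCLM.contDiff.contDiffAt.comp w h1
  have h3 : (Complex.imCLM ∘ Complex.log) = Complex.arg := by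
    funext z; simp [Complex.log_im]
  rwa [h3] at h2

/-! ### Localized twist maps -/

/-- Parameters of a twist map. The positive integers `p`, `q` determine the periodic flow `(e^{it}
z₁, e^{ipt/q} z₂)`, whose orbit space has area coordinates `s = |z₁|² / (|z₁|² + (p/q)|z₂|²)` and `χ
= arg (w₀ z₁ᵖ z̄₂^q)`. The twist rotates, about the point `(s₀, 0)`, the ellipses with semi-axes
proportional to `(a, b)` by an angle which depends on the ellipse; `Θ` is a primitive of the angle
as a function of `ρ = ((s - s₀) / a)² + (χ / b)²`, and vanishes for `1 ≤ ρ`. The bounds on `a` and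
`b` keep the ellipse `ρ ≤ 1` inside `0 < s < 1` and away from the branch cut of `arg`. -/
structure TwistData where
  /-- first weight of the periodic flow -/
  p : ℕ
  /-- second weight of the periodic flow -/
  q : ℕ
  /-- phase that normalizes the angle `χ` -/
  w₀ : ℂ
  /-- centre of the ellipses -/
  s₀ : ℝ
  /-- semi-axis in the direction of `s` -/
  a : ℝ
  /-- semi-axis in the direction of `χ` -/
  b : ℝ
  /-- primitive of the rotation angle -/
  Θ : ℝ → ℝ
  p_pos : 0 < p
  q_pos : 0 < q
  w₀_ne : w₀ ≠ 0
  a_pos : 0 < a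
  a_lt : a < s₀
  a_lt' : a < 1 - s₀
  b_pos : 0 < b
  b_le : b ≤ Real.pi / 2
  Θ_smooth : ContDiff ℝ ∞ Θ
  Θ_zero : ∀ ρ, 1 ≤ ρ → Θ ρ = 0

namespace TwistData

variable (D : TwistData)

/-- The rotation angle on the ellipse through `(U, V)`, in rescaled coordinates. -/
noncomputable def angle (U V : ℝ) : ℝ := deriv D.Θ (U ^ 2 + V ^ 2)

/-- First coordinate of the rotated point. -/
noncomputable def rotU (U V : ℝ) : ℝ := U * Real.cos (D.angle U V) - V * Real.sin (D.angle U V)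

/-- Second coordinate of the rotated point. -/
noncomputable def rotV (U V : ℝ) : ℝ := U * Real.sin (D.angle U V) + V * Real.cos (D.angle U V)

/-- A primitive of `s dχ - s' dχ'`, where `(s', χ')` is the image of `(s, χ)`: the rotation
preserves area, so this form is closed. -/
noncomputable def primitive (U V : ℝ) : ℝ :=
  D.s₀ * D.b * (V - D.rotV U V) + D.a * D.b / 2 * (U * V - D.rotU U V * D.rotV U V -
    ((U ^ 2 + V ^ 2) * D.angle U V - D.Θ (U ^ 2 + V ^ 2)))

theorem contDiff_deriv_Θ : ContDiff ℝ ∞ (deriv D.Θ) := (contDiff_infty_iff_deriv.1 D.Θ_smooth).2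

theorem deriv_Θ_zero {ρ : ℝ} (h : 1 ≤ ρ) : deriv D.Θ ρ = 0 := by
  have h1 : HasDerivWithinAt D.Θ (deriv D.Θ ρ) (Set.Ici ρ) ρ :=
    ((D.Θ_smooth.differentiable (by simp)) ρ).hasDerivAt.hasDerivWithinAt
  have h2 : HasDerivWithinAt D.Θ 0 (Set.Ici ρ) ρ :=
    (hasDerivWithinAt_const ρ (Set.Ici ρ) (0 : ℝ)).congr
      (fun x hx => D.Θ_zero x (h.trans hx)) (D.Θ_zero ρ h)
  exact (uniqueDiffWithinAt_Ici ρ).eq_deriv _ h1 h2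

theorem rot_norm (U V : ℝ) : D.rotU U V ^ 2 + D.rotV U V ^ 2 = U ^ 2 + V ^ 2 := by
  simp only [rotU, rotV]
  linear_combination (U ^ 2 + V ^ 2) * Real.sin_sq_add_cos_sq (D.angle U V)

theorem rotU_of_one_le {U V : ℝ} (h : 1 ≤ U ^ 2 + V ^ 2) : D.rotU U V = U := by
  simp [rotU, angle, D.deriv_Θ_zero h]

theorem rotV_of_one_le {U V : ℝ} (h : 1 ≤ U ^ 2 + V ^ 2) : D.rotV U V = V := by
  simp [rotV, angle, D.deriv_Θ_zero h]

theorem primitive_of_one_le {U V : ℝ} (h : 1 ≤ U ^ 2 + V ^ 2) : D.primitive U V = 0 := by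
  simp [primitive, D.rotU_of_one_le h, D.rotV_of_one_le h, angle, D.deriv_Θ_zero h, D.Θ_zero _ h]

theorem contDiff_angle : ContDiff ℝ ∞ fun u : ℝ × ℝ => D.angle u.1 u.2 :=
  D.contDiff_deriv_Θ.comp ((contDiff_fst.pow 2).add (contDiff_snd.pow 2))

theorem contDiff_rotU : ContDiff ℝ ∞ fun u : ℝ × ℝ => D.rotU u.1 u.2 :=
  (contDiff_fst.mul (Real.contDiff_cos.comp D.contDiff_angle)).sub
    (contDiff_snd.mul (Real.contDiff_sin.comp D.contDiff_angle))

theorem contDiff_rotV : ContDiff ℝ ∞ fun u : ℝ × ℝ => D.rotV u.1 u.2 :=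
  (contDiff_fst.mul (Real.contDiff_sin.comp D.contDiff_angle)).add
    (contDiff_snd.mul (Real.contDiff_cos.comp D.contDiff_angle))

theorem contDiff_primitive : ContDiff ℝ ∞ fun u : ℝ × ℝ => D.primitive u.1 u.2 := by
  have hρ : ContDiff ℝ ∞ fun u : ℝ × ℝ => u.1 ^ 2 + u.2 ^ 2 :=
    (contDiff_fst.pow 2).add (contDiff_snd.pow 2)
  exact (contDiff_const.mul (contDiff_snd.sub D.contDiff_rotV)).add (contDiff_const.mul
    (((contDiff_fst.mul contDiff_snd).sub (D.contDiff_rotU.mul D.contDiff_rotV)).sub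
      ((hρ.mul D.contDiff_angle).sub (D.Θ_smooth.comp hρ))))

/-- The defining property of the primitive, along a curve. -/
theorem hasDerivAt_primitive {U V : ℝ → ℝ} {U' V' : ℝ} {t : ℝ} (hU : HasDerivAt U U' t)
    (hV : HasDerivAt V V' t) : ∃ R : ℝ, HasDerivAt (fun t => D.rotV (U t) (V t)) R t ∧
      HasDerivAt (fun t => D.primitive (U t) (V t))
        ((D.s₀ + D.a * U t) * (D.b * V') - (D.s₀ + D.a * D.rotU (U t) (V t)) * (D.b * R)) t := by
  have hρ : HasDerivAt (fun t => U t ^ 2 + V t ^ 2) (2 * U t * U' + 2 * V t * V') t := by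
    simpa using (hU.fun_pow 2).fun_add (hV.fun_pow 2)
  have hΘ : HasDerivAt (fun t => D.Θ (U t ^ 2 + V t ^ 2))
      (D.angle (U t) (V t) * (2 * U t * U' + 2 * V t * V')) t :=
    (((D.Θ_smooth.differentiable (by simp)) _).hasDerivAt).comp t hρ
  set φ' := deriv (deriv D.Θ) (U t ^ 2 + V t ^ 2) * (2 * U t * U' + 2 * V t * V') with hφ'
  have hφ : HasDerivAt (fun t => D.angle (U t) (V t)) φ' t :=
    (((D.contDiff_deriv_Θ.differentiable (by simp)) _).hasDerivAt).comp t hρ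
  have hc := hφ.cos
  have hs := hφ.sin
  have hRU := (hU.fun_mul hc).fun_sub (hV.fun_mul hs)
  have hRV := (hU.fun_mul hs).fun_add (hV.fun_mul hc)
  refine ⟨_, hRV, ?_⟩
  have hP := ((hV.fun_sub hRV).const_mul (D.s₀ * D.b)).fun_add
    ((((hU.fun_mul hV).fun_sub (hRU.fun_mul hRV)).fun_sub ((hρ.fun_mul hφ).fun_sub hΘ)).const_mul
      (D.a * D.b / 2))
  refine hP.congr_deriv ?_
  simp only [rotU]
  have h1 := Real.sin_sq_add_cos_sq (D.angle (U t) (V t))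
  generalize Real.sin (D.angle (U t) (V t)) = S at *
  generalize Real.cos (D.angle (U t) (V t)) = C at *
  generalize D.angle (U t) (V t) = A at *
  generalize U t = u at *
  generalize V t = v at *
  clear hP hRV hRU hs hc hφ hΘ hρ hU hV
  clear_value φ'
  linear_combination D.a * D.b / 2 * ((u * V' - v * U') + (u ^ 2 + v ^ 2) * φ') * h1

end TwistData

namespace TwistData

variable (D : TwistData)

/-- The ratio of the two weights. -/
noncomputable def slope : ℝ := (D.p : ℝ) / D.q

/-- Twice the Hamiltonian of the periodic flow. -/
noncomputable def energy (x : R4) : ℝ :=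
  Complex.normSq (zOne x) + D.slope * Complex.normSq (zTwo x)

/-- The invariant `s = |z₁|² / (|z₁|² + (p/q)|z₂|²)` of the periodic flow. -/
noncomputable def sCoord (x : R4) : ℝ := Complex.normSq (zOne x) / D.energy x

/-- The invariant `w₀ z₁ᵖ z̄₂^q` of the periodic flow. -/
noncomputable def wCoord (x : R4) : ℂ := D.w₀ * (zOne x ^ D.p * star (zTwo x) ^ D.q)

/-- Rescaled coordinate `U = (s - s₀) / a`. -/
noncomputable def uCoord (x : R4) : ℝ := (D.sCoord x - D.s₀) / D.a

/-- Rescaled coordinate `V = arg w / b`. -/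
noncomputable def vCoord (x : R4) : ℝ := Complex.arg (D.wCoord x) / D.b

/-- The value of `s` at the image point. -/
noncomputable def sImage (x : R4) : ℝ := D.s₀ + D.a * D.rotU (D.uCoord x) (D.vCoord x)

/-- The increment of the argument of `z₂`. -/
noncomputable def phaseTwo (x : R4) : ℝ := D.primitive (D.uCoord x) (D.vCoord x) / D.q

/-- The increment of the argument of `z₁`. -/
noncomputable def phaseOne (x : R4) : ℝ :=
  (D.b * D.rotV (D.uCoord x) (D.vCoord x) - Complex.arg (D.wCoord x) +
    D.primitive (D.uCoord x) (D.vCoord x)) / D.p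

/-- The factor by which `z₁` is stretched. -/
noncomputable def stretchOne (x : R4) : ℝ := √(D.sImage x / D.sCoord x)

/-- The factor by which `z₂` is stretched. -/
noncomputable def stretchTwo (x : R4) : ℝ := √((1 - D.sImage x) / (1 - D.sCoord x))

/-- The twist map: the lift, by a map preserving `λ` and `|z₁|² + (p/q)|z₂|²`, of the
area-preserving twist of the orbit space. The formula gives the identity outside of the ellipse `U²
+ V² < 1`. -/
noncomputable def twist (x : R4) : R4 := ofComplex
  (D.stretchOne x * Complex.exp (D.phaseOne x * Complex.I) * zOne x,
    D.stretchTwo x * Complex.exp (D.phaseTwo x * Complex.I) * zTwo x)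

/-- The points where polar coordinates are smooth. -/
def domain : Set R4 := {x | zOne x ≠ 0 ∧ zTwo x ≠ 0 ∧ D.wCoord x ∈ Complex.slitPlane}

theorem slope_pos : 0 < D.slope :=
  div_pos (Nat.cast_pos.2 D.p_pos) (Nat.cast_pos.2 D.q_pos)

theorem energy_pos {x : R4} (hx : x ≠ 0) : 0 < D.energy x := by
  have h1 := Complex.normSq_nonneg (zOne x)
  have h2 := Complex.normSq_nonneg (zTwo x)
  by_contra! h
  have h3 := mul_nonneg D.slope_pos.le h2
  have h4 : Complex.normSq (zOne x) = 0 := by unfold energy at h; linarith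
  have h5 : D.slope * Complex.normSq (zTwo x) = 0 := by unfold energy at h; linarith
  rcases mul_eq_zero.1 h5 with h6 | h6
  · exact D.slope_pos.ne' h6
  · refine hx (ext_complex ?_ ?_)
    · rw [Complex.normSq_eq_zero.1 h4, map_zero]
    · rw [Complex.normSq_eq_zero.1 h6, map_zero]

theorem energy_zero : D.energy 0 = 0 := by simp [energy]

theorem one_sub_sCoord {x : R4} (hx : x ≠ 0) :
    1 - D.sCoord x = D.slope * Complex.normSq (zTwo x) / D.energy x := by
  rw [sCoord, eq_div_iff (D.energy_pos hx).ne', sub_mul, div_mul_cancel₀ _ (D.energy_pos hx).ne',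
    energy]
  ring

theorem sCoord_mul_energy (x : R4) : D.sCoord x * D.energy x = Complex.normSq (zOne x) := by
  by_cases hx : x = 0
  · simp [hx, energy_zero]
  · rw [sCoord, div_mul_cancel₀ _ (D.energy_pos hx).ne']

theorem one_sub_sCoord_mul_energy (x : R4) :
    (1 - D.sCoord x) * D.energy x = D.slope * Complex.normSq (zTwo x) := by
  have h := D.sCoord_mul_energy x
  have h' : D.energy x = Complex.normSq (zOne x) + D.slope * Complex.normSq (zTwo x) := rfl
  linarith

theorem sCoord_of_zOne {x : R4} (h : zOne x = 0) : D.sCoord x = 0 := by simp [sCoord, h]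

theorem sCoord_of_zTwo {x : R4} (hx : x ≠ 0) (h : zTwo x = 0) : D.sCoord x = 1 := by
  have := D.one_sub_sCoord hx
  rw [h] at this
  simp at this
  linarith

theorem sCoord_mem {x : R4} (h1 : zOne x ≠ 0) (h2 : zTwo x ≠ 0) :
    0 < D.sCoord x ∧ D.sCoord x < 1 := by
  have hx : x ≠ 0 := by rintro rfl; simp at h1
  have h3 := D.one_sub_sCoord hx
  have h4 : 0 < D.slope * Complex.normSq (zTwo x) / D.energy x :=
    div_pos (mul_pos D.slope_pos (Complex.normSq_pos.2 h2)) (D.energy_pos hx)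
  exact ⟨div_pos (Complex.normSq_pos.2 h1) (D.energy_pos hx), by linarith⟩

theorem one_lt_uCoord_sq {x : R4} (h : D.sCoord x = 0 ∨ D.sCoord x = 1) :
    1 < D.uCoord x ^ 2 := by
  have ha := D.a_pos
  rw [uCoord, div_pow, one_lt_div (by positivity)]
  rcases h with h | h <;> rw [h] <;> nlinarith [D.a_lt, D.a_lt']

theorem one_le_vCoord_sq {x : R4} (h : (D.wCoord x).re < 0) : 1 ≤ D.vCoord x ^ 2 := by
  have hb := D.b_pos
  have h1 : Real.pi / 2 < |Complex.arg (D.wCoord x)| := by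
    by_contra! h2
    rw [Complex.abs_arg_le_pi_div_two_iff] at h2
    linarith
  rw [vCoord, div_pow, one_le_div (by positivity), ← sq_abs (Complex.arg _)]
  exact pow_le_pow_left₀ hb.le (by linarith [D.b_le]) 2

theorem wCoord_ne {x : R4} (h1 : zOne x ≠ 0) (h2 : zTwo x ≠ 0) : D.wCoord x ≠ 0 :=
  mul_ne_zero D.w₀_ne (mul_ne_zero (pow_ne_zero _ h1) (pow_ne_zero _ (star_ne_zero.2 h2)))

theorem contDiff_wCoord : ContDiff ℝ ∞ D.wCoord :=
  contDiff_const.mul ((zOne.contDiff.pow _).mul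
    (((starL' ℝ : ℂ ≃L[ℝ] ℂ).contDiff.comp zTwo.contDiff).pow _))

theorem contDiff_energy : ContDiff ℝ ∞ D.energy :=
  (contDiff_normSq.comp zOne.contDiff).add
    (contDiff_const.mul (contDiff_normSq.comp zTwo.contDiff))

theorem contDiffAt_sCoord {x : R4} (hx : x ≠ 0) : ContDiffAt ℝ ∞ D.sCoord x :=
  (contDiff_normSq.comp zOne.contDiff).contDiffAt.div D.contDiff_energy.contDiffAt
    (D.energy_pos hx).ne'

/-- Every point outside of the domain of the polar coordinates has a neighbourhood with
`1 ≤ U² + V²`, where the twist map is the identity. -/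
theorem eventually_one_le {x : R4} (hx : x ≠ 0) (h : x ∉ D.domain) :
    ∀ᶠ y in 𝓝 x, 1 ≤ D.uCoord y ^ 2 + D.vCoord y ^ 2 := by
  have hs : ContinuousAt (fun y => D.uCoord y ^ 2) x :=
    (((D.contDiffAt_sCoord hx).continuousAt.sub continuousAt_const).div_const _).pow 2
  by_cases h' : zOne x = 0 ∨ zTwo x = 0
  · have h1 : 1 < D.uCoord x ^ 2 := D.one_lt_uCoord_sq
      (h'.imp D.sCoord_of_zOne (D.sCoord_of_zTwo hx))
    filter_upwards [hs.eventually (lt_mem_nhds h1)] with y hy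
    nlinarith [sq_nonneg (D.vCoord y)]
  · push Not at h'
    have h1 : D.wCoord x ∉ Complex.slitPlane := fun h2 => h ⟨h'.1, h'.2, h2⟩
    have h2 : (D.wCoord x).re < 0 := by
      rw [Complex.mem_slitPlane_iff] at h1
      push Not at h1
      refine lt_of_le_of_ne h1.1 fun h3 => D.wCoord_ne h'.1 h'.2 (Complex.ext h3 h1.2)
    have hc : Continuous fun y => (D.wCoord y).re :=
      Complex.continuous_re.comp D.contDiff_wCoord.continuous
    filter_upwards [hc.continuousAt.eventually (gt_mem_nhds h2)] with y hy
    nlinarith [sq_nonneg (D.uCoord y), D.one_le_vCoord_sq hy]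

theorem mem_domain_of_lt_one {x : R4} (h : D.uCoord x ^ 2 + D.vCoord x ^ 2 < 1) : x ∈ D.domain := by
  by_contra h'
  by_cases hx : x = 0
  · have h1 := D.one_lt_uCoord_sq (x := x) (Or.inl (D.sCoord_of_zOne (by simp [hx])))
    nlinarith [sq_nonneg (D.vCoord x)]
  · exact (D.eventually_one_le hx h').self_of_nhds.not_gt h

theorem ne_zero_of_mem_domain {x : R4} (h : x ∈ D.domain) : x ≠ 0 := by
  rintro rfl; exact h.1 (map_zero _)

theorem sImage_of_one_le {x : R4} (h : 1 ≤ D.uCoord x ^ 2 + D.vCoord x ^ 2) :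
    D.sImage x = D.sCoord x := by
  rw [sImage, D.rotU_of_one_le h, uCoord, mul_div_cancel₀ _ D.a_pos.ne']
  ring

theorem sImage_mem {x : R4} (hx : x ∈ D.domain) : 0 < D.sImage x ∧ D.sImage x < 1 := by
  rcases le_or_gt 1 (D.uCoord x ^ 2 + D.vCoord x ^ 2) with h | h
  · rw [D.sImage_of_one_le h]
    exact D.sCoord_mem hx.1 hx.2.1
  · have h1 := D.rot_norm (D.uCoord x) (D.vCoord x)
    have h2 : |D.rotU (D.uCoord x) (D.vCoord x)| < 1 := by
      rw [← sq_lt_one_iff_abs_lt_one]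
      nlinarith [sq_nonneg (D.rotV (D.uCoord x) (D.vCoord x))]
    have h3 := abs_lt.1 h2
    have ha := D.a_pos
    constructor <;> unfold sImage <;> nlinarith [D.a_lt, D.a_lt']

theorem twist_of_one_le {x : R4} (h : 1 ≤ D.uCoord x ^ 2 + D.vCoord x ^ 2) : D.twist x = x := by
  by_cases hx : x = 0
  · rw [twist, hx, map_zero, map_zero, mul_zero, mul_zero]; exact map_zero ofComplex
  have h1 : D.phaseTwo x = 0 := by rw [phaseTwo, D.primitive_of_one_le h, zero_div]
  have h2 : D.phaseOne x = 0 := by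
    rw [phaseOne, D.primitive_of_one_le h, D.rotV_of_one_le h, vCoord,
      mul_div_cancel₀ _ D.b_pos.ne']
    simp
  refine ext_complex ?_ ?_
  · rw [twist, zOne_ofComplex, h2, stretchOne, D.sImage_of_one_le h]
    by_cases h3 : zOne x = 0
    · simp [h3]
    · have : D.sCoord x ≠ 0 :=
        (div_pos (Complex.normSq_pos.2 h3) (D.energy_pos hx)).ne'
      simp [div_self this]
  · rw [twist, zTwo_ofComplex, h1, stretchTwo, D.sImage_of_one_le h]
    by_cases h3 : zTwo x = 0
    · simp [h3]
    · have : 1 - D.sCoord x ≠ 0 := by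
        rw [D.one_sub_sCoord hx]
        exact (div_pos (mul_pos D.slope_pos (Complex.normSq_pos.2 h3)) (D.energy_pos hx)).ne'
      simp [div_self this]

/-- The energy of the image point: with `E = energy x` the two terms are `s' E` and `(1 - s') E`. -/
theorem stretchOne_sq_mul (x : R4) :
    D.stretchOne x ^ 2 * Complex.normSq (zOne x) + D.slope *
      (D.stretchTwo x ^ 2 * Complex.normSq (zTwo x)) = D.energy x := by
  rcases le_or_gt 1 (D.uCoord x ^ 2 + D.vCoord x ^ 2) with h | h
  · have h1 := congrArg D.energy (D.twist_of_one_le h)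
    rw [energy, twist, zOne_ofComplex, zTwo_ofComplex] at h1
    simp only [map_mul, Complex.normSq_ofReal] at h1
    simp only [Complex.normSq_eq_norm_sq (Complex.exp _), Complex.norm_exp_ofReal_mul_I] at h1
    rw [← h1]
    ring
  · have hx := D.mem_domain_of_lt_one h
    have h1 := D.sCoord_mem hx.1 hx.2.1
    have h2 := D.sImage_mem hx
    rw [stretchOne, stretchTwo, Real.sq_sqrt (div_nonneg h2.1.le h1.1.le),
      Real.sq_sqrt (div_nonneg (by linarith) (by linarith)), ← D.sCoord_mul_energy,
      mul_left_comm D.slope, ← D.one_sub_sCoord_mul_energy]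
    have h3 : 1 - D.sCoord x ≠ 0 := by linarith
    field_simp [h1.1.ne']
    ring

theorem normSq_zOne_twist (x : R4) :
    Complex.normSq (zOne (D.twist x)) = D.stretchOne x ^ 2 * Complex.normSq (zOne x) := by
  rw [twist, zOne_ofComplex, map_mul, map_mul, Complex.normSq_ofReal,
    Complex.normSq_eq_norm_sq (Complex.exp _), Complex.norm_exp_ofReal_mul_I]
  ring

theorem normSq_zTwo_twist (x : R4) :
    Complex.normSq (zTwo (D.twist x)) = D.stretchTwo x ^ 2 * Complex.normSq (zTwo x) := by
  rw [twist, zTwo_ofComplex, map_mul, map_mul, Complex.normSq_ofReal,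
    Complex.normSq_eq_norm_sq (Complex.exp _), Complex.norm_exp_ofReal_mul_I]
  ring

/-- The twist map preserves the Hamiltonian of the periodic flow. -/
theorem energy_twist (x : R4) : D.energy (D.twist x) = D.energy x := by
  rw [energy, normSq_zOne_twist, normSq_zTwo_twist, stretchOne_sq_mul]

theorem twist_ne_zero {x : R4} (hx : x ≠ 0) : D.twist x ≠ 0 := fun h => by
  have h1 := D.energy_twist x
  rw [h, energy_zero] at h1
  exact (D.energy_pos hx).ne h1

theorem sCoord_smul {r : ℝ} (hr : 0 < r) (x : R4) : D.sCoord (r • x) = D.sCoord x := by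
  have h1 : D.energy (r • x) = (r * r) * D.energy x := by
    simp only [energy, map_smul, Complex.real_smul, map_mul, Complex.normSq_ofReal]; ring
  rw [sCoord, h1, map_smul, Complex.real_smul, map_mul, Complex.normSq_ofReal,
    mul_div_mul_left _ _ (by positivity), sCoord]

theorem arg_wCoord_smul {r : ℝ} (hr : 0 < r) (x : R4) :
    Complex.arg (D.wCoord (r • x)) = Complex.arg (D.wCoord x) := by
  have h1 : D.wCoord (r • x) = ((r ^ D.p * r ^ D.q : ℝ) : ℂ) * D.wCoord x := by
    simp only [wCoord, map_smul, Complex.real_smul, star_mul', Complex.star_def,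
      Complex.conj_ofReal]
    push_cast
    ring
  rw [h1, Complex.arg_real_mul _ (by positivity)]

theorem twist_smul {r : ℝ} (hr : 0 < r) (x : R4) : D.twist (r • x) = r • D.twist x := by
  have hu : D.uCoord (r • x) = D.uCoord x := by rw [uCoord, D.sCoord_smul hr, uCoord]
  have hv : D.vCoord (r • x) = D.vCoord x := by rw [vCoord, D.arg_wCoord_smul hr, vCoord]
  have h1 : D.stretchOne (r • x) = D.stretchOne x := by
    simp only [stretchOne, sImage, hu, hv, D.sCoord_smul hr]
  have h2 : D.stretchTwo (r • x) = D.stretchTwo x := by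
    simp only [stretchTwo, sImage, hu, hv, D.sCoord_smul hr]
  have h3 : D.phaseOne (r • x) = D.phaseOne x := by
    simp only [phaseOne, hu, hv, D.arg_wCoord_smul hr]
  have h4 : D.phaseTwo (r • x) = D.phaseTwo x := by simp only [phaseTwo, hu, hv]
  rw [twist, h1, h2, h3, h4, twist, ← map_smul]
  congr 1
  ext <;> simp <;> ring

theorem contDiffAt_uCoord {x : R4} (hx : x ≠ 0) : ContDiffAt ℝ ∞ D.uCoord x :=
  ((D.contDiffAt_sCoord hx).sub contDiffAt_const).div_const _

theorem contDiffAt_arg_wCoord {x : R4} (hx : x ∈ D.domain) :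
    ContDiffAt ℝ ∞ (fun x => Complex.arg (D.wCoord x)) x :=
  (contDiffAt_arg hx.2.2).comp x D.contDiff_wCoord.contDiffAt

theorem contDiffAt_uvCoord {x : R4} (hx : x ∈ D.domain) :
    ContDiffAt ℝ ∞ (fun x => (D.uCoord x, D.vCoord x)) x :=
  (D.contDiffAt_uCoord (D.ne_zero_of_mem_domain hx)).prodMk
    ((D.contDiffAt_arg_wCoord hx).div_const _)

theorem contDiffAt_sImage {x : R4} (hx : x ∈ D.domain) : ContDiffAt ℝ ∞ D.sImage x :=
  contDiffAt_const.add (contDiffAt_const.mul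
    (D.contDiff_rotU.contDiffAt.comp x (D.contDiffAt_uvCoord hx)))

theorem contDiffAt_primitive {x : R4} (hx : x ∈ D.domain) :
    ContDiffAt ℝ ∞ (fun x => D.primitive (D.uCoord x) (D.vCoord x)) x :=
  D.contDiff_primitive.contDiffAt.comp x (D.contDiffAt_uvCoord hx)

theorem contDiffAt_phaseTwo {x : R4} (hx : x ∈ D.domain) : ContDiffAt ℝ ∞ D.phaseTwo x :=
  (D.contDiffAt_primitive hx).div_const _

theorem contDiffAt_phaseOne {x : R4} (hx : x ∈ D.domain) : ContDiffAt ℝ ∞ D.phaseOne x :=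
  (((contDiffAt_const.mul (D.contDiff_rotV.contDiffAt.comp x (D.contDiffAt_uvCoord hx))).sub
    (D.contDiffAt_arg_wCoord hx)).add (D.contDiffAt_primitive hx)).div_const _

theorem contDiffAt_stretchOne {x : R4} (hx : x ∈ D.domain) : ContDiffAt ℝ ∞ D.stretchOne x := by
  have h1 := D.sCoord_mem hx.1 hx.2.1
  have h2 := D.sImage_mem hx
  exact ((D.contDiffAt_sImage hx).div (D.contDiffAt_sCoord (D.ne_zero_of_mem_domain hx))
    h1.1.ne').sqrt (div_pos h2.1 h1.1).ne'

theorem contDiffAt_stretchTwo {x : R4} (hx : x ∈ D.domain) : ContDiffAt ℝ ∞ D.stretchTwo x := by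
  have h1 := D.sCoord_mem hx.1 hx.2.1
  have h2 := D.sImage_mem hx
  have h3 : 0 < 1 - D.sCoord x := by linarith
  exact ((contDiffAt_const.sub (D.contDiffAt_sImage hx)).div
    (contDiffAt_const.sub (D.contDiffAt_sCoord (D.ne_zero_of_mem_domain hx)))
    h3.ne').sqrt (div_pos (by linarith) h3).ne'

theorem contDiffAt_twist {x : R4} (hx : x ≠ 0) : ContDiffAt ℝ ∞ D.twist x := by
  by_cases h : x ∈ D.domain
  · have hexp : ∀ f : R4 → ℝ, ContDiffAt ℝ ∞ f x →
        ContDiffAt ℝ ∞ (fun x => Complex.exp (f x * Complex.I)) x := fun f hf =>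
      ((Complex.ofRealCLM.contDiff.contDiffAt.comp x hf).mul contDiffAt_const).cexp
    exact ofComplex.contDiff.contDiffAt.comp x
      ((((Complex.ofRealCLM.contDiff.contDiffAt.comp x (D.contDiffAt_stretchOne h)).mul
        (hexp _ (D.contDiffAt_phaseOne h))).mul zOne.contDiff.contDiffAt).prodMk
      (((Complex.ofRealCLM.contDiff.contDiffAt.comp x (D.contDiffAt_stretchTwo h)).mul
        (hexp _ (D.contDiffAt_phaseTwo h))).mul zTwo.contDiff.contDiffAt))
  · refine contDiffAt_id.congr_of_eventuallyEq ?_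
    filter_upwards [D.eventually_one_le hx h] with y hy using D.twist_of_one_le hy

/-- The angle `χ = arg w` changes along a curve according to the angular velocities of `z₁`, `z₂`.
-/
theorem hasDerivAt_arg_wCoord {x : R4} (hx : x ∈ D.domain) (v : R4) :
    HasDerivAt (fun t : ℝ => Complex.arg (D.wCoord (x + t • v)))
      (D.p * (star (zOne x) * zOne v).im / Complex.normSq (zOne x) -
        D.q * (star (zTwo x) * zTwo v).im / Complex.normSq (zTwo x)) 0 := by
  have hline : HasDerivAt (fun t : ℝ => x + t • v) v 0 := by
    simpa using ((hasDerivAt_id (0 : ℝ)).smul_const v).const_add x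
  have hz1 : HasDerivAt (fun t : ℝ => zOne (x + t • v)) (zOne v) 0 :=
    zOne.hasFDerivAt.comp_hasDerivAt (0 : ℝ) hline
  have hz2 : HasDerivAt (fun t : ℝ => zTwo (x + t • v)) (zTwo v) 0 :=
    zTwo.hasFDerivAt.comp_hasDerivAt (0 : ℝ) hline
  have hw := ((hz1.fun_pow D.p).fun_mul (hz2.star.fun_pow D.q)).const_mul D.w₀
  have h := hasDerivAt_arg hw (by simpa [wCoord] using hx.2.2)
  refine h.congr_deriv ?_
  simp only [zero_smul, add_zero]
  have h1 := hx.1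
  have h2 : star (zTwo x) ≠ 0 := star_ne_zero.2 hx.2.1
  have h2' := hx.2.1
  have e1 : zOne v / zOne x = star (zOne x) * zOne v / (Complex.normSq (zOne x) : ℂ) := by
    rw [Complex.normSq_eq_conj_mul_self, Complex.star_def]
    have : (starRingEnd ℂ) (zOne x) ≠ 0 := star_ne_zero.2 h1
    field_simp
  have e2 : star (zTwo v) / star (zTwo x) =
      star (star (zTwo x) * zTwo v) / (Complex.normSq (zTwo x) : ℂ) := by
    rw [Complex.normSq_eq_conj_mul_self, star_mul', star_star]
    simp only [Complex.star_def] at h2 ⊢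
    field_simp
  have e3 : (D.w₀ * ((D.p * zOne x ^ (D.p - 1) * zOne v) * star (zTwo x) ^ D.q +
      zOne x ^ D.p * (D.q * star (zTwo x) ^ (D.q - 1) * star (zTwo v)))) /
      (D.w₀ * (zOne x ^ D.p * star (zTwo x) ^ D.q)) =
      (D.p : ℝ) * (zOne v / zOne x) + (D.q : ℝ) * (star (zTwo v) / star (zTwo x)) := by
    have hw₀ := D.w₀_ne
    obtain ⟨p, hp⟩ : ∃ p, D.p = p + 1 := ⟨D.p - 1, by have := D.p_pos; omega⟩
    obtain ⟨q, hq⟩ : ∃ q, D.q = q + 1 := ⟨D.q - 1, by have := D.q_pos; omega⟩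
    rw [hp, hq]
    simp only [Nat.add_sub_cancel, Complex.ofReal_natCast]
    field_simp
    try ring
  have e4 : (star (star (zTwo x) * zTwo v)).im = -(star (zTwo x) * zTwo v).im :=
    Complex.conj_im _
  rw [e3, e1, e2, Complex.add_im, Complex.im_ofReal_mul, Complex.im_ofReal_mul,
    Complex.div_ofReal_im, Complex.div_ofReal_im, e4]
  ring

/-- In polar coordinates `2λ = |z₁|² dθ₁ + |z₂|² dθ₂`, and the phases of the twist map are chosen to
make up for the change of `|z₁|²` and `|z₂|²`, by the equation `d primitive = s dχ - s' dχ'`. -/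
theorem liouvilleForm_fderiv_twist_of_mem {x : R4} (hx : x ∈ D.domain) (v : R4) :
    liouvilleForm (D.twist x) (fderiv ℝ D.twist x v) = liouvilleForm x v := by
  have hx0 := D.ne_zero_of_mem_domain hx
  have hline : HasDerivAt (fun t : ℝ => x + t • v) v 0 := by
    simpa using ((hasDerivAt_id (0 : ℝ)).smul_const v).const_add x
  have hd : ∀ {F : Type} [NormedAddCommGroup F] [NormedSpace ℝ F] {f : R4 → F},
      ContDiffAt ℝ ∞ f x → HasDerivAt (fun t : ℝ => f (x + t • v)) (fderiv ℝ f x v) 0 := by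
    intro F _ _ f hf
    have h1 : HasFDerivAt f (fderiv ℝ f x) (x + (0 : ℝ) • v) := by
      simpa using (hf.differentiableAt (by simp)).hasFDerivAt
    exact h1.comp_hasDerivAt (0 : ℝ) hline
  have hz1 : HasDerivAt (fun t : ℝ => zOne (x + t • v)) (zOne v) 0 :=
    zOne.hasFDerivAt.comp_hasDerivAt (0 : ℝ) hline
  have hz2 : HasDerivAt (fun t : ℝ => zTwo (x + t • v)) (zTwo v) 0 :=
    zTwo.hasFDerivAt.comp_hasDerivAt (0 : ℝ) hline
  have hT := hd (D.contDiffAt_twist hx0)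
  have hZ1 := zOne.hasFDerivAt.comp_hasDerivAt (0 : ℝ) hT
  have hZ2 := zTwo.hasFDerivAt.comp_hasDerivAt (0 : ℝ) hT
  have hχ := D.hasDerivAt_arg_wCoord hx v
  obtain ⟨R, hR, hP⟩ := D.hasDerivAt_primitive
    (hd (D.contDiffAt_uCoord hx0)) (hχ.div_const D.b)
  have hξ := ((((hR.const_mul D.b).fun_sub hχ).fun_add hP).div_const (D.p : ℝ))
  have hη := hP.div_const (D.q : ℝ)
  have k1 := im_star_mul_deriv_polar (hd (D.contDiffAt_stretchOne hx)) hξ hz1 hZ1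
    (Filter.Eventually.of_forall fun t => by
      simp only [Function.comp, twist, zOne_ofComplex]; rfl)
  have k2 := im_star_mul_deriv_polar (hd (D.contDiffAt_stretchTwo hx)) hη hz2 hZ2
    (Filter.Eventually.of_forall fun t => by
      simp only [Function.comp, twist, zTwo_ofComplex]; rfl)
  simp only [Function.comp, zero_smul, add_zero] at k1 k2
  rw [liouvilleForm_eq_complex, liouvilleForm_eq_complex, k1, k2]
  have h1 := D.sCoord_mem hx.1 hx.2.1
  have h2 := D.sImage_mem hx
  rw [stretchOne, stretchTwo, Real.sq_sqrt (div_nonneg h2.1.le h1.1.le),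
      Real.sq_sqrt (div_nonneg (by linarith) (by linarith))]
  have e1 : D.s₀ + D.a * D.uCoord x = D.sCoord x := by
    rw [uCoord, mul_div_cancel₀ _ D.a_pos.ne']; ring
  have e2 : D.s₀ + D.a * D.rotU (D.uCoord x) (Complex.arg (D.wCoord x) / D.b) = D.sImage x := rfl
  rw [e1, e2, mul_div_cancel₀ _ D.b_pos.ne']
  have n1 := Complex.normSq_pos.2 hx.1
  have n2 := Complex.normSq_pos.2 hx.2.1
  have m1 := D.sCoord_mul_energy x
  have m2 := D.one_sub_sCoord_mul_energy x
  have hE := D.energy_pos hx0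
  have hp : (0 : ℝ) < D.p := Nat.cast_pos.2 D.p_pos
  have hq : (0 : ℝ) < D.q := Nat.cast_pos.2 D.q_pos
  have m3 : Complex.normSq (zTwo x) = (1 - D.sCoord x) * D.energy x * D.q / D.p := by
    rw [m2, slope]; field_simp
  have h3 : 1 - D.sCoord x ≠ 0 := by linarith
  have h4 := h1.1.ne'
  rw [m3, ← m1]
  generalize (star (zOne x) * zOne v).im = J1
  generalize (star (zTwo x) * zTwo v).im = J2
  generalize D.sImage x = s' at *
  generalize D.sCoord x = s at *
  generalize D.energy x = E at *
  field_simp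
  ring

/-- The twist map preserves the Liouville form. -/
theorem liouvilleForm_fderiv_twist {x : R4} (hx : x ≠ 0) (v : R4) :
    liouvilleForm (D.twist x) (fderiv ℝ D.twist x v) = liouvilleForm x v := by
  by_cases h : x ∈ D.domain
  · exact D.liouvilleForm_fderiv_twist_of_mem h v
  · have h1 := D.eventually_one_le hx h
    have h2 : D.twist =ᶠ[𝓝 x] id := by
      filter_upwards [h1] with y hy using D.twist_of_one_le hy
    rw [h2.fderiv_eq, h2.eq_of_nhds, fderiv_id]
    rfl

end TwistData

namespace TwistData

variable (D : TwistData)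

/-- The twist data with the opposite rotation angle. -/
noncomputable def inv : TwistData :=
  { D with
    Θ := fun ρ => -D.Θ ρ
    Θ_smooth := D.Θ_smooth.neg
    Θ_zero := fun ρ h => by rw [D.Θ_zero ρ h, neg_zero] }

theorem inv_angle (U V : ℝ) : D.inv.angle U V = -D.angle U V := by
  change deriv (fun ρ => -D.Θ ρ) _ = _
  rw [deriv.fun_neg]; rfl

theorem angle_rot (U V : ℝ) : D.angle (D.rotU U V) (D.rotV U V) = D.angle U V := by
  rw [angle, D.rot_norm, angle]

theorem inv_rotU (U V : ℝ) : D.inv.rotU (D.rotU U V) (D.rotV U V) = U := by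
  rw [rotU, inv_angle, angle_rot, Real.cos_neg, Real.sin_neg, rotU, rotV]
  linear_combination U * Real.sin_sq_add_cos_sq (D.angle U V)

theorem inv_rotV (U V : ℝ) : D.inv.rotV (D.rotU U V) (D.rotV U V) = V := by
  rw [rotV, inv_angle, angle_rot, Real.cos_neg, Real.sin_neg, rotU, rotV]
  linear_combination V * Real.sin_sq_add_cos_sq (D.angle U V)

theorem inv_primitive (U V : ℝ) :
    D.inv.primitive (D.rotU U V) (D.rotV U V) = -D.primitive U V := by
  rw [primitive, inv_rotU, inv_rotV, inv_angle, angle_rot, rot_norm, primitive]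
  change D.s₀ * D.b * _ + D.a * D.b / 2 * (_ - (_ - -D.Θ _)) = _
  ring

/-- Area coordinates of the image point. -/
theorem sCoord_twist (x : R4) : D.sCoord (D.twist x) = D.sImage x := by
  rcases le_or_gt 1 (D.uCoord x ^ 2 + D.vCoord x ^ 2) with h | h
  · rw [D.twist_of_one_le h, D.sImage_of_one_le h]
  have hx := D.mem_domain_of_lt_one h
  have h1 := D.sCoord_mem hx.1 hx.2.1
  have h2 := D.sImage_mem hx
  have hE := D.energy_pos (D.ne_zero_of_mem_domain hx)
  rw [sCoord, energy_twist, normSq_zOne_twist, ← sCoord_mul_energy, stretchOne,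
    Real.sq_sqrt (div_nonneg h2.1.le h1.1.le)]
  have := h1.1.ne'
  field_simp

theorem stretchOne_pos {x : R4} (hx : x ∈ D.domain) : 0 < D.stretchOne x :=
  Real.sqrt_pos.2 (div_pos (D.sImage_mem hx).1 (D.sCoord_mem hx.1 hx.2.1).1)

theorem stretchTwo_pos {x : R4} (hx : x ∈ D.domain) : 0 < D.stretchTwo x :=
  Real.sqrt_pos.2 (div_pos (by linarith [(D.sImage_mem hx).2])
    (by linarith [(D.sCoord_mem hx.1 hx.2.1).2]))

theorem arg_wCoord_twist {x : R4} (h : D.uCoord x ^ 2 + D.vCoord x ^ 2 < 1) :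
    Complex.arg (D.wCoord (D.twist x)) = D.b * D.rotV (D.uCoord x) (D.vCoord x) := by
  have hx := D.mem_domain_of_lt_one h
  set χ := Complex.arg (D.wCoord x) with hχ
  set χ' := D.b * D.rotV (D.uCoord x) (D.vCoord x) with hχ'
  have hp : (D.p : ℂ) ≠ 0 := Nat.cast_ne_zero.2 D.p_pos.ne'
  have hq : (D.q : ℂ) ≠ 0 := Nat.cast_ne_zero.2 D.q_pos.ne'
  have hr : 0 < D.stretchOne x ^ D.p * D.stretchTwo x ^ D.q * ‖D.wCoord x‖ :=
    mul_pos (mul_pos (pow_pos (D.stretchOne_pos hx) _) (pow_pos (D.stretchTwo_pos hx) _))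
      (norm_pos_iff.2 (D.wCoord_ne hx.1 hx.2.1))
  have hw : D.wCoord (D.twist x) =
      ((D.stretchOne x ^ D.p * D.stretchTwo x ^ D.q * ‖D.wCoord x‖ : ℝ) : ℂ) *
        Complex.exp (χ' * Complex.I) := by
    have h0 := Complex.norm_mul_exp_arg_mul_I (D.wCoord x)
    rw [← hχ] at h0
    have hs : star (Complex.exp (D.phaseTwo x * Complex.I)) =
        Complex.exp (-(D.phaseTwo x * Complex.I)) := by
      rw [Complex.star_def, ← Complex.exp_conj]
      simp
    have he : Complex.exp (χ' * Complex.I) = Complex.exp (χ * Complex.I) *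
        (Complex.exp (D.phaseOne x * Complex.I) ^ D.p *
          Complex.exp (-(D.phaseTwo x * Complex.I)) ^ D.q) := by
      rw [← Complex.exp_nat_mul, ← Complex.exp_nat_mul, ← Complex.exp_add, ← Complex.exp_add]
      congr 1
      rw [phaseOne, phaseTwo, ← hχ, ← hχ']
      push_cast
      field_simp
      ring
    have h1 : D.wCoord (D.twist x) = D.stretchOne x ^ D.p * D.stretchTwo x ^ D.q *
        (Complex.exp (D.phaseOne x * Complex.I) ^ D.p *
          Complex.exp (-(D.phaseTwo x * Complex.I)) ^ D.q) * D.wCoord x := by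
      simp only [wCoord, twist, zOne_ofComplex, zTwo_ofComplex, star_mul', hs]
      simp only [Complex.star_def, Complex.conj_ofReal]
      ring
    rw [h1, he]
    nth_rewrite 1 [← h0]
    push_cast
    ring
  have hV : |D.rotV (D.uCoord x) (D.vCoord x)| < 1 := by
    have h1 := D.rot_norm (D.uCoord x) (D.vCoord x)
    rw [← sq_lt_one_iff_abs_lt_one]
    nlinarith [sq_nonneg (D.rotU (D.uCoord x) (D.vCoord x))]
  have hV' := abs_lt.1 hV
  have hb := D.b_pos
  have hb' := D.b_le
  have hpi := Real.pi_pos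
  rw [hw, Complex.arg_real_mul _ hr, Complex.arg_exp_mul_I, toIocMod_eq_self]
  constructor <;> nlinarith

theorem uCoord_twist (x : R4) : D.uCoord (D.twist x) = D.rotU (D.uCoord x) (D.vCoord x) := by
  rw [uCoord, sCoord_twist, sImage, add_sub_cancel_left, mul_div_cancel_left₀ _ D.a_pos.ne']

theorem vCoord_twist {x : R4} (h : D.uCoord x ^ 2 + D.vCoord x ^ 2 < 1) :
    D.vCoord (D.twist x) = D.rotV (D.uCoord x) (D.vCoord x) := by
  rw [vCoord, D.arg_wCoord_twist h, mul_div_cancel_left₀ _ D.b_pos.ne']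

theorem inv_twist_twist (x : R4) : D.inv.twist (D.twist x) = x := by
  rcases le_or_gt 1 (D.uCoord x ^ 2 + D.vCoord x ^ 2) with h | h
  · rw [D.twist_of_one_le h]
    exact D.inv.twist_of_one_le h
  have hx := D.mem_domain_of_lt_one h
  have hu : D.inv.uCoord (D.twist x) = D.rotU (D.uCoord x) (D.vCoord x) := D.uCoord_twist x
  have hv : D.inv.vCoord (D.twist x) = D.rotV (D.uCoord x) (D.vCoord x) := D.vCoord_twist h
  have hs : D.inv.sCoord (D.twist x) = D.sImage x := D.sCoord_twist x
  have ha : Complex.arg (D.inv.wCoord (D.twist x)) =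
    D.b * D.rotV (D.uCoord x) (D.vCoord x) := D.arg_wCoord_twist h
  have hs' : D.inv.sImage (D.twist x) = D.sCoord x := by
    rw [sImage, hu, hv, inv_rotU]
    change D.s₀ + D.a * D.uCoord x = _
    rw [uCoord, mul_div_cancel₀ _ D.a_pos.ne']
    ring
  have h2 : D.inv.phaseTwo (D.twist x) = -D.phaseTwo x := by
    rw [phaseTwo, hu, hv, inv_primitive, neg_div]; rfl
  have h1 : D.inv.phaseOne (D.twist x) = -D.phaseOne x := by
    rw [phaseOne, hu, hv, inv_primitive, inv_rotV, ha, phaseOne]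
    change (D.b * D.vCoord x - _ + _) / (D.p : ℝ) = _
    rw [vCoord, mul_div_cancel₀ _ D.b_pos.ne']
    ring
  have m1 := D.sCoord_mem hx.1 hx.2.1
  have m2 := D.sImage_mem hx
  have r1 : D.inv.stretchOne (D.twist x) * D.stretchOne x = 1 := by
    rw [stretchOne, hs, hs', stretchOne, ← Real.sqrt_mul (div_nonneg m1.1.le m2.1.le),
      div_mul_div_cancel₀' m1.1.ne', div_self m2.1.ne', Real.sqrt_one]
  have r2 : D.inv.stretchTwo (D.twist x) * D.stretchTwo x = 1 := by
    rw [stretchTwo, hs, hs', stretchTwo, ← Real.sqrt_mul (div_nonneg (by linarith) (by linarith)),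
      div_mul_div_cancel₀' (by linarith), div_self (by linarith), Real.sqrt_one]
  have e : ∀ θ : ℝ, Complex.exp ((-θ : ℝ) * Complex.I) * Complex.exp (θ * Complex.I) = 1 := by
    intro θ
    rw [← Complex.exp_add]
    simp
  have r1' : (D.inv.stretchOne (D.twist x) : ℂ) * D.stretchOne x = 1 := by exact_mod_cast r1
  have r2' : (D.inv.stretchTwo (D.twist x) : ℂ) * D.stretchTwo x = 1 := by exact_mod_cast r2
  refine ext_complex ?_ ?_
  · rw [twist, zOne_ofComplex, h1, twist, zOne_ofComplex]
    linear_combination (norm := (simp only [twist]; ring_nf))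
      (Complex.exp ((-D.phaseOne x : ℝ) * Complex.I) *
      Complex.exp (D.phaseOne x * Complex.I) * zOne x) * r1' + zOne x * e (D.phaseOne x)
  · rw [twist, zTwo_ofComplex, h2, twist, zTwo_ofComplex]
    linear_combination (norm := (simp only [twist]; ring_nf))
      (Complex.exp ((-D.phaseTwo x : ℝ) * Complex.I) *
      Complex.exp (D.phaseTwo x * Complex.I) * zTwo x) * r2' + zTwo x * e (D.phaseTwo x)

theorem inv_inv : D.inv.inv = D := by
  cases D
  simp [inv]

theorem twist_inv_twist (x : R4) : D.twist (D.inv.twist x) = x := by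
  have := D.inv.inv_twist_twist x
  rwa [inv_inv] at this

end TwistData

/-! ### Twist maps that connect orbits -/

/-- A smooth function on the line that vanishes on `[1, ∞)` and has prescribed derivative at a given
point to the left of `1`. -/
theorem exists_primitive_of_angle {ρ₀ : ℝ} (h : ρ₀ < 1) (φ : ℝ) :
    ∃ Θ : ℝ → ℝ, ContDiff ℝ ∞ Θ ∧ (∀ ρ, 1 ≤ ρ → Θ ρ = 0) ∧ deriv Θ ρ₀ = φ := by
  have h1 : 0 < 1 - ρ₀ := by linarith
  refine ⟨fun ρ => φ * (ρ - ρ₀) * Real.smoothTransition (2 * (1 - ρ) / (1 - ρ₀)), ?_, ?_, ?_⟩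
  · refine (contDiff_const.mul (contDiff_id.sub contDiff_const)).mul
      (Real.smoothTransition.contDiff.comp ?_)
    exact (contDiff_const.mul (contDiff_const.sub contDiff_id)).div_const _
  · intro ρ hρ
    dsimp only
    rw [Real.smoothTransition.zero_of_nonpos, mul_zero]
    exact div_nonpos_of_nonpos_of_nonneg (by linarith) h1.le
  · have h2 : (fun ρ => φ * (ρ - ρ₀) * Real.smoothTransition (2 * (1 - ρ) / (1 - ρ₀)))
        =ᶠ[𝓝 ρ₀] fun ρ => φ * (ρ - ρ₀) := by
      have h3 : ρ₀ < (1 + ρ₀) / 2 := by linarith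
      filter_upwards [gt_mem_nhds h3] with ρ hρ
      rw [Real.smoothTransition.one_of_one_le, mul_one]
      rw [le_div_iff₀ h1]; linarith
    rw [h2.deriv_eq]
    have h4 : HasDerivAt (fun ρ => φ * (ρ - ρ₀)) (φ * 1) ρ₀ :=
      ((hasDerivAt_id ρ₀).sub_const ρ₀).const_mul φ
    rw [h4.deriv, mul_one]

/-- Two orbits of the periodic flow, given by points `x`, `y` whose invariants have different
angles, are made to have the same value of `s` by a twist map that fixes `y`: a half-turn around the
midpoint of the values of `s`, along ellipses thin enough to miss `y`. -/
theorem exists_twist {p q : ℕ} (hp : 0 < p) (hq : 0 < q) {x y : R4} (hx1 : zOne x ≠ 0)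
    (hx2 : zTwo x ≠ 0) (hy1 : zOne y ≠ 0) (hy2 : zTwo y ≠ 0)
    (harg : Complex.arg ((zOne x ^ p * star (zTwo x) ^ q)⁻¹ *
      (zOne y ^ p * star (zTwo y) ^ q)) ≠ 0) :
    ∃ D : TwistData, D.p = p ∧ D.q = q ∧ D.twist y = y ∧
      ∃ x', D.twist x' = x ∧ D.sCoord x' = D.sCoord y := by
  have hbase : ∀ z : R4, zOne z ≠ 0 → zTwo z ≠ 0 → ∃ s : ℝ, 0 < s ∧ s < 1 ∧
      ∀ D : TwistData, D.p = p → D.q = q → D.sCoord z = s := by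
    intro z h1 h2
    have hβ : 0 < (p : ℝ) / q := div_pos (Nat.cast_pos.2 hp) (Nat.cast_pos.2 hq)
    have n1 := Complex.normSq_pos.2 h1
    have n2 := mul_pos hβ (Complex.normSq_pos.2 h2)
    refine ⟨Complex.normSq (zOne z) / (Complex.normSq (zOne z) + p / q * Complex.normSq (zTwo z)),
      by positivity, (div_lt_one (by positivity)).2 (by linarith), ?_⟩
    rintro D rfl rfl
    rfl
  obtain ⟨sx, hsx0, hsx1, hsx⟩ := hbase x hx1 hx2
  obtain ⟨sy, hsy0, hsy1, hsy⟩ := hbase y hy1 hy2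
  set χ := Complex.arg ((zOne x ^ p * star (zTwo x) ^ q)⁻¹ * (zOne y ^ p * star (zTwo y) ^ q))
    with hχ
  -- with the centre midway between `sx` and `sy`, the point `x` lies inside the ellipse, on `χ = 0`
  obtain ⟨a, ha1, ha2⟩ : ∃ a, |sx - sy| / 2 < a ∧ a < min ((sx + sy) / 2) (1 - (sx + sy) / 2) := by
    refine exists_between ?_
    rw [lt_min_iff]
    constructor
    · have : |sx - sy| < sx + sy := abs_lt.2 ⟨by linarith, by linarith⟩
      linarith
    · have : |sx - sy| < 2 - (sx + sy) := abs_lt.2 ⟨by linarith, by linarith⟩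
      linarith
  have ha : 0 < a := lt_of_le_of_lt (by positivity) ha1
  have hρ : ((sx - (sx + sy) / 2) / a) ^ 2 < 1 := by
    rw [sq_lt_one_iff_abs_lt_one, abs_div, abs_of_pos ha, div_lt_one ha]
    calc |sx - (sx + sy) / 2| = |(sx - sy) / 2| := by congr 1; ring
      _ = |sx - sy| / 2 := by rw [abs_div, abs_two]
      _ < a := ha1
  obtain ⟨Θ, hΘ1, hΘ2, hΘ3⟩ := exists_primitive_of_angle hρ Real.pi
  let D : TwistData :=
    { p := p, q := q, w₀ := (zOne x ^ p * star (zTwo x) ^ q)⁻¹, s₀ := (sx + sy) / 2, a := a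
      b := min |χ| (Real.pi / 2), Θ := Θ, p_pos := hp, q_pos := hq
      w₀_ne := inv_ne_zero (mul_ne_zero (pow_ne_zero _ hx1) (pow_ne_zero _ (star_ne_zero.2 hx2)))
      a_pos := ha, a_lt := (lt_min_iff.1 ha2).1, a_lt' := (lt_min_iff.1 ha2).2
      b_pos := lt_min (abs_pos.2 harg) (by positivity), b_le := min_le_right _ _
      Θ_smooth := hΘ1, Θ_zero := hΘ2 }
  -- as `b ≤ |χ|`, the point `y` lies outside of the ellipse
  have hDy : D.twist y = y := by
    refine D.twist_of_one_le ?_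
    have h1 : 1 ≤ D.vCoord y ^ 2 := by
      have hb := D.b_pos
      change 1 ≤ (χ / D.b) ^ 2
      rw [div_pow, one_le_div (by positivity), ← sq_abs χ]
      exact pow_le_pow_left₀ hb.le (min_le_left _ _) 2
    nlinarith [sq_nonneg (D.uCoord y)]
  have hu : D.uCoord x = (sx - (sx + sy) / 2) / a := by
    rw [TwistData.uCoord, hsx D rfl rfl]
  have hv : D.vCoord x = 0 := by
    have hw : D.wCoord x = 1 := by
      change (zOne x ^ p * star (zTwo x) ^ q)⁻¹ * (zOne x ^ p * star (zTwo x) ^ q) = 1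
      exact inv_mul_cancel₀
        (mul_ne_zero (pow_ne_zero _ hx1) (pow_ne_zero _ (star_ne_zero.2 hx2)))
    rw [TwistData.vCoord, hw, Complex.arg_one, zero_div]
  have hang : D.inv.angle (D.uCoord x) (D.vCoord x) = -Real.pi := by
    rw [D.inv_angle, TwistData.angle, hu, hv]
    change -deriv Θ _ = _
    rw [zero_pow two_ne_zero, add_zero, hΘ3]
  refine ⟨D, rfl, rfl, hDy, D.inv.twist x, D.twist_inv_twist x, ?_⟩
  have h1 : D.sCoord (D.inv.twist x) = D.inv.sImage x := D.inv.sCoord_twist x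
  rw [h1, hsy D rfl rfl]
  change (sx + sy) / 2 + a * D.inv.rotU (D.uCoord x) (D.vCoord x) = sy
  rw [TwistData.rotU, hang, hv, Real.cos_neg, Real.cos_pi, hu]
  field_simp
  ring

/-- The linear flow `(e^{it} z₁, e^{iαt} z₂)`. -/
noncomputable def rotFlow (α t : ℝ) (x : R4) : R4 := ofComplex
  (Complex.exp (t * Complex.I) * zOne x, Complex.exp ((α * t : ℝ) * Complex.I) * zTwo x)

theorem exists_rotation {z w : ℂ} (h : Complex.normSq z = Complex.normSq w) :
    ∃ θ : ℝ, Complex.exp (θ * Complex.I) * z = w := by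
  have hn : ‖z‖ = ‖w‖ := by
    rw [Complex.normSq_eq_norm_sq, Complex.normSq_eq_norm_sq] at h
    exact (sq_eq_sq₀ (norm_nonneg _) (norm_nonneg _)).1 h
  refine ⟨Complex.arg w - Complex.arg z, ?_⟩
  nth_rewrite 2 [← Complex.norm_mul_exp_arg_mul_I z]
  nth_rewrite 2 [← Complex.norm_mul_exp_arg_mul_I w]
  rw [mul_left_comm, ← Complex.exp_add, hn]
  congr 2
  push_cast
  ring

theorem exp_add_two_pi_mul (θ : ℝ) (k : ℤ) :
    Complex.exp ((θ + 2 * Real.pi * k : ℝ) * Complex.I) = Complex.exp (θ * Complex.I) := by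
  have : ((θ + 2 * Real.pi * k : ℝ) * Complex.I : ℂ) =
      θ * Complex.I + k * (2 * Real.pi * Complex.I) := by push_cast; ring
  rw [this, Complex.exp_add, Complex.exp_int_mul_two_pi_mul_I, mul_one]

/-- Two points of the same torus are connected by a linear flow whose slope is arbitrarily close to
a given one: the connection takes a long time, and the slope is adjusted so that both phases match.
-/
theorem exists_rotFlow_eq {x y : R4} (h1 : Complex.normSq (zOne x) = Complex.normSq (zOne y))
    (h2 : Complex.normSq (zTwo x) = Complex.normSq (zTwo y)) (β : ℝ) {ε : ℝ} (hε : 0 < ε) :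
    ∃ α, |α - β| < ε ∧ ∃ t, 0 ≤ t ∧ rotFlow α t x = y := by
  obtain ⟨θ₁, hθ₁⟩ := exists_rotation h1
  obtain ⟨θ₂, hθ₂⟩ := exists_rotation h2
  have hpi := Real.pi_pos
  set B := |θ₂| + 2 * Real.pi with hB
  obtain ⟨m, hm⟩ := exists_nat_gt (|θ₁| + B / ε)
  set t := θ₁ + 2 * Real.pi * ((m : ℤ) : ℝ) with ht
  have htB : B / ε < t := by
    have h3 : (m : ℝ) ≤ 2 * Real.pi * m := by nlinarith [Real.pi_gt_three, m.cast_nonneg (α := ℝ)]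
    have h4 := neg_abs_le θ₁
    simp only [ht, Int.cast_natCast]
    linarith
  have ht0 : 0 < t := lt_trans (by positivity) htB
  -- the phase of `z₂` is corrected by at most `B`, so the slope changes by at most `B / t`
  set k := ⌊β * t / (2 * Real.pi)⌋ with hk
  have hk1 : 2 * Real.pi * k ≤ β * t := by
    have := Int.floor_le (β * t / (2 * Real.pi))
    rw [← hk, le_div_iff₀ (by positivity)] at this
    linarith
  have hk2 : β * t < 2 * Real.pi * k + 2 * Real.pi := by
    have := Int.lt_floor_add_one (β * t / (2 * Real.pi))
    rw [← hk, div_lt_iff₀ (by positivity)] at this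
    linarith
  refine ⟨(θ₂ + 2 * Real.pi * k) / t, ?_, t, ht0.le, ?_⟩
  · have h5 : (θ₂ + 2 * Real.pi * k) / t - β = (θ₂ + 2 * Real.pi * k - β * t) / t := by
      field_simp
    rw [h5, abs_div, abs_of_pos ht0, div_lt_iff₀ ht0]
    have h6 : |θ₂ + 2 * Real.pi * k - β * t| ≤ B :=
      abs_le.2 ⟨by linarith [neg_abs_le θ₂], by linarith [le_abs_self θ₂]⟩
    rw [div_lt_iff₀ hε] at htB
    linarith
  · refine ext_complex ?_ ?_
    · rw [rotFlow, zOne_ofComplex, ht, exp_add_two_pi_mul, hθ₁]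
    · rw [rotFlow, zTwo_ofComplex, div_mul_cancel₀ _ ht0.ne']
      exact (congrArg (· * zTwo x) (exp_add_two_pi_mul θ₂ k)).trans hθ₂

/-- A nonempty open set contains a point off the coordinate planes. -/
theorem exists_mem_coord_ne_zero {C : Set R4} (hC : IsOpen C) (hne : C.Nonempty) :
    ∃ x ∈ C, zOne x ≠ 0 ∧ zTwo x ≠ 0 := by
  obtain ⟨x, hx⟩ := hne
  have hc : Continuous fun ε : ℝ => x + ε • ofComplex (1, 1) := by fun_prop
  have h0 : ∀ᶠ ε : ℝ in 𝓝[>] 0, x + ε • ofComplex (1, 1) ∈ C :=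
    nhdsWithin_le_nhds ((hc.continuousAt (x := 0)).eventually (hC.mem_nhds (by simpa using hx)))
  have h1 : ∀ z : ℂ, ∀ᶠ ε : ℝ in 𝓝[>] 0, z + ε ≠ 0 := by
    intro z
    by_cases hz : z = 0
    · filter_upwards [self_mem_nhdsWithin] with ε hε
      rw [hz, zero_add]
      exact_mod_cast (ne_of_gt hε)
    · have hc' : Continuous fun ε : ℝ => z + (ε : ℂ) := by fun_prop
      exact nhdsWithin_le_nhds ((hc'.continuousAt (x := 0)).eventually
        (isOpen_compl_singleton.mem_nhds (by simpa using hz)))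
  obtain ⟨ε, h2, h3, h4⟩ := (h0.and ((h1 (zOne x)).and (h1 (zTwo x)))).exists
  exact ⟨_, h2, by simpa using h3, by simpa using h4⟩

/-- A small rotation of `z₁` moves a point to one with a different angle `χ`. -/
theorem exists_mem_arg_ne_zero {C : Set R4} (hC : IsOpen C) {y : R4} (hy : y ∈ C)
    (hy1 : zOne y ≠ 0) (hy2 : zTwo y ≠ 0) {p : ℕ} (hp : 0 < p) (q : ℕ) {w : ℂ} (hw : w ≠ 0) :
    ∃ y' ∈ C, zOne y' ≠ 0 ∧ zTwo y' ≠ 0 ∧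
      Complex.arg (w * (zOne y' ^ p * star (zTwo y') ^ q)) ≠ 0 := by
  by_cases h : Complex.arg (w * (zOne y ^ p * star (zTwo y) ^ q)) = 0
  swap
  · exact ⟨y, hy, hy1, hy2, h⟩
  set W := w * (zOne y ^ p * star (zTwo y) ^ q) with hW
  have hWn : 0 < ‖W‖ := norm_pos_iff.2
    (mul_ne_zero hw (mul_ne_zero (pow_ne_zero _ hy1) (pow_ne_zero _ (star_ne_zero.2 hy2))))
  have hWe : W = (‖W‖ : ℂ) := by
    have := Complex.norm_mul_exp_arg_mul_I W
    rw [h] at this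
    simpa using this.symm
  have hp' : (0 : ℝ) < p := Nat.cast_pos.2 hp
  have hc : Continuous fun θ : ℝ => ofComplex (Complex.exp (θ * Complex.I) * zOne y, zTwo y) := by
    fun_prop
  have h0 : ∀ᶠ θ : ℝ in 𝓝[>] 0,
      ofComplex (Complex.exp (θ * Complex.I) * zOne y, zTwo y) ∈ C :=
    nhdsWithin_le_nhds ((hc.continuousAt (x := 0)).eventually (hC.mem_nhds (by simpa using hy)))
  have h1 : ∀ᶠ θ : ℝ in 𝓝[>] 0, θ < Real.pi / p :=
    nhdsWithin_le_nhds (gt_mem_nhds (by positivity))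
  obtain ⟨θ, h2, h3, h4⟩ := (h0.and (h1.and self_mem_nhdsWithin)).exists
  have h4' : 0 < θ := h4
  refine ⟨_, h2, ?_, ?_, ?_⟩
  · rw [zOne_ofComplex]; exact mul_ne_zero (Complex.exp_ne_zero _) hy1
  · rw [zTwo_ofComplex]; exact hy2
  · have h5 : w * (zOne (ofComplex (Complex.exp (θ * Complex.I) * zOne y, zTwo y)) ^ p *
        star (zTwo (ofComplex (Complex.exp (θ * Complex.I) * zOne y, zTwo y))) ^ q) =
        (‖W‖ : ℂ) * Complex.exp ((p * θ : ℝ) * Complex.I) := by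
      rw [zOne_ofComplex, zTwo_ofComplex, ← hWe, hW, mul_pow, ← Complex.exp_nat_mul]
      push_cast
      ring_nf
    have h6 : p * θ < Real.pi := by rwa [lt_div_iff₀ hp', mul_comm] at h3
    have h7 : 0 < p * θ := by positivity
    rw [h5, Complex.arg_real_mul _ hWn, Complex.arg_exp_mul_I, (toIocMod_eq_self _).2]
    · exact h7.ne'
    · constructor <;> linarith [Real.pi_pos]

/-- Given two open cones, some twist map of slope close to `α` conjugates linear flows, of slopes
arbitrarily close to that of the twist map, to flows with an orbit connecting the two cones. -/
theorem exists_twist_connecting {C C' : Set R4} (hC : IsOpen C) (hne : C.Nonempty)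
    (hC' : IsOpen C') (hne' : C'.Nonempty) (hcone : IsCone C') {α ε : ℝ} (hα : 0 < α)
    (hε : 0 < ε) : ∃ D : TwistData, |D.slope - α| < ε ∧ ∀ ε' > 0, ∃ α', |α' - D.slope| < ε' ∧
      ∃ x ≠ 0, D.twist x ∈ C ∧ ∃ t, 0 ≤ t ∧ D.twist (rotFlow α' t x) ∈ C' := by
  obtain ⟨p, q, hp, hq, hpq⟩ : ∃ p q : ℕ, 0 < p ∧ 0 < q ∧ |(p : ℝ) / q - α| < ε := by
    obtain ⟨r, hr1, hr2⟩ := exists_rat_btwn (show α < α + ε by linarith)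
    have hr : 0 < r := by exact_mod_cast hα.trans hr1
    refine ⟨r.num.natAbs, r.den, Int.natAbs_pos.2 (Rat.num_pos.2 hr).ne', r.pos, ?_⟩
    have h1 : ((r.num.natAbs : ℕ) : ℝ) / r.den = r := by
      rw [Nat.cast_natAbs, abs_of_pos (Rat.num_pos.2 hr)]
      exact (Rat.cast_def r).symm
    rw [h1, abs_lt]
    constructor <;> linarith
  obtain ⟨x, hx, hx1, hx2⟩ := exists_mem_coord_ne_zero hC hne
  obtain ⟨y₀, hy₀, hy₁, hy₂⟩ := exists_mem_coord_ne_zero hC' hne'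
  obtain ⟨y, hy, hy1, hy2, harg⟩ := exists_mem_arg_ne_zero hC' hy₀ hy₁ hy₂ hp q
    (inv_ne_zero (mul_ne_zero (pow_ne_zero p hx1) (pow_ne_zero q (star_ne_zero.2 hx2))))
  obtain ⟨D, hDp, hDq, hDy, x', hDx, hs⟩ := exists_twist hp hq hx1 hx2 hy1 hy2 harg
  have hβ : D.slope = p / q := by rw [TwistData.slope, hDp, hDq]
  refine ⟨D, by rwa [hβ], fun ε' hε' => ?_⟩
  have hx'0 : x' ≠ 0 := by
    rintro rfl
    have h1 := D.energy_twist 0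
    rw [hDx, D.energy_zero] at h1
    exact (D.energy_pos (x := x) (by rintro rfl; simp at hx1)).ne' h1
  have hEx := D.energy_pos hx'0
  have hy0 : y ≠ 0 := by rintro rfl; simp at hy1
  have hEy := D.energy_pos hy0
  -- rescale the target point to the energy of the source
  set r := √(D.energy x' / D.energy y) with hr
  have hr0 : 0 < r := Real.sqrt_pos.2 (div_pos hEx hEy)
  have hr2 : r * r = D.energy x' / D.energy y := Real.mul_self_sqrt (div_pos hEx hEy).le
  have hE : D.energy (r • y) = D.energy x' := by
    have : D.energy (r • y) = r * r * D.energy y := by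
      simp only [TwistData.energy, map_smul, Complex.real_smul, map_mul, Complex.normSq_ofReal]
      ring
    rw [this, hr2, div_mul_cancel₀ _ hEy.ne']
  have hs' : D.sCoord x' = D.sCoord (r • y) := by rw [hs, D.sCoord_smul hr0]
  have e1 : Complex.normSq (zOne x') = Complex.normSq (zOne (r • y)) := by
    rw [← D.sCoord_mul_energy, ← D.sCoord_mul_energy, hs', hE]
  have e2 : Complex.normSq (zTwo x') = Complex.normSq (zTwo (r • y)) := by
    refine mul_left_cancel₀ D.slope_pos.ne' ?_
    rw [← D.one_sub_sCoord_mul_energy, ← D.one_sub_sCoord_mul_energy, hs', hE]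
  obtain ⟨α', hα', t, ht, hflow⟩ := exists_rotFlow_eq e1 e2 D.slope hε'
  refine ⟨α', hα', x', hx'0, by rwa [hDx], t, ht, ?_⟩
  rw [hflow, D.twist_smul hr0, hDy]
  exact hcone y hy r hr0

/-! ### Homogeneous contact symmetries -/

/-- A diffeomorphism of `ℝ⁴ ∖ {0}` that commutes with dilations and preserves `λ`, extended by `0`
at the origin. -/
structure ContactSymm where
  /-- the map -/
  toFun : R4 → R4
  /-- its inverse -/
  invFun : R4 → R4
  left_inv : ∀ x, invFun (toFun x) = x
  right_inv : ∀ x, toFun (invFun x) = x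
  smooth : ∀ x, x ≠ 0 → ContDiffAt ℝ ∞ toFun x
  smooth_inv : ∀ x, x ≠ 0 → ContDiffAt ℝ ∞ invFun x
  smul : ∀ r : ℝ, 0 < r → ∀ x, toFun (r • x) = r • toFun x
  liouville : ∀ x, x ≠ 0 → ∀ v, liouvilleForm (toFun x) (fderiv ℝ toFun x v) = liouvilleForm x v

theorem HasDerivAt.symplecticForm {A B : ℝ → R4} {A' B' : R4} {t : ℝ} (hA : HasDerivAt A A' t)
    (hB : HasDerivAt B B' t) : HasDerivAt (fun t => symplecticForm (A t) (B t))
      (symplecticForm A' (B t) + symplecticForm (A t) B') t := by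
  have a : ∀ i, HasDerivAt (fun t => A t i) (A' i) t := fun i =>
    (EuclideanSpace.proj i : R4 →L[ℝ] ℝ).hasFDerivAt.comp_hasDerivAt t hA
  have b : ∀ i, HasDerivAt (fun t => B t i) (B' i) t := fun i =>
    (EuclideanSpace.proj i : R4 →L[ℝ] ℝ).hasFDerivAt.comp_hasDerivAt t hB
  refine ((((a 0).fun_mul (b 1)).fun_sub ((a 1).fun_mul (b 0))).fun_add
    (((a 2).fun_mul (b 3)).fun_sub ((a 3).fun_mul (b 2)))).congr_deriv ?_
  simp only [_root_.symplecticForm]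
  ring

namespace ContactSymm

/-- The identity. -/
noncomputable def refl : ContactSymm where
  toFun := id
  invFun := id
  left_inv _ := rfl
  right_inv _ := rfl
  smooth _ _ := contDiffAt_id
  smooth_inv _ _ := contDiffAt_id
  smul _ _ _ := rfl
  liouville x _ v := by rw [fderiv_id]; rfl

variable (S : ContactSymm)

theorem inv_smul {r : ℝ} (hr : 0 < r) (x : R4) : S.invFun (r • x) = r • S.invFun x := by
  rw [← S.left_inv (r • S.invFun x), S.smul r hr, S.right_inv]

theorem map_zero' : S.toFun 0 = 0 := by
  have h := S.smul 2 two_pos 0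
  rw [smul_zero, two_smul] at h
  simpa using h

theorem ne_zero {x : R4} (hx : x ≠ 0) : S.toFun x ≠ 0 := fun h => hx <| by
  rw [← S.left_inv x, h]; nth_rewrite 1 [← S.map_zero']; exact S.left_inv 0

theorem inv_ne_zero {x : R4} (hx : x ≠ 0) : S.invFun x ≠ 0 := fun h => hx <| by
  rw [← S.right_inv x, h, S.map_zero']

/-- Composition of symmetries, first a twist map and then `S`. -/
noncomputable def compTwist (D : TwistData) : ContactSymm where
  toFun x := S.toFun (D.twist x)
  invFun x := D.inv.twist (S.invFun x)
  left_inv x := by rw [S.left_inv, D.inv_twist_twist]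
  right_inv x := by rw [D.twist_inv_twist, S.right_inv]
  smooth x hx := (S.smooth _ (D.twist_ne_zero hx)).comp x (D.contDiffAt_twist hx)
  smooth_inv x hx := (D.inv.contDiffAt_twist (S.inv_ne_zero hx)).comp x (S.smooth_inv x hx)
  smul r hr x := by rw [D.twist_smul hr, S.smul r hr]
  liouville x hx v := by
    have h1 := ((S.smooth _ (D.twist_ne_zero hx)).differentiableAt (by simp)).hasFDerivAt
    have h2 := ((D.contDiffAt_twist hx).differentiableAt (by simp)).hasFDerivAt
    have h3 := (h1.comp x h2).fderiv
    change liouvilleForm _ (fderiv ℝ (S.toFun ∘ D.twist) x v) = _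
    rw [h3]
    change liouvilleForm _ (fderiv ℝ S.toFun (D.twist x) (fderiv ℝ D.twist x v)) = _
    rw [S.liouville _ (D.twist_ne_zero hx), D.liouvilleForm_fderiv_twist hx]

/-- Preserving `λ` implies preserving `ω = dλ`, by the symmetry of second derivatives. -/
theorem symplecticForm_fderiv {x : R4} (hx : x ≠ 0) (v w : R4) :
    symplecticForm (fderiv ℝ S.toFun x v) (fderiv ℝ S.toFun x w) = symplecticForm v w := by
  have hd : DifferentiableAt ℝ (fderiv ℝ S.toFun) x :=
    ((S.smooth x hx).fderiv_right (m := ∞) (by simp)).differentiableAt (by simp)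
  have key : ∀ v w, symplecticForm (fderiv ℝ S.toFun x v) (fderiv ℝ S.toFun x w) +
      symplecticForm (S.toFun x) (fderiv ℝ (fderiv ℝ S.toFun) x v w) = symplecticForm v w := by
    intro v w
    have hline : HasDerivAt (fun t : ℝ => x + t • v) v 0 := by
      simpa using ((hasDerivAt_id (0 : ℝ)).smul_const v).const_add x
    have h0 : x + (0 : ℝ) • v = x := by simp
    have hA : HasDerivAt (fun t : ℝ => S.toFun (x + t • v)) (fderiv ℝ S.toFun x v) 0 := by
      have h1 : HasFDerivAt S.toFun (fderiv ℝ S.toFun x) (x + (0 : ℝ) • v) := by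
        rw [h0]; exact ((S.smooth x hx).differentiableAt (by simp)).hasFDerivAt
      exact h1.comp_hasDerivAt (0 : ℝ) hline
    have hB : HasDerivAt (fun t : ℝ => fderiv ℝ S.toFun (x + t • v) w)
        (fderiv ℝ (fderiv ℝ S.toFun) x v w) 0 := by
      have h1 : HasFDerivAt (fderiv ℝ S.toFun) (fderiv ℝ (fderiv ℝ S.toFun) x)
          (x + (0 : ℝ) • v) := by
        rw [h0]; exact hd.hasFDerivAt
      have h2 : HasDerivAt (fun t : ℝ => fderiv ℝ S.toFun (x + t • v))
          (fderiv ℝ (fderiv ℝ S.toFun) x v) 0 := h1.comp_hasDerivAt (0 : ℝ) hline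
      simpa using h2.clm_apply (hasDerivAt_const (0 : ℝ) w)
    have h1 := hA.symplecticForm hB
    have h2 : HasDerivAt (fun t : ℝ => symplecticForm (x + t • v) w) (symplecticForm v w) 0 := by
      have := hline.symplecticForm (hasDerivAt_const (0 : ℝ) w)
      refine this.congr_deriv ?_
      simp [_root_.symplecticForm]
    have h3 : (fun t : ℝ => symplecticForm (x + t • v) w) =ᶠ[𝓝 0]
        fun t : ℝ => symplecticForm (S.toFun (x + t • v)) (fderiv ℝ S.toFun (x + t • v) w) := by
      have hc : ContinuousAt (fun t : ℝ => x + t • v) 0 := hline.continuousAt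
      filter_upwards [hc.eventually (isOpen_compl_singleton.mem_nhds
        (show x + (0 : ℝ) • v ∈ ({0}ᶜ : Set R4) by rwa [h0]))] with t ht
      have := S.liouville (x + t • v) ht w
      rw [liouvilleForm_eq, liouvilleForm_eq] at this
      linarith
    have h4 := h2.unique (h1.congr_of_eventuallyEq h3)
    simpa [h0] using h4.symm
  have hsymm : fderiv ℝ (fderiv ℝ S.toFun) x v w = fderiv ℝ (fderiv ℝ S.toFun) x w v :=
    (S.smooth x hx).isSymmSndFDerivAt
    (by
      rw [minSmoothness_of_isRCLikeNormedField]
      exact WithTop.coe_le_coe.2 (le_top : (2 : ℕ∞) ≤ ⊤)) v w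
  have k1 := key v w
  have k2 := key w v
  rw [← hsymm, symplecticForm_swap, symplecticForm_swap w v] at k2
  linarith

/-- Symmetries conjugate Hamiltonian vector fields. -/
theorem hamVec_comp_inv {F : R4 → ℝ} {x : R4} (hx : x ≠ 0) (hF : DifferentiableAt ℝ F x) :
    hamVec (F ∘ S.invFun) (S.toFun x) = fderiv ℝ S.toFun x (hamVec F x) := by
  have hy := S.ne_zero hx
  have h1 : HasFDerivAt S.toFun (fderiv ℝ S.toFun x) (S.invFun (S.toFun x)) := by
    rw [S.left_inv]; exact ((S.smooth x hx).differentiableAt (by simp)).hasFDerivAt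
  have h2 : HasFDerivAt S.invFun (fderiv ℝ S.invFun (S.toFun x)) (S.toFun x) :=
    ((S.smooth_inv _ hy).differentiableAt (by simp)).hasFDerivAt
  have h3 : ∀ w, fderiv ℝ S.toFun x (fderiv ℝ S.invFun (S.toFun x) w) = w := by
    intro w
    have h4 := h1.comp (S.toFun x) h2
    have h5 : S.toFun ∘ S.invFun = id := funext S.right_inv
    rw [h5] at h4
    exact congrArg (fun L : R4 →L[ℝ] R4 => L w) (h4.unique (hasFDerivAt_id _))
  have hF' : HasFDerivAt F (fderiv ℝ F x) (S.invFun (S.toFun x)) := by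
    rw [S.left_inv]; exact hF.hasFDerivAt
  refine eq_of_symplecticForm_left fun w => ?_
  rw [symplecticForm_hamVec, (hF'.comp _ h2).fderiv]
  nth_rewrite 2 [← h3 w]
  rw [S.symplecticForm_fderiv hx, symplecticForm_hamVec]
  rfl

end ContactSymm

/-! ### One step of the approximation by conjugation -/

/-- The quadratic Hamiltonian `(|z₁|² + α |z₂|²) / 2`. -/
noncomputable def ellipsoid (α : ℝ) (x : R4) : ℝ :=
  (Complex.normSq (zOne x) + α * Complex.normSq (zTwo x)) / 2

theorem contDiff_ellipsoid (α : ℝ) : ContDiff ℝ ∞ (ellipsoid α) :=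
  ((contDiff_normSq.comp zOne.contDiff).add
    (contDiff_const.mul (contDiff_normSq.comp zTwo.contDiff))).div_const _

theorem ellipsoid_smul (α r : ℝ) (x : R4) : ellipsoid α (r • x) = r ^ 2 * ellipsoid α x := by
  simp only [ellipsoid, map_smul, Complex.real_smul, map_mul, Complex.normSq_ofReal]; ring

theorem ellipsoid_pos {α : ℝ} (hα : 0 < α) {x : R4} (hx : x ≠ 0) : 0 < ellipsoid α x := by
  have h1 := Complex.normSq_nonneg (zOne x)
  have h2 := Complex.normSq_nonneg (zTwo x)
  rcases h1.lt_or_eq with h | h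
  · unfold ellipsoid; positivity
  · have h3 : zTwo x ≠ 0 := fun h' => hx (ext_complex
      (by rw [Complex.normSq_eq_zero.1 h.symm, map_zero]) (by rw [h', map_zero]))
    have := Complex.normSq_pos.2 h3
    unfold ellipsoid; positivity

theorem ellipsoid_one (x : R4) : ellipsoid 1 x = ‖x‖ ^ 2 / 2 := by
  rw [ellipsoid, norm_sq_eq_complex, one_mul]

theorem hamVec_ellipsoid (α : ℝ) (x : R4) :
    hamVec (ellipsoid α) x = ofComplex (Complex.I * zOne x, α * (Complex.I * zTwo x)) := by
  have h : HasFDerivAt (ellipsoid α) ((2 : ℝ)⁻¹ • ((2 • (innerSL ℝ (zOne x)).comp zOne) +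
      α • (2 • (innerSL ℝ (zTwo x)).comp zTwo))) x := by
    have h1 := ((zOne.hasFDerivAt (x := x)).norm_sq.add
      ((zTwo.hasFDerivAt (x := x)).norm_sq.const_mul α)).const_mul (2 : ℝ)⁻¹
    refine h1.congr_of_eventuallyEq (Filter.Eventually.of_forall fun y => ?_)
    simp only [ellipsoid, Complex.normSq_eq_norm_sq, Pi.add_apply]
    ring
  refine eq_of_symplecticForm_left fun w => ?_
  rw [symplecticForm_hamVec, h.fderiv]
  simp [symplecticForm, ofComplex, zOne_apply, zTwo_apply, Complex.inner]
  ring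

theorem isHamTrajectory_rotFlow (α : ℝ) {x : R4} (hx : x ≠ 0) :
    IsHamTrajectory (ellipsoid α) fun t => rotFlow α t x := by
  intro t
  constructor
  · intro h
    refine hx (ext_complex ?_ ?_)
    · have := congrArg zOne h
      simpa [rotFlow] using this
    · have := congrArg zTwo h
      simpa [rotFlow] using this
  · have e1 : HasDerivAt (fun t : ℝ => Complex.exp (t * Complex.I) * zOne x)
        (Complex.exp (t * Complex.I) * (1 * Complex.I) * zOne x) t :=
      (((hasDerivAt_id t).ofReal_comp.mul_const Complex.I).cexp).mul_const _
    have e2 : HasDerivAt (fun t : ℝ => Complex.exp ((α * t : ℝ) * Complex.I) * zTwo x)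
        (Complex.exp ((α * t : ℝ) * Complex.I) * ((α * 1 : ℝ) * Complex.I) * zTwo x) t :=
      ((((hasDerivAt_id t).const_mul α).ofReal_comp.mul_const Complex.I).cexp).mul_const _
    have h := ofComplex.hasFDerivAt.comp_hasDerivAt t (e1.prodMk e2)
    refine h.congr_deriv ?_
    change _ = hamVec (ellipsoid α) (rotFlow α t x)
    rw [hamVec_ellipsoid, rotFlow, zOne_ofComplex, zTwo_ofComplex]
    congr 2
    · ring
    · push_cast; ring

namespace ContactSymm

variable (S : ContactSymm)

/-- The Hamiltonian `(|z₁|² + α |z₂|²) / 2` in the coordinates given by `S`. -/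
noncomputable def ham (α : ℝ) : R4 → ℝ := ellipsoid α ∘ S.invFun

theorem contDiffOn_inv : ContDiffOn ℝ ∞ S.invFun {0}ᶜ := fun x hx =>
  (S.smooth_inv x hx).contDiffWithinAt

theorem isHomogHam_ham {α : ℝ} (hα : 0 < α) : IsHomogHam (S.ham α) where
  smooth := (contDiff_ellipsoid α).comp_contDiffOn S.contDiffOn_inv
  homog r hr x := by
    simp only [ham, Function.comp]
    rw [S.inv_smul hr, ellipsoid_smul]
  pos x hx := ellipsoid_pos hα (S.inv_ne_zero hx)

theorem isHamTrajectory_ham {α : ℝ} {c : ℝ → R4} (hc : IsHamTrajectory (ellipsoid α) c) :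
    IsHamTrajectory (S.ham α) fun t => S.toFun (c t) := by
  intro t
  obtain ⟨h1, h2⟩ := hc t
  refine ⟨S.ne_zero h1, ?_⟩
  rw [ham, S.hamVec_comp_inv h1 ((contDiff_ellipsoid α).differentiable (by simp) _)]
  exact ((S.smooth _ h1).differentiableAt (by simp)).hasFDerivAt.comp_hasDerivAt t h2

/-- The Hamiltonian `|z₂|² / 2` in the coordinates given by `S`, which is the derivative of `S.ham
α` with respect to `α`. -/
noncomputable def slopeDeriv : R4 → ℝ := fun x => Complex.normSq (zTwo (S.invFun x)) / 2

theorem contDiffOn_slopeDeriv : ContDiffOn ℝ ∞ S.slopeDeriv {0}ᶜ :=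
  ((contDiff_normSq.comp zTwo.contDiff).comp_contDiffOn S.contDiffOn_inv).div_const _

theorem cutOff_ham_sub (α β : ℝ) :
    cutOff (S.ham α) - cutOff (S.ham β) = (α - β) • cutOff S.slopeDeriv := by
  funext x
  simp only [cutOff, ham, slopeDeriv, ellipsoid, Pi.sub_apply, Pi.smul_apply, smul_eq_mul,
    Function.comp]
  ring

theorem ham_compTwist (D : TwistData) : (S.compTwist D).ham D.slope = S.ham D.slope := by
  funext x
  change D.energy (D.inv.twist (S.invFun x)) / 2 = D.energy (S.invFun x) / 2
  rw [show D.energy (D.inv.twist (S.invFun x)) = D.energy (S.invFun x) from D.inv.energy_twist _]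

end ContactSymm

/-- A smooth function with compact support has bounded derivatives. -/
theorem exists_iteratedFDeriv_bound {f : R4 → ℝ} (hf : ContDiff ℝ ∞ f) (hs : HasCompactSupport f)
    (k : ℕ) : ∃ M : ℝ, 0 < M ∧ ∀ j ≤ k, ∀ x, ‖iteratedFDeriv ℝ j f x‖ ≤ M := by
  have h : ∀ j : ℕ, ∃ M : ℝ, ∀ x, ‖iteratedFDeriv ℝ j f x‖ ≤ M := fun j =>
    (hs.iteratedFDeriv j).exists_bound_of_continuous
      (hf.continuous_iteratedFDeriv (by exact_mod_cast le_top))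
  choose M hM using h
  refine ⟨∑ j ∈ Finset.range (k + 1), |M j| + 1, by positivity, fun j hj x => ?_⟩
  have h1 := Finset.single_le_sum (f := fun j => |M j|) (fun i _ => abs_nonneg _)
    (Finset.mem_range.2 (Nat.lt_succ_of_le hj))
  linarith [hM j x, le_abs_self (M j)]

theorem exists_slope_bound (S : ContactSymm) (k : ℕ) {δ : ℝ} (hδ : 0 < δ) :
    ∃ ε > 0, ∀ α β : ℝ, |α - β| < ε → ∀ j ≤ k, ∀ x,
      ‖iteratedFDeriv ℝ j (cutOff (S.ham α) - cutOff (S.ham β)) x‖ ≤ δ := by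
  obtain ⟨M, hM0, hM⟩ := exists_iteratedFDeriv_bound (contDiff_cutOff S.contDiffOn_slopeDeriv)
    (hasCompactSupport_cutOff _) k
  refine ⟨δ / M, div_pos hδ hM0, fun α β hαβ j hj x => ?_⟩
  rw [S.cutOff_ham_sub, iteratedFDeriv_const_smul_apply
    ((contDiff_cutOff S.contDiffOn_slopeDeriv).contDiffAt.of_le (by exact_mod_cast le_top)),
    norm_smul, Real.norm_eq_abs]
  calc |α - β| * _ ≤ δ / M * M := mul_le_mul hαβ.le (hM j hj x) (norm_nonneg _) (by positivity)
    _ = δ := div_mul_cancel₀ _ hM0.ne'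

/-- A `C^k`-small change of a Hamiltonian conjugate to a quadratic one produces another such
Hamiltonian with an orbit that connects two given open cones. -/
theorem ContactSymm.exists_connecting (S : ContactSymm) {α : ℝ} (hα : 0 < α) {C C' : Set R4}
    (hC : IsOpen C) (hne : C.Nonempty) (hC' : IsOpen C') (hne' : C'.Nonempty) (hcone : IsCone C')
    (k : ℕ) {δ : ℝ} (hδ : 0 < δ) :
    ∃ (S' : ContactSymm) (α' : ℝ), 0 < α' ∧ Connects (S'.ham α') C C' ∧ ∀ j ≤ k, ∀ x,
      ‖iteratedFDeriv ℝ j (cutOff (S'.ham α') - cutOff (S.ham α)) x‖ ≤ δ := by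
  have hcont : ContinuousOn S.toFun {0}ᶜ := fun x hx =>
    (S.smooth x hx).continuousAt.continuousWithinAt
  have hpre : ∀ O : Set R4, IsOpen O → O.Nonempty →
      IsOpen ({0}ᶜ ∩ S.toFun ⁻¹' O) ∧ ({0}ᶜ ∩ S.toFun ⁻¹' O).Nonempty := by
    intro O hO hOne
    obtain ⟨y, hy, hy1, -⟩ := exists_mem_coord_ne_zero hO hOne
    refine ⟨hcont.isOpen_inter_preimage isOpen_compl_singleton hO, S.invFun y,
      S.inv_ne_zero (by rintro rfl; simp at hy1), ?_⟩
    rwa [Set.mem_preimage, S.right_inv]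
  obtain ⟨ho, hn⟩ := hpre C hC hne
  obtain ⟨ho', hn'⟩ := hpre C' hC' hne'
  have hcone' : IsCone ({0}ᶜ ∩ S.toFun ⁻¹' C') := fun x hx r hr =>
    ⟨smul_ne_zero hr.ne' hx.1, by
      rw [Set.mem_preimage, S.smul r hr]; exact hcone _ hx.2 r hr⟩
  -- the slope changes twice: from `α` to that of the twist map, before the latter is inserted, and
  -- then to `α'`; how small the second change has to be depends on the twist map
  obtain ⟨ε, hε, hS⟩ := exists_slope_bound S k (half_pos hδ)
  obtain ⟨D, hD, hconn⟩ := exists_twist_connecting ho hn ho' hn' hcone' hα hε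
  obtain ⟨ε', hε', hS'⟩ := exists_slope_bound (S.compTwist D) k (half_pos hδ)
  obtain ⟨α', hα', x, hx, hx1, t, ht, hx2⟩ := hconn (min ε' D.slope) (lt_min hε' D.slope_pos)
  have hα'0 : 0 < α' := by
    have := (abs_lt.1 (hα'.trans_le (min_le_right _ _))).1
    linarith
  refine ⟨S.compTwist D, α', hα'0, ⟨_, (S.compTwist D).isHamTrajectory_ham
    (isHamTrajectory_rotFlow α' hx), ?_, t, ht, hx2.2⟩, fun j hj y => ?_⟩
  · have : rotFlow α' 0 x = x := by simp [rotFlow]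
    change S.toFun (D.twist (rotFlow α' 0 x)) ∈ C
    rw [this]
    exact hx1.2
  · have e1 : cutOff ((S.compTwist D).ham α') - cutOff (S.ham α) =
        (cutOff ((S.compTwist D).ham α') - cutOff ((S.compTwist D).ham D.slope)) +
          (cutOff (S.ham D.slope) - cutOff (S.ham α)) := by
      rw [S.ham_compTwist]; abel
    have hsm : ∀ (T : ContactSymm) (a b : ℝ),
        ContDiffAt ℝ j (cutOff (T.ham a) - cutOff (T.ham b)) y := fun T a b => by
      have h : ContDiffAt ℝ j (cutOff T.slopeDeriv) y :=
        (contDiff_cutOff T.contDiffOn_slopeDeriv).contDiffAt.of_le (by exact_mod_cast le_top)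
      rw [T.cutOff_ham_sub]
      exact h.const_smul (a - b)
    rw [e1, iteratedFDeriv_add_apply (hsm _ _ _) (hsm _ _ _)]
    refine (norm_add_le _ _).trans ?_
    have h1 := hS' α' D.slope (hα'.trans_le (min_le_left _ _)) j hj y
    have h2 := hS D.slope α hD j hj y
    linarith

/-! ### The limit Hamiltonian -/

theorem isPinched_of_sphere {K : R4 → ℝ} (h0 : K 0 = 0)
    (hK : ∀ r : ℝ, 0 < r → ∀ x, K (r • x) = r ^ 2 * K x)
    (h : ∀ u : R4, ‖u‖ = 1 → |K u - 1 / 2| ≤ 1 / 4) : IsPinched K := by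
  intro x
  by_cases hx : x = 0
  · simp [hx, h0]
  have hn : 0 < ‖x‖ := norm_pos_iff.2 hx
  have hu : ‖‖x‖⁻¹ • x‖ = 1 := by rw [norm_smul, norm_inv, norm_norm, inv_mul_cancel₀ hn.ne']
  have h1 := abs_le.1 (h _ hu)
  have h2 : K x = ‖x‖ ^ 2 * K (‖x‖⁻¹ • x) := by
    rw [← hK _ hn, smul_inv_smul₀ hn.ne']
  rw [h2]
  constructor <;> nlinarith [sq_nonneg ‖x‖]

/-- Telescoping estimate for a sequence with geometrically decreasing increments. -/
theorem norm_sub_le_of_halving {E : Type*} [SeminormedAddCommGroup E] {f : ℕ → E} {δ : ℕ → ℝ}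
    (h0 : ∀ n, 0 < δ n) (hδ : ∀ n, δ (n + 1) ≤ δ n / 2) (hf : ∀ n, ‖f (n + 1) - f n‖ ≤ δ n / 2)
    {m n : ℕ} (hmn : m ≤ n) : ‖f n - f m‖ ≤ δ m := by
  suffices h : ‖f n - f m‖ ≤ δ m - δ n by linarith [h0 n]
  induction n, hmn using Nat.le_induction with
  | base => simp
  | succ n hn ih =>
    have h1 := norm_add_le (f (n + 1) - f n) (f n - f m)
    rw [sub_add_sub_cancel] at h1
    linarith [hf n, hδ n]

/-- Smooth functions whose consecutive differences decrease geometrically, in more and more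
derivatives, have a smooth limit, which is `C¹`-close to each of them. -/
theorem exists_smooth_limit {g : ℕ → R4 → ℝ} {δ : ℕ → ℝ} (hgs : ∀ n, ContDiff ℝ ∞ (g n))
    (hδ0 : ∀ n, 0 < δ n) (hδ : ∀ n, δ (n + 1) ≤ δ n / 2)
    (hinc : ∀ n j, j ≤ n + 1 → ∀ x, ‖iteratedFDeriv ℝ j (g (n + 1) - g n) x‖ ≤ δ n / 2) :
    ∃ G : R4 → ℝ, ContDiff ℝ ∞ G ∧
      (∀ x, Filter.Tendsto (fun n => g n x) Filter.atTop (𝓝 (G x))) ∧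
      (∀ x n, ‖G x - g n x‖ ≤ δ n) ∧ (∀ x n, ‖fderiv ℝ G x - fderiv ℝ (g n) x‖ ≤ δ n) ∧
      ∀ x {m n : ℕ}, m ≤ n → ‖g n x - g m x‖ ≤ δ m := by
  have hval : ∀ x {m n : ℕ}, m ≤ n → ‖g n x - g m x‖ ≤ δ m := fun x m n hmn =>
    norm_sub_le_of_halving (f := fun n => g n x) hδ0 hδ (fun n => by
      have := hinc n 0 (Nat.zero_le _) x
      rwa [norm_iteratedFDeriv_zero] at this) hmn
  have hder : ∀ x {m n : ℕ}, m ≤ n → ‖fderiv ℝ (g n) x - fderiv ℝ (g m) x‖ ≤ δ m :=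
    fun x m n hmn => norm_sub_le_of_halving (f := fun n => fderiv ℝ (g n) x) hδ0 hδ (fun n => by
      have h1 : DifferentiableAt ℝ (g (n + 1)) x := (hgs _).differentiable (by simp) _
      have h2 : DifferentiableAt ℝ (g n) x := (hgs _).differentiable (by simp) _
      have := hinc n 1 (by omega) x
      rwa [norm_iteratedFDeriv_one, fderiv_sub h1 h2] at this) hmn
  have hδgeo : ∀ n, δ n ≤ δ 0 * (1 / 2) ^ n := by
    intro n
    induction n with
    | zero => simp
    | succ n ih => rw [pow_succ]; linarith [hδ n]
  have hδsum : Summable fun n => δ n / 2 := by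
    refine Summable.of_nonneg_of_le (fun n => (half_pos (hδ0 n)).le) (fun n => ?_)
      (summable_geometric_two.mul_left (δ 0))
    linarith [hδgeo n, hδ0 n]
  set G : R4 → ℝ := fun x => g 0 x + ∑' n, (g (n + 1) - g n) x with hG
  have hGs : ContDiff ℝ ∞ G := by
    refine (hgs 0).add (contDiff_tsum_of_eventually (v := fun _ n => δ n / 2)
      (fun n => (hgs (n + 1)).sub (hgs n)) (fun _ _ => hδsum) fun k _ => ?_)
    rw [Nat.cofinite_eq_atTop]
    filter_upwards [Filter.eventually_ge_atTop k] with n hn x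
    exact hinc n k (by omega) x
  have hlim : ∀ x, Filter.Tendsto (fun n => g n x) Filter.atTop (𝓝 (G x)) := by
    intro x
    have h1 : Summable fun n => (g (n + 1) - g n) x :=
      Summable.of_norm_bounded hδsum fun n => by
        have := hinc n 0 (Nat.zero_le _) x
        rwa [norm_iteratedFDeriv_zero] at this
    have h2 := (h1.hasSum.tendsto_sum_nat).const_add (g 0 x)
    refine h2.congr fun n => ?_
    simp only [Pi.sub_apply]
    rw [Finset.sum_range_sub (fun n => g n x)]
    ring
  have hGval : ∀ x n, ‖G x - g n x‖ ≤ δ n := fun x n =>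
    le_of_tendsto ((hlim x).sub_const _).norm
      (Filter.eventually_atTop.2 ⟨n, fun m hm => hval x hm⟩)
  have hGder : ∀ x n, ‖fderiv ℝ G x - fderiv ℝ (g n) x‖ ≤ δ n := by
    intro x n
    have hLip : ∀ m, n ≤ m → LipschitzWith (δ n).toNNReal (fun x => g m x - g n x) := by
      intro m hm
      refine lipschitzWith_of_nnnorm_fderiv_le
        (((hgs m).sub (hgs n)).differentiable (by simp)) fun y => ?_
      rw [← NNReal.coe_le_coe, coe_nnnorm, Real.coe_toNNReal _ (hδ0 n).le]
      rw [fderiv_fun_sub ((hgs m).differentiable (by simp) y) ((hgs n).differentiable (by simp) y)]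
      exact hder y hm
    have hLipG : LipschitzWith (δ n).toNNReal (fun x => G x - g n x) := by
      refine LipschitzWith.of_dist_le_mul fun y z => ?_
      refine le_of_tendsto (((hlim y).sub_const _).dist ((hlim z).sub_const _))
        (Filter.eventually_atTop.2 ⟨n, fun m hm => (hLip m hm).dist_le_mul y z⟩)
    have h := norm_fderiv_le_of_lipschitz ℝ hLipG (x₀ := x)
    rwa [Real.coe_toNNReal _ (hδ0 n).le, fderiv_fun_sub (hGs.differentiable (by simp) x)
      ((hgs n).differentiable (by simp) x)] at h
  exact ⟨G, hGs, hlim, hGval, hGder, hval⟩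

/-- A stage of the construction: a symmetry, a slope, and a bound for the later changes. -/
structure Stage where
  /-- the conjugating symmetry -/
  symm : ContactSymm
  /-- the slope of the quadratic Hamiltonian -/
  slope : ℝ
  slope_pos : 0 < slope
  /-- a bound for the total change in later stages -/
  tol : ℝ
  tol_pos : 0 < tol

/-- The Hamiltonian of a stage. -/
noncomputable def Stage.ham (s : Stage) : R4 → ℝ := s.symm.ham s.slope

theorem Stage.isHomogHam (s : Stage) : IsHomogHam s.ham := s.symm.isHomogHam_ham s.slope_pos

/-- The next stage connects a given pair of cones, in a way that survives the later changes. -/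
theorem Stage.exists_next (s : Stage) {A B : Set R4} (hA : IsOpen A) (hAne : A.Nonempty)
    (hAc : IsCone A) (hB : IsOpen B) (hBne : B.Nonempty) (hBc : IsCone B) (k : ℕ) :
    ∃ s' : Stage, s'.tol ≤ s.tol / 2 ∧
      (∀ j ≤ k, ∀ x, ‖iteratedFDeriv ℝ j (cutOff s'.ham - cutOff s.ham) x‖ ≤ s.tol / 2) ∧
      (IsPinched s'.ham → ∀ K', IsHomogHam K' → IsPinched K' →
        (∀ x : R4, 1 / 4 < ‖x‖ → ‖x‖ < 4 → ‖fderiv ℝ K' x - fderiv ℝ s'.ham x‖ ≤ s'.tol) →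
        Connects K' A B) := by
  obtain ⟨S', α', hα', hconn, hclose⟩ := s.symm.exists_connecting s.slope_pos hA hAne hB hBne hBc k
    (half_pos s.tol_pos)
  by_cases hp : IsPinched (S'.ham α')
  · obtain ⟨ρ, hρ, hst⟩ := Connects.stable (S'.isHomogHam_ham hα') hp hAc hBc hB hconn
    exact ⟨⟨S', α', hα', min ρ (s.tol / 2), lt_min hρ (half_pos s.tol_pos)⟩, min_le_right _ _,
      hclose, fun _ K' h1 h2 h3 => hst K' h1 h2 fun x hx hx' =>
        (h3 x hx hx').trans (min_le_left _ _)⟩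
  · exact ⟨⟨S', α', hα', s.tol / 2, half_pos s.tol_pos⟩, le_rfl, hclose, fun h => absurd h hp⟩

/-- For a sequence of pairs of open cones, some Hamiltonian has an orbit connecting each pair: the
limit of Hamiltonians conjugate to quadratic ones, each of which deals with one more pair. -/
theorem exists_hamiltonian_connecting (A B : ℕ → Set R4) (hA : ∀ n, IsOpen (A n))
    (hAne : ∀ n, (A n).Nonempty) (hAc : ∀ n, IsCone (A n)) (hB : ∀ n, IsOpen (B n))
    (hBne : ∀ n, (B n).Nonempty) (hBc : ∀ n, IsCone (B n)) :
    ∃ K, IsHomogHam K ∧ ∀ n, Connects K (A n) (B n) := by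
  choose next hnext using fun (n : ℕ) (s : Stage) =>
    s.exists_next (hA n) (hAne n) (hAc n) (hB n) (hBne n) (hBc n) (n + 1)
  let s₀ : Stage := ⟨ContactSymm.refl, 1, one_pos, 1 / 8, by norm_num⟩
  let st : ℕ → Stage := fun n => Nat.rec s₀ next n
  have hst : ∀ n, st (n + 1) = next n (st n) := fun n => rfl
  set δ : ℕ → ℝ := fun n => (st n).tol with hδdef
  have hδ0 : ∀ n, 0 < δ n := fun n => (st n).tol_pos
  have hδ : ∀ n, δ (n + 1) ≤ δ n / 2 := fun n => (hnext n (st n)).1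
  set g : ℕ → R4 → ℝ := fun n => cutOff (st n).ham with hgdef
  have hgs : ∀ n, ContDiff ℝ ∞ (g n) := fun n => contDiff_cutOff (st n).isHomogHam.smooth
  have hinc : ∀ n j, j ≤ n + 1 → ∀ x, ‖iteratedFDeriv ℝ j (g (n + 1) - g n) x‖ ≤ δ n / 2 :=
    fun n => (hnext n (st n)).2.1
  obtain ⟨G, hGs, hlim, hGval, hGder, hval⟩ := exists_smooth_limit hgs hδ0 hδ hinc
  have hg : ∀ n (x : R4), 1 / 4 ≤ ‖x‖ → ‖x‖ ≤ 4 → g n x = (st n).ham x := fun n x h1 h2 => by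
    simp only [hgdef, cutOff, annulusCutoff_eq_one h1 h2, one_mul]
  have hg0 : ∀ u : R4, ‖u‖ = 1 → g 0 u = 1 / 2 := fun u hu => by
    rw [hg 0 u (by rw [hu]; norm_num) (by rw [hu]; norm_num)]
    change ellipsoid 1 u = 1 / 2
    rw [ellipsoid_one, hu]; norm_num
  have hδ00 : δ 0 = 1 / 8 := rfl
  have hpin : ∀ n, IsPinched (st n).ham := fun n => by
    refine isPinched_of_sphere (st n).isHomogHam.zero (st n).isHomogHam.homog fun u hu => ?_
    rw [← hg n u (by rw [hu]; norm_num) (by rw [hu]; norm_num), ← hg0 u hu]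
    have := hval u (Nat.zero_le n)
    rw [Real.norm_eq_abs, hδ00] at this
    linarith
  -- the homogeneous extension
  set K : R4 → ℝ := fun x => ‖x‖ ^ 2 * G (‖x‖⁻¹ • x) with hK
  have hunit : ∀ x : R4, x ≠ 0 → ‖‖x‖⁻¹ • x‖ = 1 := fun x hx => by
    rw [norm_smul, norm_inv, norm_norm, inv_mul_cancel₀ (norm_ne_zero_iff.2 hx)]
  have hKlim : ∀ x, Filter.Tendsto (fun n => (st n).ham x) Filter.atTop (𝓝 (K x)) := by
    intro x
    by_cases hx : x = 0
    · subst hx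
      simp only [hK, norm_zero, (st _).isHomogHam.zero]
      simp
    · refine ((hlim (‖x‖⁻¹ • x)).const_mul (‖x‖ ^ 2)).congr fun n => ?_
      rw [hg n _ (by rw [hunit x hx]; norm_num) (by rw [hunit x hx]; norm_num),
        ← (st n).isHomogHam.homog _ (norm_pos_iff.2 hx), smul_inv_smul₀ (norm_ne_zero_iff.2 hx)]
  have hKG : ∀ x : R4, 1 / 4 ≤ ‖x‖ → ‖x‖ ≤ 4 → K x = G x := fun x h1 h2 =>
    tendsto_nhds_unique (hKlim x) ((hlim x).congr fun n => hg n x h1 h2)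
  have hKhom : ∀ r : ℝ, 0 < r → ∀ x, K (r • x) = r ^ 2 * K x := fun r hr x =>
    tendsto_nhds_unique (hKlim _) (((hKlim x).const_mul _).congr fun n =>
      ((st n).isHomogHam.homog r hr x).symm)
  have hKpin : IsPinched K := by
    refine isPinched_of_sphere (by simp [hK]) hKhom fun u hu => ?_
    rw [hKG u (by rw [hu]; norm_num) (by rw [hu]; norm_num), ← hg0 u hu]
    have := hGval u 0
    rw [Real.norm_eq_abs, hδ00] at this
    linarith
  have hKH : IsHomogHam K :=
    { smooth := by
        intro x hx
        have hn : ContDiffAt ℝ ∞ (fun x : R4 => ‖x‖) x := contDiffAt_norm ℝ hx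
        have h1 : ContDiffAt ℝ ∞ (fun x : R4 => ‖x‖⁻¹ • x) x :=
          (hn.inv (norm_ne_zero_iff.2 hx)).smul contDiffAt_id
        have h2 : ContDiffAt ℝ ∞ (fun x : R4 => G (‖x‖⁻¹ • x)) x := hGs.contDiffAt.comp x h1
        have h3 : ContDiffAt ℝ ∞ (fun x : R4 => ‖x‖ ^ 2) x := hn.pow 2
        exact (h3.mul h2).contDiffWithinAt
      homog := hKhom
      pos := fun x hx => by
        have := (hKpin x).1
        have h2 : 0 < ‖x‖ := norm_pos_iff.2 hx
        have h3 : 0 < ‖x‖ ^ 2 / 4 := by positivity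
        linarith }
  refine ⟨K, hKH, fun n => (hnext n (st n)).2.2 (hpin (n + 1)) K hKH hKpin fun x hx hx' => ?_⟩
  have e1 : K =ᶠ[𝓝 x] G := by
    filter_upwards [continuous_norm.continuousAt.eventually (lt_mem_nhds hx),
      continuous_norm.continuousAt.eventually (gt_mem_nhds hx')] with y hy1 hy2
    exact hKG y hy1.le hy2.le
  have e2 := (cutOff_eventuallyEq (st (n + 1)).ham hx hx').fderiv_eq (𝕜 := ℝ)
  have e3 := hGder x (n + 1)
  rw [← e1.fderiv_eq, e2] at e3
  exact e3

/-! ### Conclusion -/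

/-- If any two open cones are connected by an orbit, the hypersurface contains no closed Lagrangian:
the latter would separate two invariant open sets. -/
theorem not_exists_lagrangian_of_connects {K : R4 → ℝ} (hK : IsHomogHam K)
    (h : ∀ A B : Set R4, IsOpen A → IsOpen B → A.Nonempty → B.Nonempty → IsCone A → IsCone B →
      ∃ A' B', A' ⊆ A ∧ B' ⊆ B ∧ Connects K A' B') :
    ¬ ∃ L : Set R4, IsClosedLagrangian L ∧ L ⊆ unitLevel K := by
  rintro ⟨L, hL, hLN⟩
  obtain ⟨U, V, hU, hV, hdisj, -, ⟨O, hO, hUO⟩, ⟨P, hP, hVP⟩, hUinv, -⟩ :=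
    exists_separation hK hL hLN
  -- the open cone over a relatively open set
  have hcone : ∀ O : Set R4, IsOpen O → (unitLevel K ∩ O).Nonempty →
      IsOpen ({0}ᶜ ∩ (fun x => (√(K x))⁻¹ • x) ⁻¹' O) ∧
        ({0}ᶜ ∩ (fun x => (√(K x))⁻¹ • x) ⁻¹' O).Nonempty ∧
        IsCone ({0}ᶜ ∩ (fun x => (√(K x))⁻¹ • x) ⁻¹' O) := by
    intro O hO hne
    refine ⟨?_, ?_, ?_⟩
    · have hc : ContinuousOn (fun x => (√(K x))⁻¹ • x) {0}ᶜ :=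
        ((hK.smooth.continuousOn.sqrt).inv₀
          fun x hx => (Real.sqrt_pos.2 (hK.pos x hx)).ne').smul continuousOn_id
      exact hc.isOpen_inter_preimage isOpen_compl_singleton hO
    · obtain ⟨u, hu, huO⟩ := hne
      refine ⟨u, hK.ne_zero_of_mem hu, ?_⟩
      have : K u = 1 := hu
      simpa [this] using huO
    · intro x hx r hr
      refine ⟨smul_ne_zero hr.ne' hx.1, ?_⟩
      have h1 : (√(K (r • x)))⁻¹ • (r • x) = (√(K x))⁻¹ • x := by
        rw [hK.homog r hr, Real.sqrt_mul (sq_nonneg r), Real.sqrt_sq hr.le, smul_smul, mul_inv,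
          mul_right_comm, inv_mul_cancel₀ hr.ne', one_mul]
      change (√(K (r • x)))⁻¹ • (r • x) ∈ O
      rw [h1]
      exact hx.2
  obtain ⟨o1, n1, c1⟩ := hcone O hO (hUO ▸ hU)
  obtain ⟨o2, n2, c2⟩ := hcone P hP (hVP ▸ hV)
  obtain ⟨A', B', hA', hB', c, hc, hc0, T, -, hcT⟩ := h _ _ o1 o2 n1 n2 c1 c2
  have hr : 0 < (√(K (c 0)))⁻¹ := inv_pos.2 (Real.sqrt_pos.2 (hK.pos _ (hc 0).1))
  have hcr := hc.smul hK hr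
  have hmem : ∀ t, (√(K (c 0)))⁻¹ • c t ∈ unitLevel K := fun t => by
    rw [hc.energy hK 0 t]
    exact hK.smul_mem (hc t).1
  have hreeb : IsReebTrajectory (unitLevel K) fun t => (√(K (c 0)))⁻¹ • c t :=
    (hK.isReebTrajectory_iff _).2 fun t => ⟨hmem t, (hcr t).2⟩
  have h0 : (√(K (c 0)))⁻¹ • c 0 ∈ U := by
    rw [hUO]; exact ⟨hmem 0, (hA' hc0).2⟩
  have hT : (√(K (c 0)))⁻¹ • c T ∈ V := by
    rw [hVP]
    refine ⟨hmem T, ?_⟩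
    rw [hc.energy hK 0 T]
    exact (hB' hcT).2
  exact Set.disjoint_left.1 hdisj (hUinv.2 _ hreeb h0 T) hT

/-- It suffices to connect the cones over the sets of a countable basis of the topology. -/
theorem exists_homogHam_without_lagrangian :
    ∃ K, IsHomogHam K ∧ ¬ ∃ L : Set R4, IsClosedLagrangian L ∧ L ⊆ unitLevel K := by
  obtain ⟨f, hf⟩ := (TopologicalSpace.countable_countableBasis R4).exists_eq_range (by
    obtain ⟨b, hb, -⟩ := (TopologicalSpace.isBasis_countableBasis R4).exists_subset_of_mem_open
      (Set.mem_univ 0) isOpen_univ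
    exact ⟨b, hb⟩)
  have hfm : ∀ n, f n ∈ TopologicalSpace.countableBasis R4 := fun n => hf ▸ Set.mem_range_self n
  -- the cones over the sets of a countable basis
  let cone : ℕ → Set R4 := fun n => ⋃ r : Set.Ioi (0 : ℝ), (fun x : R4 => (r : ℝ) • x) ⁻¹' f n
  have hopen : ∀ n, IsOpen (cone n) := fun n => isOpen_iUnion fun r =>
    (TopologicalSpace.isOpen_of_mem_countableBasis (hfm n)).preimage (continuous_const_smul _)
  have hne : ∀ n, (cone n).Nonempty := fun n => by
    obtain ⟨x, hx⟩ := TopologicalSpace.nonempty_of_mem_countableBasis (hfm n)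
    exact ⟨x, Set.mem_iUnion.2 ⟨⟨1, Set.mem_Ioi.2 one_pos⟩, by simpa using hx⟩⟩
  have hc : ∀ n, IsCone (cone n) := fun n x hx r hr => by
    obtain ⟨s, hs⟩ := Set.mem_iUnion.1 hx
    refine Set.mem_iUnion.2 ⟨⟨s / r, div_pos s.2 hr⟩, ?_⟩
    change ((s : ℝ) / r) • r • x ∈ f n
    rw [smul_smul, div_mul_cancel₀ _ hr.ne']
    exact hs
  have hsub : ∀ A : Set R4, IsOpen A → A.Nonempty → IsCone A → ∃ n, cone n ⊆ A := by
    intro A hA hAne hAc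
    obtain ⟨x, hx⟩ := hAne
    obtain ⟨b, hb, -, hbA⟩ :=
      (TopologicalSpace.isBasis_countableBasis R4).exists_subset_of_mem_open hx hA
    obtain ⟨n, rfl⟩ : b ∈ Set.range f := hf ▸ hb
    refine ⟨n, fun y hy => ?_⟩
    obtain ⟨s, hs⟩ := Set.mem_iUnion.1 hy
    have h1 := hAc _ (hbA hs) (s : ℝ)⁻¹ (inv_pos.2 s.2)
    dsimp only at h1
    rwa [inv_smul_smul₀ s.2.ne'] at h1
  obtain ⟨K, hK, hconn⟩ := exists_hamiltonian_connecting
    (fun n => cone n.unpair.1) (fun n => cone n.unpair.2) (fun n => hopen _) (fun n => hne _)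
    (fun n => hc _) (fun n => hopen _) (fun n => hne _) (fun n => hc _)
  refine ⟨K, hK, not_exists_lagrangian_of_connects hK fun A B hA hB hAne hBne hAc hBc => ?_⟩
  obtain ⟨i, hi⟩ := hsub A hA hAne hAc
  obtain ⟨j, hj⟩ := hsub B hB hBne hBc
  have := hconn (Nat.pair i j)
  rw [Nat.unpair_pair] at this
  exact ⟨_, _, hi, hj, this⟩

/-- Each of the two sides of a Lagrangian is invariant, and neither null nor conull. -/
theorem not_isReebErgodic_of_lagrangian {K : R4 → ℝ} (hK : IsHomogHam K) {L : Set R4}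
    (hL : IsClosedLagrangian L) (hLN : L ⊆ unitLevel K) : ¬ IsReebErgodic (unitLevel K) := by
  intro herg
  obtain ⟨U, V, hU, hV, hdisj, hUV, ⟨O, hO, hUO⟩, ⟨P, hP, hVP⟩, hUinv, -⟩ :=
    exists_separation hK hL hLN
  have hm : MeasurableSet U :=
    hUO ▸ hK.isCompact_unitLevel.isClosed.measurableSet.inter hO.measurableSet
  have hVsub : V ⊆ unitLevel K \ U := fun x hx =>
    ⟨(hUV.subset (Or.inr hx)).1, fun hxU => Set.disjoint_left.1 hdisj hxU hx⟩
  rcases herg U hm hUinv with h | h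
  · have := hK.contactVolumeMeasure_pos hO (hUO ▸ hU)
    rw [← hUO, h] at this
    exact lt_irrefl _ this
  · have h1 := hK.contactVolumeMeasure_pos hP (hVP ▸ hV)
    rw [← hVP] at h1
    exact (h1.trans_le (measure_mono hVsub)).ne' h

/-- A trajectory stays in one of the two sides of a Lagrangian, or in the Lagrangian. -/
theorem not_hasDenseReebTrajectory_of_lagrangian {K : R4 → ℝ} (hK : IsHomogHam K) {L : Set R4}
    (hL : IsClosedLagrangian L) (hLN : L ⊆ unitLevel K) :
    ¬ HasDenseReebTrajectory (unitLevel K) := by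
  rintro ⟨c, hc, hdense⟩
  obtain ⟨U, V, hU, hV, hdisj, hUV, ⟨O, hO, hUO⟩, ⟨P, hP, hVP⟩, hUinv, hVinv⟩ :=
    exists_separation hK hL hLN
  have hmeet : ∀ W O : Set R4, IsOpen O → W = unitLevel K ∩ O → W.Nonempty → ∃ t, c t ∈ W := by
    rintro W O hO rfl ⟨x, hx, hxO⟩
    obtain ⟨_, hy, t, rfl⟩ := mem_closure_iff.1 (hdense hx) O hO hxO
    exact ⟨t, (hc t).1, hy⟩
  obtain ⟨s, hs⟩ := hmeet U O hO hUO hU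
  obtain ⟨t, ht⟩ := hmeet V P hP hVP hV
  by_cases h0 : c 0 ∈ L
  · exact (hUV.subset (Or.inl hs)).2 (reebTrajectory_mem_lagrangian hK hL hLN hc h0 s)
  rcases (hUV.symm.subset ⟨(hc 0).1, h0⟩ : c 0 ∈ U ∪ V) with h | h
  · exact Set.disjoint_left.1 hdisj (hUinv.2 c hc h t) ht
  · exact Set.disjoint_left.1 hdisj hs (hVinv.2 c hc h s)

theorem mainTheorem10 :
    -- some closed starshaped hypersurface contains no closed Lagrangian
    (∃ N : Set R4, IsClosedStarshapedHypersurface N ∧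
      ¬ ∃ L : Set R4, IsClosedLagrangian L ∧ L ⊆ N) ∧
    -- none with an ergodic Reeb flow does
    (∀ N : Set R4, IsClosedStarshapedHypersurface N → IsReebErgodic N →
      ¬ ∃ L : Set R4, IsClosedLagrangian L ∧ L ⊆ N) ∧
    -- none with a dense Reeb trajectory does
    (∀ N : Set R4, IsClosedStarshapedHypersurface N → HasDenseReebTrajectory N →
      ¬ ∃ L : Set R4, IsClosedLagrangian L ∧ L ⊆ N) ∧
    -- a closed Lagrangian separates a closed starshaped hypersurface into two invariant open sets
    (∀ N : Set R4, IsClosedStarshapedHypersurface N →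
      ∀ L : Set R4, IsClosedLagrangian L → L ⊆ N →
        ∃ U V : Set R4, U.Nonempty ∧ V.Nonempty ∧ Disjoint U V ∧ U ∪ V = N \ L ∧
          (∃ O : Set R4, IsOpen O ∧ U = N ∩ O) ∧ (∃ O : Set R4, IsOpen O ∧ V = N ∩ O) ∧
          IsReebInvariant N U ∧ IsReebInvariant N V) := by
  refine ⟨?_, ?_, ?_, ?_⟩
  · obtain ⟨K, hK, h⟩ := exists_homogHam_without_lagrangian
    exact ⟨_, hK.isClosedStarshapedHypersurface, h⟩
  · rintro N hN herg ⟨L, hL, hLN⟩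
    obtain ⟨K, hK, rfl⟩ := hN.exists_homogHam
    exact not_isReebErgodic_of_lagrangian hK hL hLN herg
  · rintro N hN hdense ⟨L, hL, hLN⟩
    obtain ⟨K, hK, rfl⟩ := hN.exists_homogHam
    exact not_hasDenseReebTrajectory_of_lagrangian hK hL hLN hdense
  · intro N hN L hL hLN
    obtain ⟨K, hK, rfl⟩ := hN.exists_homogHam
    exact exists_separation hK hL hLN
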